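/- Let $X$ be a smooth projective connected curve over an algebraically closed field $k$. For an integer $n\ge 0$ let $X^{(n)}$ be the $n$-th symmetric power of $X$: for a $k$-scheme $S$, an $S$-point of $X^{(n)}$ is a line bundle $L$ on $X\times S$ together with a map $L\to\mathcal O_{X\times S}$ whose restriction to $X\times\bar s$ is, for every geometric point $\bar s\to S$, generically an isomorphism and of relative degree $n$ (i.e. it corresponds to an effective divisor of degree $n$), up to isomorphism. Let $Y^n$ be the $k$-scheme whose $S$-points are the isomorphism classes of the following data: vector bundles $E_1,E_2$ of rank $2$ on $X\times S$ with trivializations of $\det E_1$ and $\det E_2$; a map $\varphi:E_1\to E_2$ whose restriction to $X\times\bar s$ is nonzero for every geometric point $\bar s\to S$; a line subbundle $L\hookrightarrow E_1$; and a surjection $E_2\twoheadrightarrow\mathcal O_{X\times S}$; such that the composite $L\to E_1\xrightarrow{\varphi}E_2\to\mathcal O_{X\times S}$ restricted to $X\times\bar s$ is, for every geometric point $\bar s\to S$, generically an isomorphism and of relative degree $n$. Let $\pi_n:Y^n\to X^{(n)}$ be the map that remembers only the composite $L\to\mathcal O_{X\times S}$, and let $v:Y^n\to\mathbb A^1$ be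 the map given by $\det\varphi\in\Gamma(X\times S,\mathcal O)=\Gamma(S,\mathcal O)=\mathbb A^1(S)$. For $c\in k=\mathbb A^1(k)$ let $Y^n_c=v^{-1}(c)$. Let $n=n_1+n_2$ with $n_1,n_2\ge 0$. Let $X^{(n_1)}\overset{\circ}{\times}X^{(n_2)}\subset X^{(n_1)}\times X^{(n_2)}$ be the open locus of pairs of effective divisors with disjoint supports, and let $Y^{n_1}\overset{\circ}{\times}_{\mathbb A^1}Y^{n_2}$ and $Y^{n_1}_c\overset{\circ}{\times}Y^{n_2}_c$ be the inverse images of this locus under $\pi_{n_1}\times\pi_{n_2}$ in $Y^{n_1}\times_{\mathbb A^1}Y^{n_2}$ and in $Y^{n_1}_c\times Y^{n_2}_c$. Then: (1) There is a morphism $t:Y^{n_1}\overset{\circ}{\times}_{\mathbb A^1}Y^{n_2}\to Y^n$ that makes the square $$\begin{array}{ccc} Y^{n_1}\overset{\circ}{\times}_{\mathbb A^1}Y^{n_2} & \xrightarrow{\;t\;} & Y^n\\ {\scriptstyle \pi_{n_1}\times\pi_{n_2}}\downarrow & & \downarrow{\scriptstyle \pi_n}\\ X^{(n_1)}\overset{\circ}{\times}X^{(n_2)}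 & \longrightarrow & X^{(n)}\end{array}$$ cartesian, where the lower arrow is the addition of effective divisors, and that commutes with the natural maps to $\mathbb A^1$. Moreover $t$ is the natural map: for every $S$-point $(y_1,y_2)$ of its source, with associated divisors $D_1,D_2\subset X\times S$, the data $t(y_1,y_2)$ are isomorphic to $y_1$ over $(X\times S)\setminus D_2$ and to $y_2$ over $(X\times S)\setminus D_1$. (2) For every $c\in k$, the map $t$ restricts to a morphism $Y^{n_1}_c\overset{\circ}{\times}Y^{n_2}_c\to Y^n_c$ that makes the square $$\begin{array}{ccc} Y^{n_1}_c\overset{\circ}{\times}Y^{n_2}_c & \longrightarrow & Y^n_c\\ {\scriptstyle \pi_{n_1}\times\pi_{n_2}}\downarrow & & \downarrow{\scriptstyle \pi_n}\\ X^{(n_1)}\overset{\circ}{\times}X^{(n_2)} & \longrightarrow & X^{(n)}\end{array}$$ cartesian. -/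

import Mathlib

open CategoryTheory AlgebraicGeometry Limits Opposite TopologicalSpace

universe u

namespace VinLoc

noncomputable section

/-! ### Functions on open subsets, and matrices of functions -/

/-- Restriction of functions from `U` to a smaller open subset `V`. -/
def res {Z : Scheme.{u}} {U : Z.Opens} (V : Z.Opens) (h : V ≤ U) : Γ(Z, U) →+* Γ(Z, V) :=
  (Z.presheaf.map (homOfLE h).op).hom

/-- Pullback of functions along `f : Z' ⟶ Z`, from `U` to an open subset `V` of `f⁻¹(U)`. -/
def pb {Z' Z : Scheme.{u}} (f : Z' ⟶ Z) {U : Z.Opens} (V : Z'.Opens) (h : V ≤ f ⁻¹ᵁ U) :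
    Γ(Z, U) →+* Γ(Z', V) :=
  (f.appLE U V h).hom

/-- The germ of a function at a point. -/
def germ {Z : Scheme.{u}} {U : Z.Opens} (z : Z) (h : z ∈ U) : Γ(Z, U) →+* Z.presheaf.stalk z :=
  (Z.presheaf.germ U z h).hom

/-- Entrywise restriction of a matrix of functions. -/
def resM {Z : Scheme.{u}} {U : Z.Opens} (V : Z.Opens) (h : V ≤ U) {m n : Type*}
    (M : Matrix m n Γ(Z, U)) : Matrix m n Γ(Z, V) := M.map (res V h)

/-- Entrywise pullback of a matrix of functions. -/
def pbM {Z' Z : Scheme.{u}} (f : Z' ⟶ Z) {U : Z.Opens} (V : Z'.Opens) (h : V ≤ f ⁻¹ᵁ U)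
    {m n : Type*} (M : Matrix m n Γ(Z, U)) : Matrix m n Γ(Z', V) := M.map (pb f V h)

/-- The entry of a `1 × 1` matrix. -/
def ent {R : Type*} (M : Matrix (Fin 1) (Fin 1) R) : R := M 0 0

section lemmas

variable {Z Z' Z'' : Scheme.{u}} {l m n : Type*}

@[simp] theorem res_self {U : Z.Opens} (h : U ≤ U) (a : Γ(Z, U)) : res U h a = a := by
  simp [res]

@[simp] theorem res_res {U V W : Z.Opens} (h : V ≤ U) (h' : W ≤ V) (a : Γ(Z, U)) :
    res W h' (res V h a) = res W (h'.trans h) a := by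
  simp only [res, ← RingHom.comp_apply, ← CommRingCat.hom_comp, ← Functor.map_comp]
  rfl

@[simp] theorem res_pb (f : Z' ⟶ Z) {U : Z.Opens} {V W : Z'.Opens} (h : V ≤ f ⁻¹ᵁ U)
    (h' : W ≤ V) (a : Γ(Z, U)) : res W h' (pb f V h a) = pb f W (h'.trans h) a := by
  simp only [res, pb, ← RingHom.comp_apply, ← CommRingCat.hom_comp, Scheme.Hom.appLE_map]

@[simp] theorem pb_res (f : Z' ⟶ Z) {U V : Z.Opens} {W : Z'.Opens} (h : V ≤ U)
    (h' : W ≤ f ⁻¹ᵁ V) (a : Γ(Z, U)) :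
    pb f W h' (res V h a) = pb f W (h'.trans ((Opens.map f.base).map (homOfLE h)).le) a := by
  simp only [res, pb, ← RingHom.comp_apply, ← CommRingCat.hom_comp, Scheme.Hom.map_appLE]

@[simp] theorem pb_pb (f : Z' ⟶ Z) (g : Z'' ⟶ Z') {U : Z.Opens} {V : Z'.Opens} {W : Z''.Opens}
    (h : V ≤ f ⁻¹ᵁ U) (h' : W ≤ g ⁻¹ᵁ V) (a : Γ(Z, U)) :
    pb g W h' (pb f V h a) =
      pb (g ≫ f) W (h'.trans ((Opens.map g.base).map (homOfLE h)).le) a := by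
  simp only [pb, ← RingHom.comp_apply, ← CommRingCat.hom_comp, Scheme.Hom.appLE_comp_appLE]

theorem pb_id {U V : Z.Opens} (h : V ≤ (𝟙 Z : Z ⟶ Z) ⁻¹ᵁ U) (a : Γ(Z, U)) :
    pb (𝟙 Z) V h a = res V (show V ≤ U from h) a := by
  simp [pb, res]; rfl

@[simp] theorem germ_res {U V : Z.Opens} (h : V ≤ U) {z : Z} (hz : z ∈ V) (a : Γ(Z, U)) :
    germ z hz (res V h a) = germ z (h hz) a := by
  simp only [res, germ, ← RingHom.comp_apply, ← CommRingCat.hom_comp, TopCat.Presheaf.germ_res]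

@[simp] theorem resM_self {U : Z.Opens} (h : U ≤ U) (M : Matrix m n Γ(Z, U)) :
    resM U h M = M := by
  ext; simp [resM]

@[simp] theorem resM_resM {U V W : Z.Opens} (h : V ≤ U) (h' : W ≤ V) (M : Matrix m n Γ(Z, U)) :
    resM W h' (resM V h M) = resM W (h'.trans h) M := by
  ext; simp [resM]

@[simp] theorem resM_pbM (f : Z' ⟶ Z) {U : Z.Opens} {V W : Z'.Opens} (h : V ≤ f ⁻¹ᵁ U)
    (h' : W ≤ V) (M : Matrix m n Γ(Z, U)) : resM W h' (pbM f V h M) = pbM f W (h'.trans h) M := by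
  ext; simp [resM, pbM]

@[simp] theorem pbM_resM (f : Z' ⟶ Z) {U V : Z.Opens} {W : Z'.Opens} (h : V ≤ U)
    (h' : W ≤ f ⁻¹ᵁ V) (M : Matrix m n Γ(Z, U)) :
    pbM f W h' (resM V h M) = pbM f W (h'.trans ((Opens.map f.base).map (homOfLE h)).le) M := by
  ext; simp [resM, pbM]

@[simp] theorem pbM_pbM (f : Z' ⟶ Z) (g : Z'' ⟶ Z') {U : Z.Opens} {V : Z'.Opens} {W : Z''.Opens}
    (h : V ≤ f ⁻¹ᵁ U) (h' : W ≤ g ⁻¹ᵁ V) (M : Matrix m n Γ(Z, U)) :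
    pbM g W h' (pbM f V h M) =
      pbM (g ≫ f) W (h'.trans ((Opens.map g.base).map (homOfLE h)).le) M := by
  ext; simp [pbM]

theorem pbM_id {U V : Z.Opens} (h : V ≤ (𝟙 Z : Z ⟶ Z) ⁻¹ᵁ U) (M : Matrix m n Γ(Z, U)) :
    pbM (𝟙 Z) V h M = resM V (show V ≤ U from h) M := by
  ext; simp [resM, pbM, pb_id]

@[simp] theorem resM_mul {U V : Z.Opens} [Fintype m] (h : V ≤ U) (M : Matrix l m Γ(Z, U))
    (N : Matrix m n Γ(Z, U)) : resM V h (M * N) = resM V h M * resM V h N := Matrix.map_mul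

@[simp] theorem pbM_mul {U : Z.Opens} {V : Z'.Opens} [Fintype m] (f : Z' ⟶ Z) (h : V ≤ f ⁻¹ᵁ U)
    (M : Matrix l m Γ(Z, U)) (N : Matrix m n Γ(Z, U)) :
    pbM f V h (M * N) = pbM f V h M * pbM f V h N := Matrix.map_mul

@[simp] theorem resM_one {U V : Z.Opens} [DecidableEq m] (h : V ≤ U) :
    resM V h (1 : Matrix m m Γ(Z, U)) = 1 :=
  Matrix.map_one _ (map_zero _) (map_one _)

@[simp] theorem pbM_one {U : Z.Opens} {V : Z'.Opens} [DecidableEq m] (f : Z' ⟶ Z)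
    (h : V ≤ f ⁻¹ᵁ U) : pbM f V h (1 : Matrix m m Γ(Z, U)) = 1 :=
  Matrix.map_one _ (map_zero _) (map_one _)

variable {U V : Z.Opens} {V' : Z'.Opens} [Fintype m] [DecidableEq m]

@[simp] theorem det_resM (h : V ≤ U) (M : Matrix m m Γ(Z, U)) :
    (resM V h M).det = res V h M.det :=
  ((res V h).map_det M).symm

@[simp] theorem det_pbM (f : Z' ⟶ Z) (h : V' ≤ f ⁻¹ᵁ U) (M : Matrix m m Γ(Z, U)) :
    (pbM f V' h M).det = pb f V' h M.det :=
  ((pb f V' h).map_det M).symm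

@[simp] theorem resM_scalar (h : V ≤ U) (a : Γ(Z, U)) :
    resM V h (Matrix.scalar m a) = Matrix.scalar m (res V h a) := by
  simp [resM, Matrix.diagonal_map]

@[simp] theorem pbM_scalar (f : Z' ⟶ Z) (h : V' ≤ f ⁻¹ᵁ U) (a : Γ(Z, U)) :
    pbM f V' h (Matrix.scalar m a) = Matrix.scalar m (pb f V' h a) := by
  simp [pbM, Matrix.diagonal_map]

@[simp] theorem ent_mul {R : Type*} [CommRing R] (M N : Matrix (Fin 1) (Fin 1) R) :
    ent (M * N) = ent M * ent N := by
  simp [ent, Matrix.mul_apply]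

@[simp] theorem ent_one {R : Type*} [CommRing R] : ent (1 : Matrix (Fin 1) (Fin 1) R) = 1 := rfl

@[simp] theorem ent_scalar {R : Type*} [CommRing R] (a : R) :
    ent (Matrix.scalar (Fin 1) a) = a := rfl

@[simp] theorem ent_resM (h : V ≤ U) (M : Matrix (Fin 1) (Fin 1) Γ(Z, U)) :
    ent (resM V h M) = res V h (ent M) := rfl

@[simp] theorem ent_pbM (f : Z' ⟶ Z) (h : V' ≤ f ⁻¹ᵁ U) (M : Matrix (Fin 1) (Fin 1) Γ(Z, U)) :
    ent (pbM f V' h M) = pb f V' h (ent M) := rfl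

theorem ent_injective {R : Type*} : Function.Injective (ent (R := R)) := fun M N h ↦ by
  ext i j
  obtain rfl := Subsingleton.elim i 0
  obtain rfl := Subsingleton.elim j 0
  exact h

end lemmas

/-! ### Vector bundles -/

/-- An open cover of `Z`, given by the choice of an open neighbourhood of every point. -/
structure Cover (Z : Scheme.{u}) where
  U : Z → Z.Opens
  mem : ∀ z, z ∈ U z

/-- The preimage of an open cover under a morphism. -/
@[simps]
def Cover.preimage {Z Z' : Scheme.{u}} (f : Z' ⟶ Z) (𝒰 : Cover Z) : Cover Z' where
  U z := f ⁻¹ᵁ 𝒰.U (f z)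
  mem z := 𝒰.mem (f z)

/-- The common refinement of two open covers. -/
@[simps]
def Cover.inf {Z : Scheme.{u}} (𝒰 𝒱 : Cover Z) : Cover Z where
  U z := 𝒰.U z ⊓ 𝒱.U z
  mem z := ⟨𝒰.mem z, 𝒱.mem z⟩

/-- `𝒲` refines the preimage of `𝒰` under `f`. -/
def Cover.Refines {Z Z' : Scheme.{u}} (f : Z' ⟶ Z) (𝒲 : Cover Z') (𝒰 : Cover Z) : Prop :=
  ∀ z, 𝒲.U z ≤ f ⁻¹ᵁ 𝒰.U (f z)

theorem Cover.Refines.inf {Z Z' : Scheme.{u}} {f : Z' ⟶ Z} {𝒲 : Cover Z'} {𝒰 : Cover Z}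
    (h : Cover.Refines f 𝒲 𝒰) (z w : Z') :
    𝒲.U z ⊓ 𝒲.U w ≤ f ⁻¹ᵁ (𝒰.U (f z) ⊓ 𝒰.U (f w)) :=
  inf_le_inf (h z) (h w)

theorem Cover.Refines.inf₃ {Z Z' : Scheme.{u}} {f : Z' ⟶ Z} {𝒲 : Cover Z'} {𝒰 : Cover Z}
    (h : Cover.Refines f 𝒲 𝒰) (z w v : Z') :
    𝒲.U z ⊓ 𝒲.U w ⊓ 𝒲.U v ≤ f ⁻¹ᵁ (𝒰.U (f z) ⊓ 𝒰.U (f w) ⊓ 𝒰.U (f v)) :=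
  inf_le_inf (inf_le_inf (h z) (h w)) (h v)

/-- A vector bundle of rank `r` on `Z` together with a trivialization over every member of the
open cover `𝒰`, given by its transition matrices: a section is a family of column vectors
`s z` of functions on `𝒰.U z` with `s z = g z w * s w` on the overlaps. -/
@[ext]
structure Bundle {Z : Scheme.{u}} (𝒰 : Cover Z) (r : ℕ) where
  g : ∀ z w : Z, Matrix (Fin r) (Fin r) Γ(Z, 𝒰.U z ⊓ 𝒰.U w)
  g_self : ∀ z, g z z = 1
  g_mul : ∀ z w v,
    resM (𝒰.U z ⊓ 𝒰.U w ⊓ 𝒰.U v) inf_le_left (g z w) *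
      resM (𝒰.U z ⊓ 𝒰.U w ⊓ 𝒰.U v) (inf_le_inf_right _ inf_le_right) (g w v) =
    resM (𝒰.U z ⊓ 𝒰.U w ⊓ 𝒰.U v) (inf_le_inf_right _ inf_le_left) (g z v)

/-- A homomorphism of vector bundles: a family of matrices of functions on the members of the
cover which is compatible with the transition matrices. -/
@[ext]
structure BHom {Z : Scheme.{u}} {𝒰 : Cover Z} {r s : ℕ} (E : Bundle 𝒰 r) (F : Bundle 𝒰 s) where
  m : ∀ z : Z, Matrix (Fin s) (Fin r) Γ(Z, 𝒰.U z)
  comm : ∀ z w : Z,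
    resM (𝒰.U z ⊓ 𝒰.U w) inf_le_left (m z) * E.g z w =
      F.g z w * resM (𝒰.U z ⊓ 𝒰.U w) inf_le_right (m w)

/-- The trivial vector bundle of rank `r`; for `r = 1` this is the structure sheaf. -/
@[simps]
def Bundle.triv {Z : Scheme.{u}} (𝒰 : Cover Z) (r : ℕ) : Bundle 𝒰 r where
  g _ _ := 1
  g_self _ := rfl
  g_mul _ _ _ := by simp only [resM_one, mul_one]

section

variable {Z Z' : Scheme.{u}} {𝒰 : Cover Z}

theorem Bundle.g_mul_symm {r : ℕ} (E : Bundle 𝒰 r) (z w : Z) :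
    E.g z w * resM (𝒰.U z ⊓ 𝒰.U w) (inf_comm (𝒰.U w) (𝒰.U z)).ge (E.g w z) = 1 := by
  have h : 𝒰.U z ⊓ 𝒰.U w ≤ 𝒰.U z ⊓ 𝒰.U w ⊓ 𝒰.U z := le_inf le_rfl inf_le_left
  simpa [E.g_self] using congrArg (resM _ h) (E.g_mul z w z)

namespace BHom

variable {r s t : ℕ} {E : Bundle 𝒰 r} {F : Bundle 𝒰 s} {G : Bundle 𝒰 t}

theorem comm_congr {E' : Bundle 𝒰 r} {F' : Bundle 𝒰 s} (a : BHom E F) (hE : E = E') (hF : F = F')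
    (z w : Z) : resM (𝒰.U z ⊓ 𝒰.U w) inf_le_left (a.m z) * E'.g z w =
      F'.g z w * resM (𝒰.U z ⊓ 𝒰.U w) inf_le_right (a.m w) := by
  subst hE hF; exact a.comm z w

/-- The identity homomorphism. -/
@[simps]
def id (E : Bundle 𝒰 r) : BHom E E where
  m _ := 1
  comm _ _ := by rw [resM_one, resM_one, Matrix.one_mul, Matrix.mul_one]

/-- The composite `E → F → G`. -/
@[simps]
def comp (a : BHom E F) (b : BHom F G) : BHom E G where
  m z := b.m z * a.m z
  comm z w := by
    rw [resM_mul, resM_mul, Matrix.mul_assoc, a.comm, ← Matrix.mul_assoc, b.comm, Matrix.mul_assoc]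

/-- The homomorphism makes `E` a subbundle of `F`: locally it is a split injection
(equivalently, it is injective on the fibers at all points). -/
def IsSubbundle (a : BHom E F) : Prop :=
  ∀ z, ∃ (V : Z.Opens) (hV : V ≤ 𝒰.U z) (N : Matrix (Fin r) (Fin s) Γ(Z, V)),
    z ∈ V ∧ N * resM V hV (a.m z) = 1

/-- The homomorphism makes `F` a quotient bundle of `E`, i.e. it is surjective: locally it is a
split surjection (equivalently, it is surjective on the fibers at all points). -/
def IsQuotient (a : BHom E F) : Prop :=
  ∀ z, ∃ (V : Z.Opens) (hV : V ≤ 𝒰.U z) (N : Matrix (Fin r) (Fin s) Γ(Z, V)),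
    z ∈ V ∧ resM V hV (a.m z) * N = 1

/-- The homomorphism is not the zero map, i.e. some germ of it is not zero. -/
def IsNonzero (a : BHom E F) : Prop :=
  ∃ z, (a.m z).map (germ z (𝒰.mem z)) ≠ 0

end BHom

/-- An isomorphism of vector bundles. -/
structure BIso {r s : ℕ} (E : Bundle 𝒰 r) (F : Bundle 𝒰 s) where
  hom : BHom E F
  inv : BHom F E
  hom_inv : hom.comp inv = BHom.id E
  inv_hom : inv.comp hom = BHom.id F

/-- The determinant line bundle. -/
@[simps]
def Bundle.det {r : ℕ} (E : Bundle 𝒰 r) : Bundle 𝒰 1 where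
  g z w := Matrix.scalar (Fin 1) (E.g z w).det
  g_self z := by rw [E.g_self, Matrix.det_one, map_one]
  g_mul z w v := by
    rw [resM_scalar, resM_scalar, resM_scalar, ← map_mul, ← det_resM, ← det_resM, ← Matrix.det_mul,
      E.g_mul, det_resM]

/-- The determinant `det E → det F` of a homomorphism of vector bundles of the same rank. -/
@[simps]
def BHom.det {r : ℕ} {E F : Bundle 𝒰 r} (a : BHom E F) : BHom E.det F.det where
  m z := Matrix.scalar (Fin 1) (a.m z).det
  comm z w := by
    rw [Bundle.det_g, Bundle.det_g, resM_scalar, resM_scalar, ← map_mul, ← map_mul, ← det_resM,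
      ← det_resM, ← Matrix.det_mul, ← Matrix.det_mul, a.comm]

/-- The tensor product of two line bundles. -/
@[simps]
def Bundle.tensor (L M : Bundle 𝒰 1) : Bundle 𝒰 1 where
  g z w := Matrix.scalar (Fin 1) (ent (L.g z w) * ent (M.g z w))
  g_self z := by rw [L.g_self, M.g_self, ent_one, mul_one, map_one]
  g_mul z w v := by
    have h₁ := congrArg ent (L.g_mul z w v)
    have h₂ := congrArg ent (M.g_mul z w v)
    apply ent_injective
    simp only [ent_mul, ent_resM, ent_scalar, map_mul] at h₁ h₂ ⊢
    rw [← h₁, ← h₂]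
    ring

/-- The tensor product `L ⊗ M → 𝒪 ⊗ 𝒪 = 𝒪` of two homomorphisms `L → 𝒪` and `M → 𝒪`. -/
@[simps]
def BHom.tensor {L M : Bundle 𝒰 1} (a : BHom L (Bundle.triv 𝒰 1)) (b : BHom M (Bundle.triv 𝒰 1)) :
    BHom (L.tensor M) (Bundle.triv 𝒰 1) where
  m z := Matrix.scalar (Fin 1) (ent (a.m z) * ent (b.m z))
  comm z w := by
    have h₁ := congrArg ent (a.comm z w)
    have h₂ := congrArg ent (b.comm z w)
    apply ent_injective
    simp only [ent_mul, ent_resM, ent_scalar, map_mul, Bundle.tensor_g, Bundle.triv_g,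
      one_mul] at h₁ h₂ ⊢
    rw [← h₁, ← h₂]
    ring

/-! ### Pullback -/

variable (f : Z' ⟶ Z) (𝒲 : Cover Z') (h : Cover.Refines f 𝒲 𝒰)

/-- The pullback of a vector bundle along `f`, with the induced trivializations over the members
of a cover that refines the preimage of the given one. -/
@[simps]
def Bundle.pull {r : ℕ} (E : Bundle 𝒰 r) : Bundle 𝒲 r where
  g z w := pbM f (𝒲.U z ⊓ 𝒲.U w) (h.inf z w) (E.g (f z) (f w))
  g_self z := by rw [E.g_self, pbM_one]
  g_mul z w v := by
    simpa using congrArg (pbM f (𝒲.U z ⊓ 𝒲.U w ⊓ 𝒲.U v) (h.inf₃ z w v))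
      (E.g_mul (f z) (f w) (f v))

/-- The pullback of a homomorphism of vector bundles. -/
@[simps]
def BHom.pull {r s : ℕ} {E : Bundle 𝒰 r} {F : Bundle 𝒰 s} (a : BHom E F) :
    BHom (E.pull f 𝒲 h) (F.pull f 𝒲 h) where
  m z := pbM f (𝒲.U z) (h z) (a.m (f z))
  comm z w := by
    simpa using congrArg (pbM f (𝒲.U z ⊓ 𝒲.U w) (h.inf z w)) (a.comm (f z) (f w))

theorem BHom.pull_id {r : ℕ} (E : Bundle 𝒰 r) :
    (BHom.id E).pull f 𝒲 h = BHom.id (E.pull f 𝒲 h) := by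
  ext1; funext z; exact pbM_one f _

theorem BHom.pull_comp {r s t : ℕ} {E : Bundle 𝒰 r} {F : Bundle 𝒰 s} {G : Bundle 𝒰 t}
    (a : BHom E F) (b : BHom F G) :
    (a.comp b).pull f 𝒲 h = (a.pull f 𝒲 h).comp (b.pull f 𝒲 h) := by
  ext1; funext z; exact pbM_mul f _ _ _

theorem Bundle.pull_triv (r : ℕ) :
    (Bundle.triv 𝒰 r).pull f 𝒲 h = Bundle.triv 𝒲 r := by
  ext1; funext z w; exact pbM_one f _

theorem Bundle.pull_det {r : ℕ} (E : Bundle 𝒰 r) :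
    E.det.pull f 𝒲 h = (E.pull f 𝒲 h).det := by
  ext1; funext z w
  simp [-Matrix.scalar_apply]

/-- The pullback of an isomorphism of vector bundles. -/
@[simps]
def BIso.pull {r s : ℕ} {E : Bundle 𝒰 r} {F : Bundle 𝒰 s} (a : BIso E F) :
    BIso (E.pull f 𝒲 h) (F.pull f 𝒲 h) where
  hom := a.hom.pull f 𝒲 h
  inv := a.inv.pull f 𝒲 h
  hom_inv := by rw [← BHom.pull_comp, a.hom_inv, BHom.pull_id]
  inv_hom := by rw [← BHom.pull_comp, a.inv_hom, BHom.pull_id]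

/-- The pullback of a map `E → 𝒪^r`, followed by the identification of the pullback of `𝒪^r`
with `𝒪^r`. -/
@[simps]
def BHom.pullToTriv {r s : ℕ} {E : Bundle 𝒰 s} (a : BHom E (Bundle.triv 𝒰 r)) :
    BHom (E.pull f 𝒲 h) (Bundle.triv 𝒲 r) where
  m z := pbM f (𝒲.U z) (h z) (a.m (f z))
  comm := (a.pull f 𝒲 h).comm_congr rfl (Bundle.pull_triv f 𝒲 h r)

/-- The pullback of a trivialization of the determinant of `E`. -/
@[simps]
def BIso.pullDet {r : ℕ} {E : Bundle 𝒰 r} (a : BIso E.det (Bundle.triv 𝒰 1)) :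
    BIso (E.pull f 𝒲 h).det (Bundle.triv 𝒲 1) where
  hom :=
    { m z := pbM f (𝒲.U z) (h z) (a.hom.m (f z))
      comm := (a.hom.pull f 𝒲 h).comm_congr (Bundle.pull_det f 𝒲 h E) (Bundle.pull_triv f 𝒲 h 1) }
  inv :=
    { m z := pbM f (𝒲.U z) (h z) (a.inv.m (f z))
      comm := (a.inv.pull f 𝒲 h).comm_congr (Bundle.pull_triv f 𝒲 h 1) (Bundle.pull_det f 𝒲 h E) }
  hom_inv := by
    ext1; funext z
    exact congrFun (congrArg BHom.m (a.pull f 𝒲 h).hom_inv) z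
  inv_hom := by
    ext1; funext z
    exact congrFun (congrArg BHom.m (a.pull f 𝒲 h).inv_hom) z

end

/-! ### Global functions as endomorphisms of the structure sheaf -/

theorem BHom.existsUnique_section {Z : Scheme.{u}} {𝒰 : Cover Z}
    (a : BHom (Bundle.triv 𝒰 1) (Bundle.triv 𝒰 1)) :
    ∃! d : Γ(Z, ⊤), ∀ z, res (𝒰.U z) le_top d = ent (a.m z) := by
  refine Z.sheaf.existsUnique_gluing' 𝒰.U ⊤ (fun z ↦ homOfLE le_top)
    (fun z _ ↦ Opens.mem_iSup.mpr ⟨z, 𝒰.mem z⟩) (fun z ↦ ent (a.m z)) fun z w ↦ ?_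
  have := congrArg ent (a.comm z w)
  simp only [Bundle.triv_g, mul_one, one_mul, ent_resM] at this
  exact this

/-- The global function by which an endomorphism of the structure sheaf multiplies. -/
def BHom.toSection {Z : Scheme.{u}} {𝒰 : Cover Z}
    (a : BHom (Bundle.triv 𝒰 1) (Bundle.triv 𝒰 1)) : Γ(Z, ⊤) :=
  a.existsUnique_section.choose

theorem BHom.res_toSection {Z : Scheme.{u}} {𝒰 : Cover Z}
    (a : BHom (Bundle.triv 𝒰 1) (Bundle.triv 𝒰 1)) (z : Z) :
    res (𝒰.U z) le_top a.toSection = ent (a.m z) :=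
  a.existsUnique_section.choose_spec.1 z

theorem BHom.eq_toSection {Z : Scheme.{u}} {𝒰 : Cover Z}
    (a : BHom (Bundle.triv 𝒰 1) (Bundle.triv 𝒰 1)) (d : Γ(Z, ⊤))
    (h : ∀ z, res (𝒰.U z) le_top d = ent (a.m z)) : d = a.toSection :=
  a.existsUnique_section.choose_spec.2 d h

/-! ### Line bundles with a map to the structure sheaf -/

/-- A line bundle with a map `L → 𝒪`, trivialized over the members of the cover `𝒰`. -/
structure LineMapOn {Z : Scheme.{u}} (𝒰 : Cover Z) where
  L : Bundle 𝒰 1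
  s : BHom L (Bundle.triv 𝒰 1)

/-- An isomorphism of line bundles that is compatible with the maps to `𝒪`. -/
structure LineMapOn.Iso {Z : Scheme.{u}} {𝒰 : Cover Z} (D D' : LineMapOn 𝒰) where
  a : BIso D.L D'.L
  comm_s : a.hom.comp D'.s = D.s

/-- The pullback of `L → 𝒪` along `f`. -/
@[simps]
def LineMapOn.pull {Z Z' : Scheme.{u}} {𝒰 : Cover Z} (f : Z' ⟶ Z) (𝒲 : Cover Z')
    (h : Cover.Refines f 𝒲 𝒰) (D : LineMapOn 𝒰) : LineMapOn 𝒲 where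
  L := D.L.pull f 𝒲 h
  s := D.s.pullToTriv f 𝒲 h

/-- The tensor product `L ⊗ L' → 𝒪` of `L → 𝒪` and `L' → 𝒪`. -/
@[simps]
def LineMapOn.tensor {Z : Scheme.{u}} {𝒰 : Cover Z} (D D' : LineMapOn 𝒰) : LineMapOn 𝒰 where
  L := D.L.tensor D'.L
  s := D.s.tensor D'.s

/-- A line bundle on `Z` with a map `L → 𝒪` (together with local trivializations of `L`). -/
structure LineMap (Z : Scheme.{u}) where
  cover : Cover Z
  on : LineMapOn cover

/-- The pullback of `L → 𝒪` along `f`. -/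
@[simps]
def LineMap.pull {Z Z' : Scheme.{u}} (f : Z' ⟶ Z) (D : LineMap Z) : LineMap Z' where
  cover := D.cover.preimage f
  on := D.on.pull f _ fun _ ↦ le_rfl

/-- Two pairs `L → 𝒪` and `L' → 𝒪` are isomorphic if they are so after restricting the local
trivializations to a common refinement of the two covers. -/
def LineMap.Equiv {Z : Scheme.{u}} (D D' : LineMap Z) : Prop :=
  ∃ (𝒲 : Cover Z) (h : Cover.Refines (𝟙 Z) 𝒲 D.cover) (k : Cover.Refines (𝟙 Z) 𝒲 D'.cover),
    Nonempty ((D.on.pull (𝟙 Z) 𝒲 h).Iso (D'.on.pull (𝟙 Z) 𝒲 k))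

/-- The tensor product `L ⊗ L' → 𝒪` of `L → 𝒪` and `L' → 𝒪`. -/
@[simps]
def LineMap.tensor {Z : Scheme.{u}} (D D' : LineMap Z) : LineMap Z where
  cover := D.cover.inf D'.cover
  on := (D.on.pull (𝟙 Z) _ fun _ ↦ inf_le_left).tensor (D'.on.pull (𝟙 Z) _ fun _ ↦ inf_le_right)

/-- The largest open subset on which the map `L → 𝒪` is an isomorphism. -/
def LineMap.isoLocus {Z : Scheme.{u}} (D : LineMap Z) : Z.Opens :=
  ⨆ z, Z.basicOpen (ent (D.on.s.m z))

/-- The germ at `z` of a local equation of the divisor defined by `L → 𝒪`. -/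
def LineMap.eqn {Z : Scheme.{u}} (D : LineMap Z) (z : Z) : Z.presheaf.stalk z :=
  germ z (D.cover.mem z) (ent (D.on.s.m z))

/-- The degree of the effective Cartier divisor defined by `L → 𝒪` on a curve over an
algebraically closed field: the sum of its multiplicities at all points, the multiplicity at `z`
being the length of the local ring `𝒪_z` modulo a local equation of the divisor. -/
def LineMap.HasDegree {Z : Scheme.{u}} (D : LineMap Z) (n : ℕ) : Prop :=
  HasSum (fun z : Z ↦ Module.length (Z.presheaf.stalk z)
    (Z.presheaf.stalk z ⧸ Ideal.span {D.eqn z})) (n : ℕ∞)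

section

variable {Z Z' Z'' : Scheme.{u}}

theorem LineMapOn.ext' {𝒰 : Cover Z} {D D' : LineMapOn 𝒰} (h : D.L = D'.L)
    (h' : D.s.m = D'.s.m) : D = D' := by
  obtain ⟨L, s⟩ := D
  obtain ⟨L', s'⟩ := D'
  obtain rfl : L = L' := h
  congr 1
  exact BHom.ext h'

theorem LineMapOn.pull_pull {𝒰 : Cover Z} {𝒱 : Cover Z'} {𝒲 : Cover Z''} (f : Z' ⟶ Z)
    (g : Z'' ⟶ Z') (h : Cover.Refines f 𝒱 𝒰) (h' : Cover.Refines g 𝒲 𝒱)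
    (h'' : Cover.Refines (g ≫ f) 𝒲 𝒰) (D : LineMapOn 𝒰) :
    (D.pull f 𝒱 h).pull g 𝒲 h' = D.pull (g ≫ f) 𝒲 h'' := by
  refine LineMapOn.ext' (Bundle.ext ?_) ?_
  · funext z w; exact pbM_pbM f g _ _ _
  · funext z; exact pbM_pbM f g _ _ _

theorem LineMapOn.pull_congr {𝒰 : Cover Z} {𝒲 : Cover Z'} {f g : Z' ⟶ Z} (e : f = g)
    (h : Cover.Refines f 𝒲 𝒰) (D : LineMapOn 𝒰) :
    D.pull f 𝒲 h = D.pull g 𝒲 (e ▸ h) := by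
  subst e; rfl

/-- The pullback of an isomorphism. -/
def LineMapOn.Iso.pull {𝒰 : Cover Z} {D D' : LineMapOn 𝒰} (e : D.Iso D') (f : Z' ⟶ Z)
    (𝒲 : Cover Z') (h : Cover.Refines f 𝒲 𝒰) : (D.pull f 𝒲 h).Iso (D'.pull f 𝒲 h) where
  a := e.a.pull f 𝒲 h
  comm_s := by
    ext1; funext z
    exact (pbM_mul f (h z) _ _).symm.trans
      (congrArg (pbM f (𝒲.U z) (h z)) (congrFun (congrArg BHom.m e.comm_s) (f z)))

theorem BHom.id_comp {𝒰 : Cover Z} {r s : ℕ} {E : Bundle 𝒰 r} {F : Bundle 𝒰 s} (a : BHom E F) :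
    (BHom.id E).comp a = a := by
  ext1; funext z; exact Matrix.mul_one _

theorem BHom.comp_id {𝒰 : Cover Z} {r s : ℕ} {E : Bundle 𝒰 r} {F : Bundle 𝒰 s} (a : BHom E F) :
    a.comp (BHom.id F) = a := by
  ext1; funext z; exact Matrix.one_mul _

theorem BHom.comp_assoc {𝒰 : Cover Z} {r s t v : ℕ} {E : Bundle 𝒰 r} {F : Bundle 𝒰 s}
    {G : Bundle 𝒰 t} {H : Bundle 𝒰 v} (a : BHom E F) (b : BHom F G) (c : BHom G H) :
    (a.comp b).comp c = a.comp (b.comp c) := by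
  ext1; funext z; exact (Matrix.mul_assoc _ _ _).symm

theorem BHom.det_comp {𝒰 : Cover Z} {r : ℕ} {E F G : Bundle 𝒰 r} (a : BHom E F) (b : BHom F G) :
    (a.comp b).det = a.det.comp b.det := by
  ext1; funext z
  simp [Matrix.det_mul, -Matrix.scalar_apply]

theorem BHom.det_id {𝒰 : Cover Z} {r : ℕ} (E : Bundle 𝒰 r) :
    (BHom.id E).det = BHom.id E.det := by
  ext1; funext z
  simp [-Matrix.scalar_apply]

/-- The identity isomorphism. -/
@[simps]
def BIso.refl {𝒰 : Cover Z} {r : ℕ} (E : Bundle 𝒰 r) : BIso E E where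
  hom := BHom.id E
  inv := BHom.id E
  hom_inv := BHom.id_comp _
  inv_hom := BHom.id_comp _

/-- The inverse isomorphism. -/
@[simps]
def BIso.symm {𝒰 : Cover Z} {r s : ℕ} {E : Bundle 𝒰 r} {F : Bundle 𝒰 s} (a : BIso E F) :
    BIso F E where
  hom := a.inv
  inv := a.hom
  hom_inv := a.inv_hom
  inv_hom := a.hom_inv

/-- The composite of two isomorphisms. -/
@[simps]
def BIso.trans {𝒰 : Cover Z} {r s t : ℕ} {E : Bundle 𝒰 r} {F : Bundle 𝒰 s} {G : Bundle 𝒰 t}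
    (a : BIso E F) (b : BIso F G) : BIso E G where
  hom := a.hom.comp b.hom
  inv := b.inv.comp a.inv
  hom_inv := by
    rw [BHom.comp_assoc, ← b.hom.comp_assoc, b.hom_inv, BHom.id_comp, a.hom_inv]
  inv_hom := by
    rw [BHom.comp_assoc, ← a.inv.comp_assoc, a.inv_hom, BHom.id_comp, b.inv_hom]

/-- The identity isomorphism. -/
def LineMapOn.Iso.refl {𝒰 : Cover Z} (D : LineMapOn 𝒰) : D.Iso D where
  a := BIso.refl _
  comm_s := BHom.id_comp _

/-- The inverse isomorphism. -/
def LineMapOn.Iso.symm {𝒰 : Cover Z} {D D' : LineMapOn 𝒰} (e : D.Iso D') : D'.Iso D where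
  a := e.a.symm
  comm_s := by
    rw [← e.comm_s, ← BHom.comp_assoc, BIso.symm_hom, e.a.inv_hom, BHom.id_comp]

/-- The composite of two isomorphisms. -/
def LineMapOn.Iso.trans {𝒰 : Cover Z} {D D' D'' : LineMapOn 𝒰} (e : D.Iso D') (e' : D'.Iso D'') :
    D.Iso D'' where
  a := e.a.trans e'.a
  comm_s := by rw [BIso.trans_hom, BHom.comp_assoc, e'.comm_s, e.comm_s]

theorem Cover.Refines.trans_id {f : Z' ⟶ Z} {𝒱 : Cover Z'} {𝒲 𝒰 : Cover Z}
    (h : Cover.Refines f 𝒱 𝒲) (h' : Cover.Refines (𝟙 Z) 𝒲 𝒰) : Cover.Refines f 𝒱 𝒰 :=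
  fun z _ hx ↦ h' (f z) (h z hx)

theorem LineMapOn.pull_id_pull {𝒰 𝒲 : Cover Z} {𝒱 : Cover Z'} (f : Z' ⟶ Z)
    (h : Cover.Refines (𝟙 Z) 𝒲 𝒰) (h' : Cover.Refines f 𝒱 𝒲) (h'' : Cover.Refines f 𝒱 𝒰)
    (D : LineMapOn 𝒰) : (D.pull (𝟙 Z) 𝒲 h).pull f 𝒱 h' = D.pull f 𝒱 h'' :=
  (LineMapOn.pull_pull (𝟙 Z) f h h' (h'.trans_id h) D).trans
    (LineMapOn.pull_congr (Category.comp_id f) _ D)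

theorem LineMapOn.pull_pull_id {𝒰 : Cover Z} {𝒱 𝒲 : Cover Z'} (f : Z' ⟶ Z)
    (h : Cover.Refines f 𝒱 𝒰) (h' : Cover.Refines (𝟙 Z') 𝒲 𝒱) (h'' : Cover.Refines f 𝒲 𝒰)
    (D : LineMapOn 𝒰) : (D.pull f 𝒱 h).pull (𝟙 Z') 𝒲 h' = D.pull f 𝒲 h'' :=
  (LineMapOn.pull_pull f (𝟙 Z') h h' (fun z _ hx ↦ h z (h' z hx)) D).trans
    (LineMapOn.pull_congr (Category.id_comp f) _ D)

/-- Transport of an isomorphism along equalities. -/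
def LineMapOn.Iso.cast {𝒰 : Cover Z} {A A' B B' : LineMapOn 𝒰} (e : A.Iso B) (h : A = A')
    (h' : B = B') : A'.Iso B' := by
  subst h h'; exact e

/-- The restriction of an isomorphism to a refinement. -/
def LineMapOn.Iso.refine {𝒰 𝒰' 𝒲 : Cover Z} {D : LineMapOn 𝒰} {D' : LineMapOn 𝒰'}
    {h : Cover.Refines (𝟙 Z) 𝒲 𝒰} {h' : Cover.Refines (𝟙 Z) 𝒲 𝒰'}
    (e : (D.pull (𝟙 Z) 𝒲 h).Iso (D'.pull (𝟙 Z) 𝒲 h')) (f : Z' ⟶ Z) (𝒱 : Cover Z')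
    (l : Cover.Refines f 𝒱 𝒲) (k : Cover.Refines f 𝒱 𝒰) (k' : Cover.Refines f 𝒱 𝒰') :
    (D.pull f 𝒱 k).Iso (D'.pull f 𝒱 k') :=
  (e.pull f 𝒱 l).cast (LineMapOn.pull_id_pull f h l k D) (LineMapOn.pull_id_pull f h' l k' D')

theorem LineMap.Equiv.refl (D : LineMap Z) : D.Equiv D :=
  ⟨D.cover, fun _ ↦ le_rfl, fun _ ↦ le_rfl, ⟨.refl _⟩⟩

theorem LineMap.Equiv.symm {D D' : LineMap Z} (e : D.Equiv D') : D'.Equiv D := by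
  obtain ⟨𝒲, h, h', ⟨e⟩⟩ := e
  exact ⟨𝒲, h', h, ⟨e.symm⟩⟩

theorem LineMap.Equiv.trans {D D' D'' : LineMap Z} (e : D.Equiv D') (e' : D'.Equiv D'') :
    D.Equiv D'' := by
  obtain ⟨𝒲₁, h₁, h₁', ⟨e₁⟩⟩ := e
  obtain ⟨𝒲₂, h₂, h₂', ⟨e₂⟩⟩ := e'
  have l₁ : Cover.Refines (𝟙 Z) (𝒲₁.inf 𝒲₂) 𝒲₁ := fun z ↦ inf_le_left
  have l₂ : Cover.Refines (𝟙 Z) (𝒲₁.inf 𝒲₂) 𝒲₂ := fun z ↦ inf_le_right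
  exact ⟨𝒲₁.inf 𝒲₂, l₁.trans_id h₁, l₂.trans_id h₂',
    ⟨(e₁.refine (𝟙 Z) _ l₁ (l₁.trans_id h₁) (l₁.trans_id h₁')).trans
      (e₂.refine (𝟙 Z) _ l₂ (l₁.trans_id h₁') (l₂.trans_id h₂'))⟩⟩

instance LineMap.setoid (Z : Scheme.{u}) : Setoid (LineMap Z) :=
  ⟨LineMap.Equiv, .refl, .symm, .trans⟩

theorem LineMap.Equiv.pull {D D' : LineMap Z} (e : D.Equiv D') (f : Z' ⟶ Z) :
    (D.pull f).Equiv (D'.pull f) := by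
  obtain ⟨𝒲, h, h', ⟨e⟩⟩ := e
  have l : Cover.Refines f (𝒲.preimage f) 𝒲 := fun _ ↦ le_rfl
  have k : Cover.Refines (𝟙 Z') (𝒲.preimage f) (D.cover.preimage f) := fun z ↦ (l.trans_id h) z
  have k' : Cover.Refines (𝟙 Z') (𝒲.preimage f) (D'.cover.preimage f) := fun z ↦ (l.trans_id h') z
  exact ⟨𝒲.preimage f, k, k', ⟨(e.refine f _ l (l.trans_id h) (l.trans_id h')).cast
    (LineMapOn.pull_pull_id f _ k _ D.on).symm (LineMapOn.pull_pull_id f _ k' _ D'.on).symm⟩⟩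

theorem LineMap.pull_id (D : LineMap Z) : (D.pull (𝟙 Z)).Equiv D :=
  ⟨D.cover, fun _ ↦ le_rfl, fun _ ↦ le_rfl,
    ⟨(LineMapOn.Iso.refl _).cast (LineMapOn.pull_pull_id (𝟙 Z) _ _ (fun _ ↦ le_rfl) D.on).symm rfl⟩⟩

theorem LineMap.pull_comp (D : LineMap Z) (f : Z' ⟶ Z) (g : Z'' ⟶ Z') :
    D.pull (g ≫ f) = (D.pull f).pull g :=
  congrArg (LineMap.mk _) (LineMapOn.pull_pull f g _ _ (fun _ ↦ le_rfl) _).symm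

end

/-! ### Properties of line bundles with a map to the structure sheaf -/

section

variable {Z Z' Z'' : Scheme.{u}}

theorem germ_pb (f : Z' ⟶ Z) {U : Z.Opens} {V : Z'.Opens} (h : V ≤ f ⁻¹ᵁ U) (z : Z') (hz : z ∈ V)
    (a : Γ(Z, U)) : germ z hz (pb f V h a) = (f.stalkMap z).hom (germ (f z) (h hz) a) := by
  have h₁ : pb f V h a = res V h ((f.app U).hom a) := rfl
  rw [h₁, germ_res]
  exact (Scheme.Hom.germ_stalkMap_apply f U z (h hz) a).symm

theorem LineMap.eqn_pull (f : Z' ⟶ Z) (D : LineMap Z) (z : Z') :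
    (D.pull f).eqn z = (f.stalkMap z).hom (D.eqn (f z)) :=
  germ_pb f _ z _ _

theorem LineMapOn.associated {𝒰 : Cover Z} (D : LineMapOn 𝒰) (z w : Z) (h : w ∈ 𝒰.U z) :
    Associated (germ w (𝒰.mem w) (ent (D.s.m w))) (germ w h (ent (D.s.m z))) := by
  have hw : w ∈ 𝒰.U w ⊓ 𝒰.U z := ⟨𝒰.mem w, h⟩
  have h₁ := congrArg (germ w hw) (congrArg ent (D.s.comm w z))
  have h₂ := congrArg (germ w hw) (congrArg ent (D.L.g_mul_symm w z))
  simp only [Bundle.triv_g, ent_mul, ent_one, one_mul, ent_resM, map_mul, germ_res, map_one]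
    at h₁ h₂
  exact ⟨⟨_, _, h₂, (mul_comm _ _).trans h₂⟩, h₁⟩

theorem LineMapOn.Iso.associated {𝒰 : Cover Z} {D D' : LineMapOn 𝒰} (e : D.Iso D') (z : Z) :
    Associated (germ z (𝒰.mem z) (ent (D'.s.m z))) (germ z (𝒰.mem z) (ent (D.s.m z))) := by
  have h₁ := congrArg (germ z (𝒰.mem z)) (congrArg ent (congrFun (congrArg BHom.m e.comm_s) z))
  have h₂ := congrArg (germ z (𝒰.mem z)) (congrArg ent (congrFun (congrArg BHom.m e.a.inv_hom) z))
  simp only [BHom.comp_m, BHom.id_m, ent_mul, ent_one, map_mul, map_one] at h₁ h₂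
  exact ⟨⟨_, _, h₂, (mul_comm _ _).trans h₂⟩, h₁⟩

theorem LineMap.associated_refine (D : LineMap Z) (𝒲 : Cover Z)
    (h : Cover.Refines (𝟙 Z) 𝒲 D.cover) (z : Z) :
    germ z (𝒲.mem z) (ent ((D.on.pull (𝟙 Z) 𝒲 h).s.m z)) = D.eqn z := by
  change germ z (𝒲.mem z) (pb (𝟙 Z) (𝒲.U z) (h z) (ent (D.on.s.m z))) = _
  rw [pb_id]
  exact germ_res _ _ _

theorem LineMap.Equiv.associated {D D' : LineMap Z} (e : D.Equiv D') (z : Z) :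
    Associated (D.eqn z) (D'.eqn z) := by
  obtain ⟨𝒲, h, h', ⟨e⟩⟩ := e
  have := (e.associated z).symm
  rwa [LineMap.associated_refine, LineMap.associated_refine] at this

theorem LineMap.mem_isoLocus (D : LineMap Z) (z : Z) : z ∈ D.isoLocus ↔ IsUnit (D.eqn z) := by
  simp only [LineMap.isoLocus, Opens.mem_iSup]
  constructor
  · rintro ⟨w, hw⟩
    obtain ⟨h, h'⟩ := (Z.mem_basicOpen'' _ z).mp hw
    exact (D.on.associated w z h).isUnit_iff.mpr h'
  · intro h
    exact ⟨z, (Z.mem_basicOpen'' _ z).mpr ⟨D.cover.mem z, h⟩⟩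

theorem LineMap.Equiv.isoLocus {D D' : LineMap Z} (e : D.Equiv D') :
    D.isoLocus = D'.isoLocus := by
  ext z
  exact (D.mem_isoLocus z).trans ((e.associated z).isUnit_iff.trans (D'.mem_isoLocus z).symm)

theorem LineMap.isoLocus_pull (f : Z' ⟶ Z) (D : LineMap Z) :
    (D.pull f).isoLocus = f ⁻¹ᵁ D.isoLocus := by
  ext z
  refine ((D.pull f).mem_isoLocus z).trans (Iff.trans ?_ (D.mem_isoLocus (f z)).symm)
  rw [LineMap.eqn_pull]
  exact isUnit_map_iff _ _

theorem LineMap.Equiv.hasDegree {D D' : LineMap Z} (e : D.Equiv D') {n : ℕ} (h : D.HasDegree n) :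
    D'.HasDegree n := by
  have : ∀ z, Ideal.span {D.eqn z} = Ideal.span {D'.eqn z} := fun z ↦
    le_antisymm (Ideal.span_singleton_le_span_singleton.mpr (e.associated z).symm.dvd)
      (Ideal.span_singleton_le_span_singleton.mpr (e.associated z).dvd)
  refine (congrArg (fun F : Z → ℕ∞ ↦ HasSum F (n : ℕ∞)) (funext fun z ↦ ?_)).mp h
  exact congrArg (fun I : Ideal (Z.presheaf.stalk z) ↦
    Module.length (Z.presheaf.stalk z) (Z.presheaf.stalk z ⧸ I)) (this z)

theorem LineMap.eqn_tensor (D D' : LineMap Z) (z : Z) :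
    (D.tensor D').eqn z = D.eqn z * D'.eqn z := by
  change germ z ((D.cover.inf D'.cover).mem z) (ent (Matrix.scalar (Fin 1) (_ * _))) = _
  rw [ent_scalar, map_mul]
  exact congrArg₂ _ (D.associated_refine _ (fun _ ↦ inf_le_left) z)
    (D'.associated_refine _ (fun _ ↦ inf_le_right) z)

theorem LineMap.isoLocus_tensor (D D' : LineMap Z) :
    (D.tensor D').isoLocus = D.isoLocus ⊓ D'.isoLocus := by
  ext z
  refine ((D.tensor D').mem_isoLocus z).trans ?_
  rw [LineMap.eqn_tensor, IsUnit.mul_iff]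
  exact and_congr (D.mem_isoLocus z).symm (D'.mem_isoLocus z).symm

theorem LineMap.HasDegree.tensor {D D' : LineMap Z} {n n' : ℕ} (h : D.HasDegree n)
    (h' : D'.HasDegree n') (hdisj : D.isoLocus ⊔ D'.isoLocus = ⊤) :
    (D.tensor D').HasDegree (n + n') := by
  have H := HasSum.add h h'
  rw [← Nat.cast_add] at H
  refine (congrArg (fun F : Z → ℕ∞ ↦ HasSum F ((n + n' : ℕ) : ℕ∞)) (funext fun z ↦ ?_)).mpr H
  have key : ∀ a b : Z.presheaf.stalk z, IsUnit a →
      Module.length (Z.presheaf.stalk z) (Z.presheaf.stalk z ⧸ Ideal.span {a * b}) =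
        Module.length (Z.presheaf.stalk z) (Z.presheaf.stalk z ⧸ Ideal.span {a}) +
        Module.length (Z.presheaf.stalk z) (Z.presheaf.stalk z ⧸ Ideal.span {b}) := by
    intro a b ha
    have h₀ : Module.length (Z.presheaf.stalk z) (Z.presheaf.stalk z ⧸ Ideal.span {a}) = 0 := by
      rw [Module.length_eq_zero_iff, Ideal.Quotient.subsingleton_iff,
        Ideal.span_singleton_eq_top]
      exact ha
    rw [h₀, zero_add, Ideal.span_singleton_mul_left_unit ha]
  have hz : z ∈ D.isoLocus ⊔ D'.isoLocus := hdisj ▸ Opens.mem_top z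
  change Module.length _ (_ ⧸ Ideal.span {(D.tensor D').eqn z}) =
    Module.length _ (_ ⧸ Ideal.span {D.eqn z}) + Module.length _ (_ ⧸ Ideal.span {D'.eqn z})
  rw [LineMap.eqn_tensor]
  rcases hz with hz | hz
  · exact key _ _ ((D.mem_isoLocus z).mp hz)
  · rw [mul_comm, add_comm]
    exact key _ _ ((D'.mem_isoLocus z).mp hz)

/-- The tensor product of two isomorphisms. -/
def LineMapOn.Iso.tensor {𝒰 : Cover Z} {D D' E E' : LineMapOn 𝒰} (e : D.Iso D') (e' : E.Iso E') :
    (D.tensor E).Iso (D'.tensor E') where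
  a :=
    { hom :=
        { m z := Matrix.scalar (Fin 1) (ent (e.a.hom.m z) * ent (e'.a.hom.m z))
          comm z w := by
            have h₁ := congrArg ent (e.a.hom.comm z w)
            have h₂ := congrArg ent (e'.a.hom.comm z w)
            apply ent_injective
            simp only [ent_mul, ent_resM, ent_scalar, map_mul, LineMapOn.tensor_L,
              Bundle.tensor_g] at h₁ h₂ ⊢
            rw [mul_mul_mul_comm, h₁, h₂, mul_mul_mul_comm] }
      inv :=
        { m z := Matrix.scalar (Fin 1) (ent (e.a.inv.m z) * ent (e'.a.inv.m z))
          comm z w := by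
            have h₁ := congrArg ent (e.a.inv.comm z w)
            have h₂ := congrArg ent (e'.a.inv.comm z w)
            apply ent_injective
            simp only [ent_mul, ent_resM, ent_scalar, map_mul, LineMapOn.tensor_L,
              Bundle.tensor_g] at h₁ h₂ ⊢
            rw [mul_mul_mul_comm, h₁, h₂, mul_mul_mul_comm] }
      hom_inv := by
        ext1; funext z
        have h₁ := congrArg ent (congrFun (congrArg BHom.m e.a.hom_inv) z)
        have h₂ := congrArg ent (congrFun (congrArg BHom.m e'.a.hom_inv) z)
        apply ent_injective
        simp only [BHom.comp_m, BHom.id_m, ent_mul, ent_one, ent_scalar] at h₁ h₂ ⊢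
        rw [mul_mul_mul_comm, h₁, h₂, mul_one]
      inv_hom := by
        ext1; funext z
        have h₁ := congrArg ent (congrFun (congrArg BHom.m e.a.inv_hom) z)
        have h₂ := congrArg ent (congrFun (congrArg BHom.m e'.a.inv_hom) z)
        apply ent_injective
        simp only [BHom.comp_m, BHom.id_m, ent_mul, ent_one, ent_scalar] at h₁ h₂ ⊢
        rw [mul_mul_mul_comm, h₁, h₂, mul_one] }
  comm_s := by
    ext1; funext z
    have h₁ := congrArg ent (congrFun (congrArg BHom.m e.comm_s) z)
    have h₂ := congrArg ent (congrFun (congrArg BHom.m e'.comm_s) z)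
    apply ent_injective
    simp only [BHom.comp_m, ent_mul] at h₁ h₂
    refine (ent_mul (Matrix.scalar (Fin 1) (_ * _)) (Matrix.scalar (Fin 1) (_ * _))).trans ?_
    refine Eq.trans ?_ (ent_scalar _).symm
    rw [ent_scalar, ent_scalar, mul_mul_mul_comm, h₁, h₂]

theorem LineMapOn.pull_tensor {𝒰 : Cover Z} (f : Z' ⟶ Z) (𝒲 : Cover Z')
    (h : Cover.Refines f 𝒲 𝒰) (D D' : LineMapOn 𝒰) :
    (D.tensor D').pull f 𝒲 h = (D.pull f 𝒲 h).tensor (D'.pull f 𝒲 h) := by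
  refine LineMapOn.ext' (Bundle.ext ?_) ?_
  · funext z w
    exact ent_injective (map_mul (pb f _ (h.inf z w)) (ent (D.L.g (f z) (f w)))
      (ent (D'.L.g (f z) (f w))))
  · funext z
    exact ent_injective (map_mul (pb f _ (h z)) (ent (D.s.m (f z))) (ent (D'.s.m (f z))))

theorem LineMap.pull_tensor (f : Z' ⟶ Z) (D D' : LineMap Z) :
    (D.tensor D').pull f = (D.pull f).tensor (D'.pull f) := by
  let 𝒱 : Cover Z' := (D.cover.inf D'.cover).preimage f
  have l₁ : Cover.Refines f 𝒱 D.cover := fun z ↦ fun x hx ↦ And.left hx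
  have l₂ : Cover.Refines f 𝒱 D'.cover := fun z ↦ fun x hx ↦ And.right hx
  have k₁ : Cover.Refines (𝟙 Z') 𝒱 (D.cover.preimage f) := fun z ↦ fun x hx ↦ And.left hx
  have k₂ : Cover.Refines (𝟙 Z') 𝒱 (D'.cover.preimage f) := fun z ↦ fun x hx ↦ And.right hx
  have m₁ : Cover.Refines (𝟙 Z) (D.cover.inf D'.cover) D.cover := fun z ↦ inf_le_left
  have m₂ : Cover.Refines (𝟙 Z) (D.cover.inf D'.cover) D'.cover := fun z ↦ inf_le_right
  have l : Cover.Refines f 𝒱 (D.cover.inf D'.cover) := fun _ ↦ le_rfl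
  have n₁ : Cover.Refines f (D.cover.preimage f) D.cover := fun _ ↦ le_rfl
  have n₂ : Cover.Refines f (D'.cover.preimage f) D'.cover := fun _ ↦ le_rfl
  refine congrArg (LineMap.mk 𝒱) ?_
  refine (LineMapOn.pull_tensor f 𝒱 l (D.on.pull (𝟙 Z) _ m₁) (D'.on.pull (𝟙 Z) _ m₂)).trans
    (congrArg₂ LineMapOn.tensor ?_ ?_)
  · exact (LineMapOn.pull_id_pull f m₁ l l₁ D.on).trans
      (LineMapOn.pull_pull_id f n₁ k₁ l₁ D.on).symm
  · exact (LineMapOn.pull_id_pull f m₂ l l₂ D'.on).trans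
      (LineMapOn.pull_pull_id f n₂ k₂ l₂ D'.on).symm

theorem LineMap.Equiv.tensor {D D' E E' : LineMap Z} (e : D.Equiv D') (e' : E.Equiv E') :
    (D.tensor E).Equiv (D'.tensor E') := by
  obtain ⟨𝒲₁, h₁, h₁', ⟨e₁⟩⟩ := e
  obtain ⟨𝒲₂, h₂, h₂', ⟨e₂⟩⟩ := e'
  have l₁ : Cover.Refines (𝟙 Z) (𝒲₁.inf 𝒲₂) 𝒲₁ := fun z ↦ inf_le_left
  have l₂ : Cover.Refines (𝟙 Z) (𝒲₁.inf 𝒲₂) 𝒲₂ := fun z ↦ inf_le_right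
  have k : ∀ {A B : LineMap Z} (h : Cover.Refines (𝟙 Z) 𝒲₁ A.cover)
      (h' : Cover.Refines (𝟙 Z) 𝒲₂ B.cover),
      Cover.Refines (𝟙 Z) (𝒲₁.inf 𝒲₂) (A.tensor B).cover :=
    fun h h' z ↦ inf_le_inf (h z) (h' z)
  have q : ∀ {A B : LineMap Z} (h : Cover.Refines (𝟙 Z) 𝒲₁ A.cover)
      (h' : Cover.Refines (𝟙 Z) 𝒲₂ B.cover),
      (A.on.pull (𝟙 Z) _ (l₁.trans_id h)).tensor (B.on.pull (𝟙 Z) _ (l₂.trans_id h')) =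
      (A.tensor B).on.pull (𝟙 Z) (𝒲₁.inf 𝒲₂) (k h h') := fun {A B} h h' ↦
    ((LineMapOn.pull_tensor (𝟙 Z) _ (k h h') _ _).trans (congrArg₂ LineMapOn.tensor
      (LineMapOn.pull_id_pull (𝟙 Z) _ _ (l₁.trans_id h) A.on)
      (LineMapOn.pull_id_pull (𝟙 Z) _ _ (l₂.trans_id h') B.on))).symm
  exact ⟨𝒲₁.inf 𝒲₂, k h₁ h₂, k h₁' h₂',
    ⟨((e₁.refine (𝟙 Z) _ l₁ (l₁.trans_id h₁) (l₁.trans_id h₁')).tensor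
      (e₂.refine (𝟙 Z) _ l₂ (l₂.trans_id h₂) (l₂.trans_id h₂'))).cast (q h₁ h₂) (q h₁' h₂')⟩⟩

end

/-! ### The data parametrized by the local models -/

theorem BHom.IsSubbundle.pull {Z Z' : Scheme.{u}} {𝒰 : Cover Z} {r s : ℕ} {E : Bundle 𝒰 r}
    {F : Bundle 𝒰 s} {a : BHom E F} (ha : a.IsSubbundle) (f : Z' ⟶ Z) (𝒲 : Cover Z')
    (h : Cover.Refines f 𝒲 𝒰) : (a.pull f 𝒲 h).IsSubbundle := by
  intro z
  obtain ⟨V, hV, N, hz, hN⟩ := ha (f z)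
  have l : f ⁻¹ᵁ V ⊓ 𝒲.U z ≤ f ⁻¹ᵁ V := inf_le_left
  refine ⟨f ⁻¹ᵁ V ⊓ 𝒲.U z, inf_le_right, pbM f _ l N, ⟨hz, 𝒲.mem z⟩, ?_⟩
  have := congrArg (pbM f (f ⁻¹ᵁ V ⊓ 𝒲.U z) l) hN
  rw [pbM_mul, pbM_one, pbM_resM] at this
  rw [BHom.pull_m, resM_pbM]
  exact this

theorem BHom.IsQuotient.pullToTriv {Z Z' : Scheme.{u}} {𝒰 : Cover Z} {r s : ℕ} {E : Bundle 𝒰 s}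
    {a : BHom E (Bundle.triv 𝒰 r)} (ha : a.IsQuotient) (f : Z' ⟶ Z) (𝒲 : Cover Z')
    (h : Cover.Refines f 𝒲 𝒰) : (a.pullToTriv f 𝒲 h).IsQuotient := by
  intro z
  obtain ⟨V, hV, N, hz, hN⟩ := ha (f z)
  have l : f ⁻¹ᵁ V ⊓ 𝒲.U z ≤ f ⁻¹ᵁ V := inf_le_left
  refine ⟨f ⁻¹ᵁ V ⊓ 𝒲.U z, inf_le_right, pbM f _ l N, ⟨hz, 𝒲.mem z⟩, ?_⟩
  have := congrArg (pbM f (f ⁻¹ᵁ V ⊓ 𝒲.U z) l) hN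
  rw [pbM_mul, pbM_one, pbM_resM] at this
  rw [BHom.pullToTriv_m, resM_pbM]
  exact this

/-- Two vector bundles `E₁`, `E₂` of rank `2` with trivialized determinants, a map
`φ : E₁ → E₂`, a line subbundle `i : L → E₁`, and a quotient `q : E₂ → 𝒪`; all bundles are
trivialized over the members of the cover `𝒰`. -/
structure DatumOn {Z : Scheme.{u}} (𝒰 : Cover Z) where
  L : Bundle 𝒰 1
  E₁ : Bundle 𝒰 2
  E₂ : Bundle 𝒰 2
  τ₁ : BIso E₁.det (Bundle.triv 𝒰 1)
  τ₂ : BIso E₂.det (Bundle.triv 𝒰 1)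
  i : BHom L E₁
  φ : BHom E₁ E₂
  q : BHom E₂ (Bundle.triv 𝒰 1)
  i_sub : i.IsSubbundle
  q_quot : q.IsQuotient

/-- An isomorphism of data: isomorphisms of the bundles `L`, `E₁`, `E₂` that are compatible with
all the maps and with the trivializations of the determinants (and the identity of `𝒪`). -/
structure DatumOn.Iso {Z : Scheme.{u}} {𝒰 : Cover Z} (D D' : DatumOn 𝒰) where
  a : BIso D.L D'.L
  b₁ : BIso D.E₁ D'.E₁
  b₂ : BIso D.E₂ D'.E₂
  comm_τ₁ : b₁.hom.det.comp D'.τ₁.hom = D.τ₁.hom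
  comm_τ₂ : b₂.hom.det.comp D'.τ₂.hom = D.τ₂.hom
  comm_i : a.hom.comp D'.i = D.i.comp b₁.hom
  comm_φ : b₁.hom.comp D'.φ = D.φ.comp b₂.hom
  comm_q : b₂.hom.comp D'.q = D.q

/-- The pullback of a datum. -/
@[simps]
def DatumOn.pull {Z Z' : Scheme.{u}} {𝒰 : Cover Z} (f : Z' ⟶ Z) (𝒲 : Cover Z')
    (h : Cover.Refines f 𝒲 𝒰) (D : DatumOn 𝒰) : DatumOn 𝒲 where
  L := D.L.pull f 𝒲 h
  E₁ := D.E₁.pull f 𝒲 h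
  E₂ := D.E₂.pull f 𝒲 h
  τ₁ := D.τ₁.pullDet f 𝒲 h
  τ₂ := D.τ₂.pullDet f 𝒲 h
  i := D.i.pull f 𝒲 h
  φ := D.φ.pull f 𝒲 h
  q := D.q.pullToTriv f 𝒲 h
  i_sub := D.i_sub.pull f 𝒲 h
  q_quot := D.q_quot.pullToTriv f 𝒲 h

/-- The composite map `L → E₁ → E₂ → 𝒪`. -/
@[simps]
def DatumOn.toLineMap {Z : Scheme.{u}} {𝒰 : Cover Z} (D : DatumOn 𝒰) : LineMapOn 𝒰 where
  L := D.L
  s := (D.i.comp D.φ).comp D.q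

/-- The determinant of `φ : E₁ → E₂`, a global function by means of the trivializations of the
determinants of `E₁` and `E₂`. -/
def DatumOn.det {Z : Scheme.{u}} {𝒰 : Cover Z} (D : DatumOn 𝒰) : Γ(Z, ⊤) :=
  ((D.τ₁.inv.comp D.φ.det).comp D.τ₂.hom).toSection

/-- Bundles and maps as in `DatumOn` (together with local trivializations of the bundles). -/
structure Datum (Z : Scheme.{u}) where
  cover : Cover Z
  on : DatumOn cover

/-- The pullback of a datum. -/
@[simps]
def Datum.pull {Z Z' : Scheme.{u}} (f : Z' ⟶ Z) (D : Datum Z) : Datum Z' where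
  cover := D.cover.preimage f
  on := D.on.pull f _ fun _ ↦ le_rfl

/-- Two data are isomorphic if they are so after restricting the local trivializations to a
common refinement of the two covers. -/
def Datum.Equiv {Z : Scheme.{u}} (D D' : Datum Z) : Prop :=
  ∃ (𝒲 : Cover Z) (h : Cover.Refines (𝟙 Z) 𝒲 D.cover) (k : Cover.Refines (𝟙 Z) 𝒲 D'.cover),
    Nonempty ((D.on.pull (𝟙 Z) 𝒲 h).Iso (D'.on.pull (𝟙 Z) 𝒲 k))

/-- The composite map `L → E₁ → E₂ → 𝒪`. -/
@[simps]
def Datum.toLineMap {Z : Scheme.{u}} (D : Datum Z) : LineMap Z where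
  cover := D.cover
  on := D.on.toLineMap

/-- The determinant of `φ : E₁ → E₂`. -/
def Datum.det {Z : Scheme.{u}} (D : Datum Z) : Γ(Z, ⊤) := D.on.det

section

variable {Z Z' Z'' : Scheme.{u}}

theorem BIso.ext' {𝒰 : Cover Z} {r s : ℕ} {E : Bundle 𝒰 r} {F : Bundle 𝒰 s} {a b : BIso E F}
    (h : a.hom = b.hom) : a = b := by
  have h' : a.inv = b.inv := by
    rw [← BHom.id_comp b.inv, ← a.inv_hom, h, BHom.comp_assoc, b.hom_inv, BHom.comp_id]
  cases a
  cases b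
  congr

theorem DatumOn.ext' {𝒰 : Cover Z} {D D' : DatumOn 𝒰} (hL : D.L = D'.L) (h₁ : D.E₁ = D'.E₁)
    (h₂ : D.E₂ = D'.E₂) (hτ₁ : D.τ₁.hom.m = D'.τ₁.hom.m) (hτ₂ : D.τ₂.hom.m = D'.τ₂.hom.m)
    (hi : D.i.m = D'.i.m) (hφ : D.φ.m = D'.φ.m) (hq : D.q.m = D'.q.m) : D = D' := by
  obtain ⟨L, E₁, E₂, τ₁, τ₂, i, φ, q, _, _⟩ := D
  obtain ⟨L', E₁', E₂', τ₁', τ₂', i', φ', q', _, _⟩ := D'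
  obtain rfl : L = L' := hL
  obtain rfl : E₁ = E₁' := h₁
  obtain rfl : E₂ = E₂' := h₂
  obtain rfl : i = i' := BHom.ext hi
  obtain rfl : φ = φ' := BHom.ext hφ
  obtain rfl : q = q' := BHom.ext hq
  obtain rfl : τ₁ = τ₁' := BIso.ext' (BHom.ext hτ₁)
  obtain rfl : τ₂ = τ₂' := BIso.ext' (BHom.ext hτ₂)
  rfl

theorem DatumOn.pull_pull {𝒰 : Cover Z} {𝒱 : Cover Z'} {𝒲 : Cover Z''} (f : Z' ⟶ Z)
    (g : Z'' ⟶ Z') (h : Cover.Refines f 𝒱 𝒰) (h' : Cover.Refines g 𝒲 𝒱)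
    (h'' : Cover.Refines (g ≫ f) 𝒲 𝒰) (D : DatumOn 𝒰) :
    (D.pull f 𝒱 h).pull g 𝒲 h' = D.pull (g ≫ f) 𝒲 h'' := by
  refine DatumOn.ext' (Bundle.ext ?_) (Bundle.ext ?_) (Bundle.ext ?_) ?_ ?_ ?_ ?_ ?_
  iterate 3 (funext z w; exact pbM_pbM f g _ _ _)
  iterate 5 (funext z; exact pbM_pbM f g _ _ _)

theorem DatumOn.pull_congr {𝒰 : Cover Z} {𝒲 : Cover Z'} {f g : Z' ⟶ Z} (e : f = g)
    (h : Cover.Refines f 𝒲 𝒰) (D : DatumOn 𝒰) :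
    D.pull f 𝒲 h = D.pull g 𝒲 (e ▸ h) := by
  subst e; rfl

theorem DatumOn.pull_id_pull {𝒰 𝒲 : Cover Z} {𝒱 : Cover Z'} (f : Z' ⟶ Z)
    (h : Cover.Refines (𝟙 Z) 𝒲 𝒰) (h' : Cover.Refines f 𝒱 𝒲) (h'' : Cover.Refines f 𝒱 𝒰)
    (D : DatumOn 𝒰) : (D.pull (𝟙 Z) 𝒲 h).pull f 𝒱 h' = D.pull f 𝒱 h'' :=
  (DatumOn.pull_pull (𝟙 Z) f h h' (h'.trans_id h) D).trans
    (DatumOn.pull_congr (Category.comp_id f) _ D)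

theorem DatumOn.pull_pull_id {𝒰 : Cover Z} {𝒱 𝒲 : Cover Z'} (f : Z' ⟶ Z)
    (h : Cover.Refines f 𝒱 𝒰) (h' : Cover.Refines (𝟙 Z') 𝒲 𝒱) (h'' : Cover.Refines f 𝒲 𝒰)
    (D : DatumOn 𝒰) : (D.pull f 𝒱 h).pull (𝟙 Z') 𝒲 h' = D.pull f 𝒲 h'' :=
  (DatumOn.pull_pull f (𝟙 Z') h h' (fun z _ hx ↦ h z (h' z hx)) D).trans
    (DatumOn.pull_congr (Category.id_comp f) _ D)

/-- The pullback of an isomorphism. -/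
def DatumOn.Iso.pull {𝒰 : Cover Z} {D D' : DatumOn 𝒰} (e : D.Iso D') (f : Z' ⟶ Z)
    (𝒲 : Cover Z') (h : Cover.Refines f 𝒲 𝒰) : (D.pull f 𝒲 h).Iso (D'.pull f 𝒲 h) where
  a := e.a.pull f 𝒲 h
  b₁ := e.b₁.pull f 𝒲 h
  b₂ := e.b₂.pull f 𝒲 h
  comm_τ₁ := by
    ext1; funext z
    have h₁ := congrArg (pbM f (𝒲.U z) (h z)) (congrFun (congrArg BHom.m e.comm_τ₁) (f z))
    refine Eq.trans ?_ ((pbM_mul f (h z) _ _).symm.trans h₁)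
    exact congrArg₂ HMul.hMul rfl ((congrArg (Matrix.scalar (Fin 1)) (det_pbM f (h z) _)).trans
      (pbM_scalar f (h z) _).symm)
  comm_τ₂ := by
    ext1; funext z
    have h₁ := congrArg (pbM f (𝒲.U z) (h z)) (congrFun (congrArg BHom.m e.comm_τ₂) (f z))
    refine Eq.trans ?_ ((pbM_mul f (h z) _ _).symm.trans h₁)
    exact congrArg₂ HMul.hMul rfl ((congrArg (Matrix.scalar (Fin 1)) (det_pbM f (h z) _)).trans
      (pbM_scalar f (h z) _).symm)
  comm_i := by
    have := congrArg (BHom.pull f 𝒲 h) e.comm_i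
    rwa [BHom.pull_comp, BHom.pull_comp] at this
  comm_φ := by
    have := congrArg (BHom.pull f 𝒲 h) e.comm_φ
    rwa [BHom.pull_comp, BHom.pull_comp] at this
  comm_q := by
    ext1; funext z
    exact (pbM_mul f (h z) _ _).symm.trans
      (congrArg (pbM f (𝒲.U z) (h z)) (congrFun (congrArg BHom.m e.comm_q) (f z)))

/-- Transport of an isomorphism along equalities. -/
def DatumOn.Iso.cast {𝒰 : Cover Z} {A A' B B' : DatumOn 𝒰} (e : A.Iso B) (h : A = A')
    (h' : B = B') : A'.Iso B' := by
  subst h h'; exact e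

/-- The restriction of an isomorphism to a refinement. -/
def DatumOn.Iso.refine {𝒰 𝒰' 𝒲 : Cover Z} {D : DatumOn 𝒰} {D' : DatumOn 𝒰'}
    {h : Cover.Refines (𝟙 Z) 𝒲 𝒰} {h' : Cover.Refines (𝟙 Z) 𝒲 𝒰'}
    (e : (D.pull (𝟙 Z) 𝒲 h).Iso (D'.pull (𝟙 Z) 𝒲 h')) (f : Z' ⟶ Z) (𝒱 : Cover Z')
    (l : Cover.Refines f 𝒱 𝒲) (k : Cover.Refines f 𝒱 𝒰) (k' : Cover.Refines f 𝒱 𝒰') :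
    (D.pull f 𝒱 k).Iso (D'.pull f 𝒱 k') :=
  (e.pull f 𝒱 l).cast (DatumOn.pull_id_pull f h l k D) (DatumOn.pull_id_pull f h' l k' D')

def DatumOn.Iso.refl {𝒰 : Cover Z} (D : DatumOn 𝒰) : D.Iso D where
  a := BIso.refl _
  b₁ := BIso.refl _
  b₂ := BIso.refl _
  comm_τ₁ := by rw [BIso.refl_hom, BHom.det_id, BHom.id_comp]
  comm_τ₂ := by rw [BIso.refl_hom, BHom.det_id, BHom.id_comp]
  comm_i := by rw [BIso.refl_hom, BIso.refl_hom, BHom.id_comp, BHom.comp_id]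
  comm_φ := by rw [BIso.refl_hom, BIso.refl_hom, BHom.id_comp, BHom.comp_id]
  comm_q := BHom.id_comp _

/-- The inverse isomorphism. -/
def DatumOn.Iso.symm {𝒰 : Cover Z} {D D' : DatumOn 𝒰} (e : D.Iso D') : D'.Iso D where
  a := e.a.symm
  b₁ := e.b₁.symm
  b₂ := e.b₂.symm
  comm_τ₁ := by
    rw [← e.comm_τ₁, ← BHom.comp_assoc, BIso.symm_hom, ← BHom.det_comp, e.b₁.inv_hom,
      BHom.det_id, BHom.id_comp]
  comm_τ₂ := by
    rw [← e.comm_τ₂, ← BHom.comp_assoc, BIso.symm_hom, ← BHom.det_comp, e.b₂.inv_hom,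
      BHom.det_id, BHom.id_comp]
  comm_i := by
    rw [BIso.symm_hom, BIso.symm_hom, ← BHom.comp_id D.i, ← e.b₁.hom_inv, ← BHom.comp_assoc D.i,
      ← e.comm_i, BHom.comp_assoc, ← BHom.comp_assoc, e.a.inv_hom, BHom.id_comp]
  comm_φ := by
    rw [BIso.symm_hom, BIso.symm_hom, ← BHom.comp_id D.φ, ← e.b₂.hom_inv, ← BHom.comp_assoc D.φ,
      ← e.comm_φ, BHom.comp_assoc, ← BHom.comp_assoc, e.b₁.inv_hom, BHom.id_comp]
  comm_q := by
    rw [← e.comm_q, ← BHom.comp_assoc, BIso.symm_hom, e.b₂.inv_hom, BHom.id_comp]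

/-- The composite of two isomorphisms. -/
def DatumOn.Iso.trans {𝒰 : Cover Z} {D D' D'' : DatumOn 𝒰} (e : D.Iso D') (e' : D'.Iso D'') :
    D.Iso D'' where
  a := e.a.trans e'.a
  b₁ := e.b₁.trans e'.b₁
  b₂ := e.b₂.trans e'.b₂
  comm_τ₁ := by rw [BIso.trans_hom, BHom.det_comp, BHom.comp_assoc, e'.comm_τ₁, e.comm_τ₁]
  comm_τ₂ := by rw [BIso.trans_hom, BHom.det_comp, BHom.comp_assoc, e'.comm_τ₂, e.comm_τ₂]
  comm_i := by
    rw [BIso.trans_hom, BIso.trans_hom, BHom.comp_assoc, e'.comm_i, ← BHom.comp_assoc, e.comm_i,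
      BHom.comp_assoc]
  comm_φ := by
    rw [BIso.trans_hom, BIso.trans_hom, BHom.comp_assoc, e'.comm_φ, ← BHom.comp_assoc, e.comm_φ,
      BHom.comp_assoc]
  comm_q := by rw [BIso.trans_hom, BHom.comp_assoc, e'.comm_q, e.comm_q]

/-- The induced isomorphism of the line bundles with a map to `𝒪`. -/
def DatumOn.Iso.toLineMap {𝒰 : Cover Z} {D D' : DatumOn 𝒰} (e : D.Iso D') :
    D.toLineMap.Iso D'.toLineMap where
  a := e.a
  comm_s := by
    change e.a.hom.comp ((D'.i.comp D'.φ).comp D'.q) = (D.i.comp D.φ).comp D.q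
    rw [← BHom.comp_assoc, ← BHom.comp_assoc, e.comm_i, BHom.comp_assoc D.i, e.comm_φ,
      BHom.comp_assoc, BHom.comp_assoc, e.comm_q, ← BHom.comp_assoc]

theorem DatumOn.toLineMap_pull {𝒰 : Cover Z} (f : Z' ⟶ Z) (𝒲 : Cover Z')
    (h : Cover.Refines f 𝒲 𝒰) (D : DatumOn 𝒰) :
    (D.pull f 𝒲 h).toLineMap = D.toLineMap.pull f 𝒲 h := by
  refine LineMapOn.ext' rfl ?_
  funext z
  exact ((pbM_mul f (h z) _ _).trans (congrArg₂ HMul.hMul rfl (pbM_mul f (h z) _ _))).symm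

theorem DatumOn.Iso.det_eq {𝒰 : Cover Z} {D D' : DatumOn 𝒰} (e : D.Iso D') : D.det = D'.det := by
  have h₁ : D.τ₁.inv.comp e.b₁.hom.det = D'.τ₁.inv := by
    rw [← BHom.comp_id (D.τ₁.inv.comp e.b₁.hom.det), ← D'.τ₁.hom_inv, ← BHom.comp_assoc,
      BHom.comp_assoc D.τ₁.inv, e.comm_τ₁, D.τ₁.inv_hom, BHom.id_comp]
  rw [DatumOn.det, DatumOn.det, ← e.comm_τ₂, ← h₁]
  congr 1
  rw [← BHom.comp_assoc, BHom.comp_assoc D.τ₁.inv, ← BHom.det_comp, ← e.comm_φ, BHom.det_comp,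
    ← BHom.comp_assoc D.τ₁.inv]

theorem DatumOn.det_pull {𝒰 : Cover Z} (f : Z' ⟶ Z) (𝒲 : Cover Z')
    (h : Cover.Refines f 𝒲 𝒰) (D : DatumOn 𝒰) :
    (D.pull f 𝒲 h).det = f.appTop.hom D.det := by
  refine (BHom.eq_toSection _ _ fun z ↦ ?_).symm
  have h₁ := congrArg (pb f (𝒲.U z) (h z))
    (BHom.res_toSection ((D.τ₁.inv.comp D.φ.det).comp D.τ₂.hom) (f z))
  rw [pb_res] at h₁
  have h₂ : res (𝒲.U z) le_top (f.appTop.hom D.det) = pb f (𝒲.U z) le_top D.det := rfl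
  rw [h₂]
  refine h₁.trans ?_
  simp only [BHom.comp_m, ent_mul, BHom.det_m, ent_scalar, map_mul, DatumOn.pull_τ₁,
    DatumOn.pull_τ₂, DatumOn.pull_φ, BIso.pullDet_inv_m, BIso.pullDet_hom_m, ent_pbM]
  exact congrArg₂ HMul.hMul rfl (congrArg₂ HMul.hMul (det_pbM f (h z) (D.φ.m (f z))).symm rfl)

theorem Datum.Equiv.refl (D : Datum Z) : D.Equiv D :=
  ⟨D.cover, fun _ ↦ le_rfl, fun _ ↦ le_rfl, ⟨.refl _⟩⟩

theorem Datum.Equiv.symm {D D' : Datum Z} (e : D.Equiv D') : D'.Equiv D := by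
  obtain ⟨𝒲, h, h', ⟨e⟩⟩ := e
  exact ⟨𝒲, h', h, ⟨e.symm⟩⟩

theorem Datum.Equiv.trans {D D' D'' : Datum Z} (e : D.Equiv D') (e' : D'.Equiv D'') :
    D.Equiv D'' := by
  obtain ⟨𝒲₁, h₁, h₁', ⟨e₁⟩⟩ := e
  obtain ⟨𝒲₂, h₂, h₂', ⟨e₂⟩⟩ := e'
  have l₁ : Cover.Refines (𝟙 Z) (𝒲₁.inf 𝒲₂) 𝒲₁ := fun z ↦ inf_le_left
  have l₂ : Cover.Refines (𝟙 Z) (𝒲₁.inf 𝒲₂) 𝒲₂ := fun z ↦ inf_le_right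
  exact ⟨𝒲₁.inf 𝒲₂, l₁.trans_id h₁, l₂.trans_id h₂',
    ⟨(e₁.refine (𝟙 Z) _ l₁ (l₁.trans_id h₁) (l₁.trans_id h₁')).trans
      (e₂.refine (𝟙 Z) _ l₂ (l₁.trans_id h₁') (l₂.trans_id h₂'))⟩⟩

instance Datum.setoid (Z : Scheme.{u}) : Setoid (Datum Z) :=
  ⟨Datum.Equiv, .refl, .symm, .trans⟩

theorem Datum.Equiv.pull {D D' : Datum Z} (e : D.Equiv D') (f : Z' ⟶ Z) :
    (D.pull f).Equiv (D'.pull f) := by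
  obtain ⟨𝒲, h, h', ⟨e⟩⟩ := e
  have l : Cover.Refines f (𝒲.preimage f) 𝒲 := fun _ ↦ le_rfl
  have k : Cover.Refines (𝟙 Z') (𝒲.preimage f) (D.cover.preimage f) := fun z ↦ (l.trans_id h) z
  have k' : Cover.Refines (𝟙 Z') (𝒲.preimage f) (D'.cover.preimage f) := fun z ↦ (l.trans_id h') z
  exact ⟨𝒲.preimage f, k, k', ⟨(e.refine f _ l (l.trans_id h) (l.trans_id h')).cast
    (DatumOn.pull_pull_id f _ k _ D.on).symm (DatumOn.pull_pull_id f _ k' _ D'.on).symm⟩⟩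

theorem Datum.pull_id (D : Datum Z) : (D.pull (𝟙 Z)).Equiv D :=
  ⟨D.cover, fun _ ↦ le_rfl, fun _ ↦ le_rfl,
    ⟨(DatumOn.Iso.refl _).cast (DatumOn.pull_pull_id (𝟙 Z) _ _ (fun _ ↦ le_rfl) D.on).symm rfl⟩⟩

theorem Datum.pull_comp (D : Datum Z) (f : Z' ⟶ Z) (g : Z'' ⟶ Z') :
    D.pull (g ≫ f) = (D.pull f).pull g :=
  congrArg (Datum.mk _) (DatumOn.pull_pull f g _ _ (fun _ ↦ le_rfl) _).symm

theorem Datum.toLineMap_pull (f : Z' ⟶ Z) (D : Datum Z) :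
    (D.pull f).toLineMap = D.toLineMap.pull f :=
  congrArg (LineMap.mk _) (DatumOn.toLineMap_pull f _ _ D.on)

theorem Datum.Equiv.toLineMap {D D' : Datum Z} (e : D.Equiv D') :
    D.toLineMap.Equiv D'.toLineMap := by
  obtain ⟨𝒲, h, h', ⟨e⟩⟩ := e
  exact ⟨𝒲, h, h', ⟨e.toLineMap.cast (DatumOn.toLineMap_pull (𝟙 Z) 𝒲 h D.on)
    (DatumOn.toLineMap_pull (𝟙 Z) 𝒲 h' D'.on)⟩⟩

theorem Datum.det_pull (f : Z' ⟶ Z) (D : Datum Z) : (D.pull f).det = f.appTop.hom D.det :=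
  DatumOn.det_pull f _ _ D.on

theorem Datum.Equiv.det_eq {D D' : Datum Z} (e : D.Equiv D') : D.det = D'.det := by
  obtain ⟨𝒲, h, h', ⟨e⟩⟩ := e
  have := e.det_eq
  rw [DatumOn.det_pull, DatumOn.det_pull] at this
  rw [Scheme.Hom.id_appTop] at this
  exact this

theorem DatumOn.Iso.isNonzero {𝒰 : Cover Z} {D D' : DatumOn 𝒰} (e : D.Iso D')
    (h : D.φ.IsNonzero) : D'.φ.IsNonzero := by
  obtain ⟨z, hz⟩ := h
  refine ⟨z, fun h' ↦ hz ?_⟩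
  have h₁ : D.φ = (e.b₁.hom.comp D'.φ).comp e.b₂.inv := by
    rw [e.comm_φ, BHom.comp_assoc, e.b₂.hom_inv, BHom.comp_id]
  rw [h₁, BHom.comp_m, BHom.comp_m, Matrix.map_mul, Matrix.map_mul, h', Matrix.zero_mul,
    Matrix.mul_zero]

theorem DatumOn.isNonzero_refine {𝒰 𝒲 : Cover Z} (h : Cover.Refines (𝟙 Z) 𝒲 𝒰) (D : DatumOn 𝒰) :
    (D.pull (𝟙 Z) 𝒲 h).φ.IsNonzero ↔ D.φ.IsNonzero := by
  have : ∀ z, ((D.pull (𝟙 Z) 𝒲 h).φ.m z).map (germ z (𝒲.mem z)) =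
      (D.φ.m z).map (germ z (𝒰.mem z)) := fun z ↦ by
    ext i j
    exact (congrArg (germ z (𝒲.mem z)) (pb_id (h z) (D.φ.m z i j))).trans (germ_res _ _ _)
  simp only [BHom.IsNonzero, this]

theorem Datum.Equiv.isNonzero {D D' : Datum Z} (e : D.Equiv D') (h : D.on.φ.IsNonzero) :
    D'.on.φ.IsNonzero := by
  obtain ⟨𝒲, k, k', ⟨e⟩⟩ := e
  exact (DatumOn.isNonzero_refine k' D'.on).mp
    (e.isNonzero ((DatumOn.isNonzero_refine k D.on).mpr h))

end

/-! ### Global functions on `X × S` -/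

theorem isIso_appTop_of_isProper {k : Type u} [Field k] [IsAlgClosed k] {X : Scheme.{u}}
    (f : X ⟶ Spec (.of k)) [IsProper f] [IsIntegral X] : IsIso f.appTop := by
  have h := IsAlgClosed.ringHom_bijective_of_isIntegral (k := k) (K := Γ(X, ⊤))
     ((Scheme.ΓSpecIso (.of k)).inv ≫ f.appTop).hom ?_
  · have : IsIso ((Scheme.ΓSpecIso (.of k)).inv ≫ f.appTop) := by
      rw [ConcreteCategory.isIso_iff_bijective]; exact h
    exact IsIso.of_isIso_comp_left (Scheme.ΓSpecIso (.of k)).inv _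
  · exact RingHom.isIntegral_respectsIso.2 (e := (Scheme.ΓSpecIso _).symm.commRingCatIsoToRingEquiv) _
      (isIntegral_appTop_of_universallyClosed f)

theorem isIso_app_snd {k : Type u} [Field k] [IsAlgClosed k] {X S : Scheme.{u}}
    (f : X ⟶ Spec (.of k)) [IsProper f] [IsIntegral X] (g : S ⟶ Spec (.of k)) (U : S.Opens) (hU : IsAffineOpen U) :
    IsIso ((pullback.snd f g).app U) := by
  have : IsIso (f.appLE ⊤ ⊤ le_top) := by
    have h : f.appLE ⊤ ⊤ le_top = f.appTop := f.appLE_eq_app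
    rw [h]
    exact isIso_appTop_of_isProper f
  have hc : CompactSpace X := (quasiCompact_iff_compactSpace f).mp inferInstance
  have hs : QuasiSeparatedSpace X := (quasiSeparated_iff_quasiSeparatedSpace f).mp inferInstance
  have h : IsIso (pushoutSection (IsPullback.of_hasPullback f g) (US := ⊤) (UT := U) (UX := ⊤)
    (UY := (pullback.snd f g) ⁻¹ᵁ U) le_top le_top (by simp)) :=
    isIso_pushoutSection_of_isQuasiSeparated_of_flat_right _ _ _ _ (isAffineOpen_top _) hU
    isCompact_univ (isQuasiSeparated_univ)
  have h₂ := ((isIso_pushoutSection_iff ..).mp h).isIso_inr_of_isIso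
  rwa [Scheme.Hom.appLE_eq_app] at h₂

/-- If `X` is integral and proper over an algebraically closed field, then the functions on `X × S`
are the functions on `S`. -/
theorem isIso_appTop_snd {k : Type u} [Field k] [IsAlgClosed k] {X S : Scheme.{u}}
    (f : X ⟶ Spec (.of k)) [IsProper f] [IsIntegral X] (g : S ⟶ Spec (.of k)) :
    IsIso ((pullback.snd f g).appTop) := by
  let α : S.sheaf ⟶ (TopCat.Sheaf.pushforward _ (pullback.snd f g).base).obj (pullback f g).sheaf :=
    ⟨(pullback.snd f g).c⟩
  have hb : Opens.IsBasis (Set.range (fun U : S.affineOpens ↦ (U : S.Opens))) := by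
    rw [Subtype.range_coe]; exact S.isBasis_affineOpens
  have hα : IsIso α := TopCat.Sheaf.isIso_iff_isIso_basis hb (φ := α) fun U ↦ isIso_app_snd f g U.1 U.2
  have hα₂ : IsIso α.hom := @Functor.map_isIso _ _ _ _ _ _ (TopCat.Sheaf.forget CommRingCat S.carrier) α hα
  exact inferInstanceAs (IsIso (α.hom.app (op ⊤)))

/-! ### The curve and the test schemes -/

section

variable {k : Type u} [Field k] (X : Over (Spec (.of k)))

/-- The product `X × S` over `k`. -/
abbrev prod (S : Over (Spec (.of k))) : Scheme.{u} := pullback X.hom S.hom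

/-- The morphism `X × S' ⟶ X × S` induced by `S' ⟶ S`. -/
def prodMap {S' S : Over (Spec (.of k))} (f : S' ⟶ S) : prod X S' ⟶ prod X S :=
  pullback.lift (pullback.fst X.hom S'.hom) (pullback.snd X.hom S'.hom ≫ f.left)
    (by rw [Category.assoc, Over.w, pullback.condition])

theorem prodMap_fst {S' S : Over (Spec (.of k))} (f : S' ⟶ S) :
    prodMap X f ≫ pullback.fst X.hom S.hom = pullback.fst X.hom S'.hom :=
  pullback.lift_fst _ _ _

theorem prodMap_snd {S' S : Over (Spec (.of k))} (f : S' ⟶ S) :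
    prodMap X f ≫ pullback.snd X.hom S.hom = pullback.snd X.hom S'.hom ≫ f.left :=
  pullback.lift_snd _ _ _

theorem prodMap_id (S : Over (Spec (.of k))) : prodMap X (𝟙 S) = 𝟙 _ := by
  apply pullback.hom_ext <;> simp [prodMap]

theorem prodMap_comp {S'' S' S : Over (Spec (.of k))} (g : S'' ⟶ S') (f : S' ⟶ S) :
    prodMap X (g ≫ f) = prodMap X g ≫ prodMap X f := by
  apply pullback.hom_ext
  · rw [Category.assoc, prodMap_fst, prodMap_fst, prodMap_fst]
  · rw [Category.assoc, prodMap_snd, prodMap_snd, ← Category.assoc, prodMap_snd, Category.assoc,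
      Over.comp_left]

variable {X}

/-- For every geometric point `s` of `S`, the restriction of `L → 𝒪` to the curve `X × s` is
an isomorphism generically (i.e. on a dense open subset), and it is of relative degree `n`. -/
def LineMap.HasRelDegree {S : Over (Spec (.of k))} (D : LineMap (prod X S)) (n : ℕ) : Prop :=
  ∀ (Ω : Type u) [Field Ω] [IsAlgClosed Ω] (a : Spec (.of Ω) ⟶ Spec (.of k)) (s : Over.mk a ⟶ S),
    Dense ((D.pull (prodMap X s)).isoLocus : Set (prod X (Over.mk a))) ∧
      (D.pull (prodMap X s)).HasDegree n

/-- For every geometric point `s` of `S`, the restriction of `φ : E₁ → E₂` to the curve `X × s` is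
not the zero map. -/
def Datum.IsNonzeroOnFibers {S : Over (Spec (.of k))} (D : Datum (prod X S)) : Prop :=
  ∀ (Ω : Type u) [Field Ω] [IsAlgClosed Ω] (a : Spec (.of Ω) ⟶ Spec (.of k)) (s : Over.mk a ⟶ S),
    (D.pull (prodMap X s)).on.φ.IsNonzero

theorem LineMap.HasRelDegree.pull {S' S : Over (Spec (.of k))} {D : LineMap (prod X S)} {n : ℕ}
    (h : D.HasRelDegree n) (f : S' ⟶ S) : (D.pull (prodMap X f)).HasRelDegree n := by
  intro Ω _ _ a s
  rw [← LineMap.pull_comp, ← prodMap_comp]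
  exact h Ω a (s ≫ f)

theorem Datum.IsNonzeroOnFibers.pull {S' S : Over (Spec (.of k))} {D : Datum (prod X S)}
    (h : D.IsNonzeroOnFibers) (f : S' ⟶ S) : (D.pull (prodMap X f)).IsNonzeroOnFibers := by
  intro Ω _ _ a s
  rw [← Datum.pull_comp, ← prodMap_comp]
  exact h Ω a (s ≫ f)

theorem LineMap.HasRelDegree.tensor {S : Over (Spec (.of k))} {D D' : LineMap (prod X S)}
    {n n' : ℕ} (h : D.HasRelDegree n) (h' : D'.HasRelDegree n')
    (hdisj : D.isoLocus ⊔ D'.isoLocus = ⊤) : (D.tensor D').HasRelDegree (n + n') := by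
  intro Ω _ _ a s
  rw [LineMap.pull_tensor, LineMap.isoLocus_tensor]
  refine ⟨(h Ω a s).1.inter_of_isOpen_left (h' Ω a s).1 (LineMap.isoLocus _).isOpen,
    (h Ω a s).2.tensor (h' Ω a s).2 ?_⟩
  rw [LineMap.isoLocus_pull, LineMap.isoLocus_pull]
  exact (congrArg (fun U : (prod X S).Opens ↦ prodMap X s ⁻¹ᵁ U) hdisj :)

/-! ### The spaces, as functors of points -/

variable (k) in
/-- The affine line over `k`: an `S`-point is a global function on `S`. -/
@[simps]
def A1 : (Over (Spec (.of k)))ᵒᵖ ⥤ Type u where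
  obj S := Γ(S.unop.left, ⊤)
  map f := ↾fun a ↦ f.unop.left.appTop.hom a

/-- The `S`-point of the affine line given by a scalar `c`. -/
def const (c : k) (S : Over (Spec (.of k))) : Γ(S.left, ⊤) :=
  S.hom.appTop.hom ((Scheme.ΓSpecIso (.of k)).inv.hom c)

theorem const_map (c : k) {S' S : Over (Spec (.of k))} (f : S' ⟶ S) :
    f.left.appTop.hom (const c S) = const c S' := by
  have h := congrArg (fun g ↦ g.appTop.hom ((Scheme.ΓSpecIso (.of k)).inv.hom c)) (Over.w f)
  simp only [Scheme.Hom.comp_appTop, CommRingCat.hom_comp, RingHom.comp_apply] at h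
  exact h

variable (X)

/-- Isomorphism classes of line bundles on `X × S` with a map `L → 𝒪`. -/
@[simps]
def lineMaps : (Over (Spec (.of k)))ᵒᵖ ⥤ Type u where
  obj S := Quotient (LineMap.setoid (prod X S.unop))
  map f := ↾Quotient.map (LineMap.pull (prodMap X f.unop)) fun _ _ e ↦ e.pull _
  map_id S := by
    ext ⟨D⟩
    refine Quotient.sound ?_
    rw [unop_id, prodMap_id]
    exact D.pull_id
  map_comp f g := by
    ext ⟨D⟩
    refine congrArg (Quotient.mk _) ?_
    rw [unop_comp, prodMap_comp]
    exact D.pull_comp _ _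

/-- Isomorphism classes of data `L → E₁ → E₂ → 𝒪` on `X × S`. -/
@[simps]
def data : (Over (Spec (.of k)))ᵒᵖ ⥤ Type u where
  obj S := Quotient (Datum.setoid (prod X S.unop))
  map f := ↾Quotient.map (Datum.pull (prodMap X f.unop)) fun _ _ e ↦ e.pull _
  map_id S := by
    ext ⟨D⟩
    refine Quotient.sound ?_
    rw [unop_id, prodMap_id]
    exact D.pull_id
  map_comp f g := by
    ext ⟨D⟩
    refine congrArg (Quotient.mk _) ?_
    rw [unop_comp, prodMap_comp]
    exact D.pull_comp _ _

variable {X}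

/-- The open subset of `X × S` on which `L → 𝒪` is an isomorphism, i.e. the complement of the
support of the divisor. -/
def locus {S : (Over (Spec (.of k)))ᵒᵖ} : (lineMaps X).obj S → (prod X S.unop).Opens :=
  Quotient.lift LineMap.isoLocus fun _ _ e ↦ e.isoLocus

/-- The sum `L ⊗ L' → 𝒪` of the divisors `L → 𝒪` and `L' → 𝒪`. -/
def sum {S : (Over (Spec (.of k)))ᵒᵖ} :
    (lineMaps X).obj S → (lineMaps X).obj S → (lineMaps X).obj S :=
  Quotient.map₂ LineMap.tensor fun _ _ e _ _ e' ↦ e.tensor e'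

theorem locus_map {S S' : (Over (Spec (.of k)))ᵒᵖ} (f : S ⟶ S') (x : (lineMaps X).obj S) :
    locus ((lineMaps X).map f x) = prodMap X f.unop ⁻¹ᵁ locus x := by
  obtain ⟨D⟩ := x
  exact D.isoLocus_pull _

theorem sum_map {S S' : (Over (Spec (.of k)))ᵒᵖ} (f : S ⟶ S') (x y : (lineMaps X).obj S) :
    (lineMaps X).map f (sum x y) = sum ((lineMaps X).map f x) ((lineMaps X).map f y) := by
  obtain ⟨D⟩ := x
  obtain ⟨E⟩ := y
  exact congrArg (Quotient.mk _) (D.pull_tensor _ E)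

variable (X)

/-- The symmetric power `X^{(n)}`, as a subfunctor of `lineMaps X`. -/
@[simps]
def symSub (n : ℕ) : Subfunctor (lineMaps X) where
  obj S := Quotient.mk _ '' {D : LineMap (prod X S.unop) | D.HasRelDegree n}
  map := by
    rintro S S' f _ ⟨D, hD, rfl⟩
    exact ⟨D.pull (prodMap X f.unop), hD.pull f.unop, rfl⟩

/-- The symmetric power `X^{(n)}`: an `S`-point is a line bundle `L` on `X × S` with a map
`L → 𝒪` which on all geometric fibers is injective of relative degree `n`. -/
abbrev Sym (n : ℕ) : (Over (Spec (.of k)))ᵒᵖ ⥤ Type u := (symSub X n).toFunctor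

/-- The local model `Y^n`, as a subfunctor of `data X`. -/
@[simps]
def modelSub (n : ℕ) : Subfunctor (data X) where
  obj S := Quotient.mk _ ''
    {D : Datum (prod X S.unop) | D.IsNonzeroOnFibers ∧ D.toLineMap.HasRelDegree n}
  map := by
    rintro S S' f _ ⟨D, ⟨hD, hD'⟩, rfl⟩
    refine ⟨D.pull (prodMap X f.unop), ⟨hD.pull f.unop, ?_⟩, rfl⟩
    rw [Datum.toLineMap_pull]
    exact hD'.pull f.unop

/-- The local model `Y^n`: an `S`-point consists of vector bundles `E₁`, `E₂` of rank `2` on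
`X × S` with trivialized determinants, a map `φ : E₁ → E₂` that is nonzero on all geometric fibers,
a line subbundle `L` of `E₁` and a quotient `E₂ → 𝒪` such that the composite `L → 𝒪` is on all
geometric fibers generically an isomorphism and of relative degree `n`. -/
abbrev Y (n : ℕ) : (Over (Spec (.of k)))ᵒᵖ ⥤ Type u := (modelSub X n).toFunctor

/-- The map that remembers only the composite `L → 𝒪`. -/
@[simps]
def toLineMaps : data X ⟶ lineMaps X where
  app S := ↾Quotient.map Datum.toLineMap fun _ _ e ↦ e.toLineMap
  naturality S S' f := by
    ext ⟨D⟩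
    exact congrArg (Quotient.mk _) (D.toLineMap_pull _)

/-- The projection `π : Y^n → X^{(n)}`, which remembers only the composite `L → 𝒪`. -/
def π (n : ℕ) : Y X n ⟶ Sym X n :=
  Subfunctor.lift ((modelSub X n).ι ≫ toLineMaps X) (by
    rintro S _ ⟨⟨_, D, hD, rfl⟩, rfl⟩
    exact ⟨D.toLineMap, hD.2, rfl⟩)

/-- The map `F × G → F' × G'` given by `F → F'` and `G → G'`. -/
abbrev prodHom {C : Type*} [Category C] {F F' G G' : C ⥤ Type u} (a : F ⟶ F') (b : G ⟶ G') :
    FunctorToTypes.prod F G ⟶ FunctorToTypes.prod F' G' :=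
  FunctorToTypes.prod.lift (FunctorToTypes.prod.fst ≫ a) (FunctorToTypes.prod.snd ≫ b)

/-- The disjoint locus of `X^{(n₁)} × X^{(n₂)}`: the pairs of divisors with disjoint supports. -/
@[simps]
def disjSub (n₁ n₂ : ℕ) : Subfunctor (FunctorToTypes.prod (Sym X n₁) (Sym X n₂)) where
  obj S := {p | locus p.1.1 ⊔ locus p.2.1 = ⊤}
  map {S S'} f p hp := by
    have := congrArg (fun U : (prod X _).Opens ↦ prodMap X f.unop ⁻¹ᵁ U) hp
    exact (congrArg₂ (· ⊔ ·) (locus_map f p.1.1) (locus_map f p.2.1)).trans this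

/-- The disjoint locus of `X^{(n₁)} × X^{(n₂)}`. -/
abbrev disj (n₁ n₂ : ℕ) : (Over (Spec (.of k)))ᵒᵖ ⥤ Type u := (disjSub X n₁ n₂).toFunctor

/-- The addition of effective divisors, on the disjoint locus. -/
@[simps]
def add (n₁ n₂ : ℕ) : disj X n₁ n₂ ⟶ Sym X (n₁ + n₂) where
  app S := ↾fun p ↦ ⟨sum p.1.1.1 p.1.2.1, by
    obtain ⟨⟨⟨_, D, hD, rfl⟩, ⟨_, E, hE, rfl⟩⟩, h⟩ := p
    exact ⟨D.tensor E, hD.tensor hE h, rfl⟩⟩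
  naturality S S' f := by
    ext p
    exact Subtype.ext (sum_map f p.1.1.1 p.1.2.1).symm

section

variable [IsAlgClosed k] [IsProper X.hom] [IsIntegral X.left]

/-- The function on `S` whose pullback to `X × S` is the given function. -/
def descend {S : Over (Spec (.of k))} (a : Γ(prod X S, ⊤)) : Γ(S.left, ⊤) :=
  haveI := isIso_appTop_snd X.hom S.hom
  (inv (pullback.snd X.hom S.hom).appTop).hom a

theorem appTop_descend {S : Over (Spec (.of k))} (a : Γ(prod X S, ⊤)) :
    (pullback.snd X.hom S.hom).appTop.hom (descend X a) = a := by
  have := isIso_appTop_snd X.hom S.hom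
  have := IsIso.inv_hom_id (pullback.snd X.hom S.hom).appTop
  exact congrArg (fun g ↦ g.hom a) this

theorem descend_appTop {S' S : Over (Spec (.of k))} (f : S' ⟶ S) (a : Γ(prod X S, ⊤)) :
    descend X ((prodMap X f).appTop.hom a) = f.left.appTop.hom (descend X a) := by
  have := isIso_appTop_snd X.hom S'.hom
  have hinj := ((ConcreteCategory.isIso_iff_bijective
    (pullback.snd X.hom S'.hom).appTop).mp inferInstance).1
  apply hinj
  refine (appTop_descend X _).trans ?_
  have h₁ := congrArg (fun g ↦ g.appTop.hom (descend X a)) (prodMap_snd X f)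
  simp only [Scheme.Hom.comp_appTop, CommRingCat.hom_comp, RingHom.comp_apply] at h₁
  rw [appTop_descend] at h₁
  exact h₁

/-- The determinant of `φ : E₁ → E₂`, as a function on `S`. -/
@[simps]
def detMap : data X ⟶ A1 k where
  app S := ↾Quotient.lift (fun D : Datum (prod X S.unop) ↦ descend X D.det)
    fun _ _ e ↦ congrArg (descend X) e.det_eq
  naturality S S' f := by
    ext ⟨D⟩
    exact (congrArg (descend X) (D.det_pull _)).trans (descend_appTop X f.unop D.det)

/-- The map `v : Y^n → 𝔸¹` given by the determinant of `φ`. -/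
abbrev v (n : ℕ) : Y X n ⟶ A1 k := (modelSub X n).ι ≫ detMap X

/-- The disjoint locus of the fiber product of `Y^{n₁}` and `Y^{n₂}` over `𝔸¹`: the pairs of points
with the same image in `𝔸¹` whose divisors have disjoint supports. -/
@[simps]
def fiberProdSub (n₁ n₂ : ℕ) : Subfunctor (FunctorToTypes.prod (Y X n₁) (Y X n₂)) where
  obj S := {p | (v X n₁).app S p.1 = (v X n₂).app S p.2 ∧
    (prodHom (π X n₁) (π X n₂)).app S p ∈ (disjSub X n₁ n₂).obj S}
  map {S S'} f p hp := by
    refine ⟨?_, ?_⟩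
    · have h := congrArg ((A1 k).map f) hp.1
      exact (NatTrans.naturality_apply (v X n₁) f p.1).trans
        (h.trans (NatTrans.naturality_apply (v X n₂) f p.2).symm)
    · have h := (disjSub X n₁ n₂).map f hp.2
      exact Set.mem_of_eq_of_mem (NatTrans.naturality_apply (prodHom (π X n₁) (π X n₂)) f p) h

/-- The disjoint locus of the fiber product of `Y^{n₁}` and `Y^{n₂}` over `𝔸¹`. -/
abbrev fiberProd (n₁ n₂ : ℕ) : (Over (Spec (.of k)))ᵒᵖ ⥤ Type u := (fiberProdSub X n₁ n₂).toFunctor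

/-- The map from the disjoint locus of the fiber product to the disjoint locus of
`X^{(n₁)} × X^{(n₂)}` that is induced by `π × π`. -/
def fiberProdπ (n₁ n₂ : ℕ) : fiberProd X n₁ n₂ ⟶ disj X n₁ n₂ :=
  Subfunctor.lift ((fiberProdSub X n₁ n₂).ι ≫ prodHom (π X n₁) (π X n₂)) (by
    rintro S _ ⟨p, rfl⟩
    exact p.2.2)

/-- The map from the disjoint locus of the fiber product to `𝔸¹`. -/
def fiberProdv (n₁ n₂ : ℕ) : fiberProd X n₁ n₂ ⟶ A1 k :=
  (fiberProdSub X n₁ n₂).ι ≫ FunctorToTypes.prod.fst ≫ v X n₁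

/-- The fiber `Y^n_c` of `Y^n → 𝔸¹` over a scalar `c`. -/
@[simps]
def fiberSub (n : ℕ) (c : k) : Subfunctor (Y X n) where
  obj S := {y | (v X n).app S y = const c S.unop}
  map {S S'} f y hy := by
    refine (NatTrans.naturality_apply (v X n) f y).trans ?_
    exact (congrArg ((A1 k).map f) hy).trans (const_map c f.unop)

/-- The fiber `Y^n_c` of `Y^n → 𝔸¹` over a scalar `c`. -/
abbrev Yc (n : ℕ) (c : k) : (Over (Spec (.of k)))ᵒᵖ ⥤ Type u := (fiberSub X n c).toFunctor

/-- The disjoint locus of `Y^{n₁}_c × Y^{n₂}_c`. -/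
@[simps]
def prodFiberSub (n₁ n₂ : ℕ) (c : k) :
    Subfunctor (FunctorToTypes.prod (Yc X n₁ c) (Yc X n₂ c)) where
  obj S := {p | (prodHom ((fiberSub X n₁ c).ι ≫ π X n₁) ((fiberSub X n₂ c).ι ≫ π X n₂)).app S p ∈
    (disjSub X n₁ n₂).obj S}
  map {S S'} f p hp := by
    have h := (disjSub X n₁ n₂).map f hp
    have e := NatTrans.naturality_apply
      (prodHom ((fiberSub X n₁ c).ι ≫ π X n₁) ((fiberSub X n₂ c).ι ≫ π X n₂)) f p
    exact (congrArg (· ∈ (disjSub X n₁ n₂).obj S') e).mpr h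

/-- The disjoint locus of `Y^{n₁}_c × Y^{n₂}_c`. -/
abbrev prodFiber (n₁ n₂ : ℕ) (c : k) : (Over (Spec (.of k)))ᵒᵖ ⥤ Type u :=
  (prodFiberSub X n₁ n₂ c).toFunctor

/-- The map from the disjoint locus of `Y^{n₁}_c × Y^{n₂}_c` to the disjoint locus of
`X^{(n₁)} × X^{(n₂)}` that is induced by `π × π`. -/
def prodFiberπ (n₁ n₂ : ℕ) (c : k) : prodFiber X n₁ n₂ c ⟶ disj X n₁ n₂ :=
  Subfunctor.lift ((prodFiberSub X n₁ n₂ c).ι ≫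
    prodHom ((fiberSub X n₁ c).ι ≫ π X n₁) ((fiberSub X n₂ c).ι ≫ π X n₂)) (by
      rintro S _ ⟨p, rfl⟩
      exact p.2)

/-- The inclusion of the disjoint locus of `Y^{n₁}_c × Y^{n₂}_c` into the disjoint locus of the
fiber product of `Y^{n₁}` and `Y^{n₂}` over `𝔸¹`. -/
def prodFiberι (n₁ n₂ : ℕ) (c : k) : prodFiber X n₁ n₂ c ⟶ fiberProd X n₁ n₂ :=
  Subfunctor.lift ((prodFiberSub X n₁ n₂ c).ι ≫ prodHom (fiberSub X n₁ c).ι (fiberSub X n₂ c).ι) (by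
    rintro S _ ⟨p, rfl⟩
    exact ⟨p.1.1.2.trans p.1.2.2.symm, p.2⟩)

end

/-- The restriction of (an isomorphism class of) data to an open subset. -/
def restrict {Z : Scheme.{u}} (U : Z.Opens) :
    Quotient (Datum.setoid Z) → Quotient (Datum.setoid U) :=
  Quotient.map (Datum.pull U.ι) fun _ _ e ↦ e.pull _

end

end

end VinLoc

/-!
The proof rests on the rigidity of the data `L → E₁ → E₂ → 𝒪` away from the divisor of the
composite `L → 𝒪`. Where this composite is an isomorphism, `L` splits off from `E₁` and from `E₂`,
with complements the kernels of the maps to `𝒪`. The trivializations of the determinants identify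
these kernels with `𝒪`. Hence the datum is isomorphic to the standard one, given by `𝒪 ⊂ 𝒪²`, the
diagonal map with entries `1` and `d`, and the projection `𝒪² → 𝒪`, where `d` is the determinant
(`DatumAt.exists_rel_std`). Moreover, the isomorphism is unique, since the standard datum has no
automorphisms (`DatumAt.eq_one_of_rel_std`).

Let `y₁`, `y₂` be two data on `Z = X × S` with the same determinant, whose divisors `D₁`, `D₂` are
disjoint. Then `Z ∖ D₂` and `Z ∖ D₁` cover `Z`, and on the overlap `y₁` and `y₂` are uniquely
isomorphic. So there is a datum that restricts to `y₁` on `Z ∖ D₂` and to `y₂` on `Z ∖ D₁`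
(`Datum.exists_glue`), and only one (`Datum.equiv_of_pull_equiv`). It is `t(y₁, y₂)`, and the
uniqueness makes it compatible with base change (`existsUnique_isSum`, `IsSum.map`). Its divisor is
`D₁ + D₂`, since line bundles with a map to `𝒪` are rigid in the same way away from the divisor
(`Datum.toLineMap_equiv_tensor`). Conversely, let `y` be a datum with divisor `D₁ + D₂`. Then `y₁`
is obtained by gluing the restriction of `y` to `Z ∖ D₂` with the standard datum on `Z ∖ D₁`, and
likewise for `y₂` (`Datum.exists_summand`, `exists_isSum`). These are the only choices, because
`y₁` is standard away from `D₁` (`Datum.equiv_of_toLineMap_equiv`, `IsSum.eq`). This shows that the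
square is cartesian, and the square over a scalar `c` follows because `t` preserves determinants.

Gluing isomorphism classes of bundles given by transition matrices is a matter of cocycles. It is
carried out for points of a quotient stack `[X/G]` (`Model`, `Desc`), which covers both the line
bundles with a map to `𝒪` and the data `L → E₁ → E₂ → 𝒪`. Objects and isomorphisms over the members
of an open cover glue if the local points have trivial stabilizers on the overlaps, since the
cocycle condition and the compatibility of the isomorphisms are then automatic (`Desc.exists_glue`,
`Desc.GoodOn.equiv_of_equivOn`).
-/

namespace VinLoc

noncomputable section

/-! ### Restriction and pullback as ring homomorphisms -/

section ringHoms

variable {Z Z' : Scheme.{u}}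

theorem res_comp_res {U V W : Z.Opens} (h : V ≤ U) (h' : W ≤ V) :
    (res W h').comp (res V h) = res W (h'.trans h) :=
  RingHom.ext fun a ↦ res_res h h' a

theorem res_comp_pb (f : Z' ⟶ Z) {U : Z.Opens} {V W : Z'.Opens} (h : V ≤ f ⁻¹ᵁ U) (h' : W ≤ V) :
    (res W h').comp (pb f V h) = pb f W (h'.trans h) :=
  RingHom.ext fun a ↦ res_pb f h h' a

theorem pb_comp_res (f : Z' ⟶ Z) {U V : Z.Opens} {W : Z'.Opens} (h : V ≤ U) (h' : W ≤ f ⁻¹ᵁ V) :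
    (pb f W h').comp (res V h) = pb f W (h'.trans ((Opens.map f.base).map (homOfLE h)).le) :=
  RingHom.ext fun a ↦ pb_res f h h' a

theorem res_eq_id {U : Z.Opens} (h : U ≤ U) : res U h = RingHom.id _ :=
  RingHom.ext fun a ↦ res_self h a

theorem image_le_of_le_preimage {U O : Z.Opens} {W : U.toScheme.Opens} (h : W ≤ U.ι ⁻¹ᵁ O) :
    U.ι ''ᵁ W ≤ O := by
  rintro _ ⟨x, hx, rfl⟩
  exact h hx

/-- A function on an open subset `W` of the open subscheme `U`, as a function on an open subset of
the ambient scheme. -/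
def ofOpen {U : Z.Opens} {W : U.toScheme.Opens} (V : Z.Opens) (h : V ≤ U.ι ''ᵁ W) :
    Γ(U, W) →+* Γ(Z, V) :=
  (res V h).comp (U.ι.appIso W).inv.hom

theorem res_comp_ofOpen {U : Z.Opens} {W : U.toScheme.Opens} {V V' : Z.Opens}
    (h : V ≤ U.ι ''ᵁ W) (h' : V' ≤ V) :
    (res V' h').comp (ofOpen V h) = ofOpen V' (h'.trans h) := by
  rw [ofOpen, ← RingHom.comp_assoc, res_comp_res]
  rfl

theorem ofOpen_comp_res {U : Z.Opens} {W W' : U.toScheme.Opens} {V : Z.Opens}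
    (h : V ≤ U.ι ''ᵁ W') (h' : W' ≤ W) :
    (ofOpen V h).comp (res W' h') =
      ofOpen V (h.trans (U.ι.image_mono h')) := by
  have := U.ι.appIso_inv_naturality (homOfLE h').op
  have := congrArg CommRingCat.Hom.hom this
  rw [CommRingCat.hom_comp, CommRingCat.hom_comp] at this
  rw [ofOpen, RingHom.comp_assoc, res, res, this, ← RingHom.comp_assoc]
  exact congrArg (RingHom.comp · _) (res_comp_res _ _)

theorem ofOpen_comp_pb {U : Z.Opens} {W : U.toScheme.Opens} {V : Z.Opens} {O : Z.Opens}
    (h : V ≤ U.ι ''ᵁ W) (h' : W ≤ U.ι ⁻¹ᵁ O) :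
    (ofOpen V h).comp (pb U.ι W h') =
      res V (h.trans (image_le_of_le_preimage h')) := by
  have := U.ι.appLE_appIso_inv h'
  have := congrArg CommRingCat.Hom.hom this
  rw [CommRingCat.hom_comp] at this
  rw [ofOpen, RingHom.comp_assoc, pb, this]
  exact res_comp_res _ _

theorem Cover.preimage_le (𝒰 : Cover Z) (f : Z' ⟶ Z) (z : Z') :
    (𝒰.preimage f).U z ≤ f ⁻¹ᵁ 𝒰.U (f z) :=
  le_rfl

theorem Cover.preimage_le₂ (𝒰 : Cover Z) (f : Z' ⟶ Z) (z w : Z') :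
    (𝒰.preimage f).U z ⊓ (𝒰.preimage f).U w ≤ f ⁻¹ᵁ (𝒰.U (f z) ⊓ 𝒰.U (f w)) :=
  le_rfl

theorem Cover.preimage_le₃ (𝒰 : Cover Z) (f : Z' ⟶ Z) (z w v : Z') :
    (𝒰.preimage f).U z ⊓ (𝒰.preimage f).U w ⊓ (𝒰.preimage f).U v ≤
      f ⁻¹ᵁ (𝒰.U (f z) ⊓ 𝒰.U (f w) ⊓ 𝒰.U (f v)) :=
  le_rfl

end ringHoms

/-! ### Descent data for a group acting on a set, functorially in a commutative ring -/

/-- A group `G` acting on a set `X`, both depending functorially on a commutative ring: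
`Rel g x y` says that `g` takes `x` to `y`. Moreover, a class of elements of `X`, stable under
base change, that have trivial stabilizers. -/
structure Model where
  G : (R : Type u) → [CommRing R] → Type u
  X : (R : Type u) → [CommRing R] → Type u
  group : ∀ (R : Type u) [CommRing R], Group (G R)
  mapG : ∀ {R S : Type u} [CommRing R] [CommRing S], (R →+* S) → G R →* G S
  mapX : ∀ {R S : Type u} [CommRing R] [CommRing S], (R →+* S) → X R → X S
  mapG_id : ∀ {R : Type u} [CommRing R] (g : G R), mapG (RingHom.id R) g = g
  mapX_id : ∀ {R : Type u} [CommRing R] (x : X R), mapX (RingHom.id R) x = x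
  mapG_mapG : ∀ {R S T : Type u} [CommRing R] [CommRing S] [CommRing T] (f : R →+* S) (f' : S →+* T)
    (g : G R), mapG f' (mapG f g) = mapG (f'.comp f) g
  mapX_mapX : ∀ {R S T : Type u} [CommRing R] [CommRing S] [CommRing T] (f : R →+* S) (f' : S →+* T)
    (x : X R), mapX f' (mapX f x) = mapX (f'.comp f) x
  Rel : ∀ {R : Type u} [CommRing R], G R → X R → X R → Prop
  rel_one : ∀ {R : Type u} [CommRing R] (x : X R), Rel 1 x x
  rel_mul : ∀ {R : Type u} [CommRing R] {g h : G R} {x y z : X R},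
    Rel g x y → Rel h y z → Rel (h * g) x z
  rel_inv : ∀ {R : Type u} [CommRing R] {g : G R} {x y : X R}, Rel g x y → Rel g⁻¹ y x
  rel_map : ∀ {R S : Type u} [CommRing R] [CommRing S] (f : R →+* S) {g : G R} {x y : X R},
    Rel g x y → Rel (mapG f g) (mapX f x) (mapX f y)
  Good : ∀ {R : Type u} [CommRing R], X R → Prop
  good_map : ∀ {R S : Type u} [CommRing R] [CommRing S] (f : R →+* S) {x : X R},
    Good x → Good (mapX f x)
  rigid : ∀ {R : Type u} [CommRing R] {g : G R} {x : X R}, Good x → Rel g x x → g = 1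

attribute [instance] Model.group

namespace Model

variable {M : Model.{u}} {R : Type u} [CommRing R]

theorem eq_of_rel {g h : M.G R} {x y : M.X R} (hx : M.Good x) (hg : M.Rel g x y)
    (hh : M.Rel h x y) : g = h := by
  have := M.rigid hx (M.rel_mul hg (M.rel_inv hh))
  exact (inv_mul_eq_one.mp this).symm

end Model

/-- A point of the quotient stack `[X/G]` over the scheme `Z`, given by descent data relative to
an open cover: local points of `X`, and transition elements of `G` that satisfy the cocycle
condition. -/
structure Desc (M : Model.{u}) (Z : Scheme.{u}) where
  cover : Cover Z
  x : ∀ z, M.X Γ(Z, cover.U z)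
  g : ∀ z w, M.G Γ(Z, cover.U z ⊓ cover.U w)
  rel : ∀ z w, M.Rel (g z w) (M.mapX (res _ inf_le_right) (x w)) (M.mapX (res _ inf_le_left) (x z))
  g_mul : ∀ z w v,
    M.mapG (res (cover.U z ⊓ cover.U w ⊓ cover.U v) inf_le_left) (g z w) *
      M.mapG (res _ (inf_le_inf_right _ inf_le_right)) (g w v) =
    M.mapG (res _ (inf_le_inf_right _ inf_le_left)) (g z v)

namespace Desc

variable {M : Model.{u}} {Z Z' : Scheme.{u}}

/-- The local point of `X`, restricted to an open subset `V`. -/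
def xr (D : Desc M Z) (z : Z) (V : Z.Opens) (h : V ≤ D.cover.U z) : M.X Γ(Z, V) :=
  M.mapX (res V h) (D.x z)

/-- The transition element of `G`, restricted to an open subset `V`. -/
def gr (D : Desc M Z) (z w : Z) (V : Z.Opens) (h : V ≤ D.cover.U z) (h' : V ≤ D.cover.U w) :
    M.G Γ(Z, V) :=
  M.mapG (res V (le_inf h h')) (D.g z w)

variable (D : Desc M Z)

theorem map_xr {z : Z} {V W : Z.Opens} (h : V ≤ D.cover.U z) (h' : W ≤ V) :
    M.mapX (res W h') (D.xr z V h) = D.xr z W (h'.trans h) := by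
  rw [xr, M.mapX_mapX, res_comp_res]; rfl

theorem map_gr {z w : Z} {V W : Z.Opens} (h : V ≤ D.cover.U z) (k : V ≤ D.cover.U w) (h' : W ≤ V) :
    M.mapG (res W h') (D.gr z w V h k) = D.gr z w W (h'.trans h) (h'.trans k) := by
  rw [gr, M.mapG_mapG, res_comp_res]; rfl

theorem rel_gr {z w : Z} {V : Z.Opens} (h : V ≤ D.cover.U z) (k : V ≤ D.cover.U w) :
    M.Rel (D.gr z w V h k) (D.xr w V k) (D.xr z V h) := by
  have := M.rel_map (res V (le_inf h k)) (D.rel z w)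
  rwa [M.mapX_mapX, M.mapX_mapX, res_comp_res, res_comp_res] at this

theorem gr_mul_gr {z w v : Z} {V : Z.Opens} (h : V ≤ D.cover.U z) (k : V ≤ D.cover.U w)
    (l : V ≤ D.cover.U v) : D.gr z w V h k * D.gr w v V k l = D.gr z v V h l := by
  have := congrArg (M.mapG (res V (le_inf (le_inf h k) l))) (D.g_mul z w v)
  rw [map_mul] at this
  simp only [M.mapG_mapG, res_comp_res] at this
  exact this

/-- The pullback of descent data along a morphism. -/
def pull (f : Z' ⟶ Z) : Desc M Z' where
  cover := D.cover.preimage f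
  x z := M.mapX (pb f _ (D.cover.preimage_le f z)) (D.x (f z))
  g z w := M.mapG (pb f _ (D.cover.preimage_le₂ f z w)) (D.g (f z) (f w))
  rel z w := by
    have := M.rel_map (pb f _ (D.cover.preimage_le₂ f z w)) (D.rel (f z) (f w))
    rw [M.mapX_mapX, M.mapX_mapX, pb_comp_res, pb_comp_res] at this
    rw [M.mapX_mapX, M.mapX_mapX, res_comp_pb, res_comp_pb]
    exact this
  g_mul z w v := by
    have := congrArg (M.mapG (pb f _ (D.cover.preimage_le₃ f z w v))) (D.g_mul (f z) (f w) (f v))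
    rw [map_mul] at this
    simp only [M.mapG_mapG, pb_comp_res] at this
    simp only [M.mapG_mapG, res_comp_pb]
    exact this

theorem pull_xr (f : Z' ⟶ Z) {z : Z'} {V : Z'.Opens} (h : V ≤ (D.pull f).cover.U z) :
    (D.pull f).xr z V h = M.mapX (pb f V (h.trans (D.cover.preimage_le f z))) (D.x (f z)) := by
  refine (M.mapX_mapX _ _ _).trans ?_
  exact congrArg (M.mapX · _) (res_comp_pb _ _ _)

theorem pull_gr (f : Z' ⟶ Z) {z w : Z'} {V : Z'.Opens} (h : V ≤ (D.pull f).cover.U z)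
    (k : V ≤ (D.pull f).cover.U w) :
    (D.pull f).gr z w V h k =
      M.mapG (pb f V ((le_inf h k).trans (D.cover.preimage_le₂ f z w))) (D.g (f z) (f w)) := by
  refine (M.mapG_mapG _ _ _).trans ?_
  exact congrArg (M.mapG · _) (res_comp_pb _ _ _)

theorem map_pull_xr (O : Z.Opens) {z : O.toScheme} {W : O.toScheme.Opens}
    (h : W ≤ (D.pull O.ι).cover.U z) {V : Z.Opens} (h' : V ≤ O.ι ''ᵁ W) :
    M.mapX (ofOpen V h') ((D.pull O.ι).xr z W h) =
      D.xr (O.ι z) V (h'.trans (image_le_of_le_preimage h)) := by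
  rw [pull_xr, M.mapX_mapX]
  exact congrArg (M.mapX · _) (ofOpen_comp_pb _ _)

theorem map_pull_gr (O : Z.Opens) {z w : O.toScheme} {W : O.toScheme.Opens}
    (h : W ≤ (D.pull O.ι).cover.U z) (k : W ≤ (D.pull O.ι).cover.U w) {V : Z.Opens}
    (h' : V ≤ O.ι ''ᵁ W) : M.mapG (ofOpen V h') ((D.pull O.ι).gr z w W h k) =
      D.gr (O.ι z) (O.ι w) V (h'.trans (image_le_of_le_preimage h))
        (h'.trans (image_le_of_le_preimage k)) := by
  rw [pull_gr, M.mapG_mapG]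
  exact congrArg (M.mapG · _) (ofOpen_comp_pb _ _)

theorem preimage_le_pull (f : Z' ⟶ Z) {z : Z'} {V : Z.Opens} (h : V ≤ D.cover.U (f z)) :
    f ⁻¹ᵁ V ≤ (D.pull f).cover.U z :=
  fun _ hx ↦ h hx

theorem pb_xr (O : Z.Opens) {z : O.toScheme} {W : O.toScheme.Opens} {V : Z.Opens}
    (h : V ≤ D.cover.U (O.ι z)) (h' : W ≤ O.ι ⁻¹ᵁ V) :
    M.mapX (pb O.ι W h') (D.xr (O.ι z) V h) =
      (D.pull O.ι).xr z W (h'.trans (D.preimage_le_pull O.ι h)) := by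
  rw [pull_xr, xr, M.mapX_mapX]
  exact congrArg (M.mapX · _) (pb_comp_res _ _ _)

theorem pb_gr (O : Z.Opens) {z w : O.toScheme} {W : O.toScheme.Opens} {V : Z.Opens}
    (h : V ≤ D.cover.U (O.ι z)) (k : V ≤ D.cover.U (O.ι w)) (h' : W ≤ O.ι ⁻¹ᵁ V) :
    M.mapG (pb O.ι W h') (D.gr (O.ι z) (O.ι w) V h k) =
      (D.pull O.ι).gr z w W (h'.trans (D.preimage_le_pull O.ι h))
        (h'.trans (D.preimage_le_pull O.ι k)) := by
  rw [pull_gr, gr, M.mapG_mapG]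
  exact congrArg (M.mapG · _) (pb_comp_res _ _ _)

variable {D}

/-- An isomorphism of descent data, defined over an open subset, in terms of the local points
at `z`. -/
structure LocIso (D D' : Desc M Z) (z : Z) where
  W : Z.Opens
  le : W ≤ D.cover.U z
  le' : W ≤ D'.cover.U z
  u : M.G Γ(Z, W)
  rel : M.Rel u (D.xr z W le) (D'.xr z W le')

/-- Two local isomorphisms agree on the intersection of their domains. -/
def LocIso.Compat {D D' : Desc M Z} {z w : Z} (e : LocIso D D' z) (e' : LocIso D D' w) : Prop :=
  ∀ (V : Z.Opens) (h : V ≤ e.W) (h' : V ≤ e'.W),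
    M.mapG (res V h) e.u * D.gr z w V (h.trans e.le) (h'.trans e'.le) =
      D'.gr z w V (h.trans e.le') (h'.trans e'.le') * M.mapG (res V h') e'.u

/-- The descent data are isomorphic over `O`: there is an atlas of compatible local isomorphisms
that covers `O`. -/
def EquivOn (O : Z.Opens) (D D' : Desc M Z) : Prop :=
  ∃ P : ∀ z, Set (LocIso D D' z), (∀ z ∈ O, ∃ e ∈ P z, z ∈ e.W) ∧ (∀ z, ∀ e ∈ P z, e.W ≤ O) ∧
    ∀ z w, ∀ e ∈ P z, ∀ e' ∈ P w, e.Compat e'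

/-- The descent data are isomorphic, possibly after refining the covers. -/
def Equiv (D D' : Desc M Z) : Prop :=
  ∃ e : ∀ z, LocIso D D' z, (∀ z, z ∈ (e z).W) ∧ ∀ z w, (e z).Compat (e w)

/-- The local points over open subsets of `O` are good. -/
def GoodOn (O : Z.Opens) (D : Desc M Z) : Prop :=
  ∀ (z : Z) (V : Z.Opens) (h : V ≤ D.cover.U z), V ≤ O → M.Good (D.xr z V h)

theorem GoodOn.compat {O : Z.Opens} {D D' : Desc M Z} (hD : D.GoodOn O) {z w : Z}
    (e : LocIso D D' z) (e' : LocIso D D' w) (h : e.W ⊓ e'.W ≤ O) : e.Compat e' := by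
  intro V hV hV'
  have h₁ := M.rel_map (res V hV) e.rel
  have h₂ := M.rel_map (res V hV') e'.rel
  rw [map_xr, map_xr] at h₁ h₂
  exact M.eq_of_rel (hD w V _ ((le_inf hV hV').trans h)) (M.rel_mul (D.rel_gr _ _) h₁)
    (M.rel_mul h₂ (D'.rel_gr _ _))

theorem GoodOn.equiv {D D' : Desc M Z} (hD : D.GoodOn ⊤)
    (h : ∀ z, ∃ e : LocIso D D' z, z ∈ e.W) : D.Equiv D' := by
  choose e he using h
  exact ⟨e, he, fun z w ↦ hD.compat _ _ le_top⟩

theorem EquivOn.equiv {D D' : Desc M Z} (h : EquivOn ⊤ D D') : D.Equiv D' := by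
  obtain ⟨P, h₁, -, h₂⟩ := h
  choose e he he' using fun z ↦ h₁ z (Opens.mem_top z)
  exact ⟨e, he', fun z w ↦ h₂ z w _ (he z) _ (he w)⟩

/-- Isomorphisms over open subsets glue if the overlaps are rigid. -/
theorem GoodOn.equiv_of_equivOn {ι : Type*} {D D' : Desc M Z} (O : ι → Z.Opens) (hO : ⨆ i, O i = ⊤)
    (hD : ∀ i j, i ≠ j → D.GoodOn (O i ⊓ O j)) (h : ∀ i, EquivOn (O i) D D') : D.Equiv D' := by
  choose P h₁ h₂ h₃ using h
  refine EquivOn.equiv ⟨fun z ↦ {e | ∃ i, e ∈ P i z}, fun z hz ↦ ?_, fun _ _ _ ↦ le_top, ?_⟩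
  · obtain ⟨i, hi⟩ := Opens.mem_iSup.mp (hO ▸ hz)
    obtain ⟨e, he, he'⟩ := h₁ i z hi
    exact ⟨e, ⟨i, he⟩, he'⟩
  · rintro z w e ⟨i, hi⟩ e' ⟨j, hj⟩
    by_cases hij : i = j
    · subst hij
      exact h₃ i z w e hi e' hj
    · exact (hD i j hij).compat e e' (inf_le_inf (h₂ i z e hi) (h₂ j w e' hj))

/-- The isomorphism over an open subset that a local isomorphism over the corresponding open
subscheme defines. -/
def LocIso.ofPull {O : Z.Opens} {D D' : Desc M Z} {z : O.toScheme}
    (e : LocIso (D.pull O.ι) (D'.pull O.ι) z) : LocIso D D' (O.ι z) where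
  W := O.ι ''ᵁ e.W
  le := image_le_of_le_preimage e.le
  le' := image_le_of_le_preimage e.le'
  u := M.mapG (ofOpen (O.ι ''ᵁ e.W) le_rfl) e.u
  rel := by
    have := M.rel_map (ofOpen (O.ι ''ᵁ e.W) le_rfl) e.rel
    rwa [map_pull_xr, map_pull_xr] at this

/-- The restriction of a local isomorphism to an open subscheme. -/
def LocIso.pull {O : Z.Opens} {D D' : Desc M Z} {z : O.toScheme} (e : LocIso D D' (O.ι z)) :
    LocIso (D.pull O.ι) (D'.pull O.ι) z where
  W := O.ι ⁻¹ᵁ e.W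
  le := D.preimage_le_pull O.ι e.le
  le' := D'.preimage_le_pull O.ι e.le'
  u := M.mapG (pb O.ι _ le_rfl) e.u
  rel := by
    have := M.rel_map (pb O.ι (O.ι ⁻¹ᵁ e.W) le_rfl) e.rel
    rwa [pb_xr, pb_xr] at this

theorem LocIso.Compat.ofPull {O : Z.Opens} {D D' : Desc M Z} {z w : O.toScheme}
    {e : LocIso (D.pull O.ι) (D'.pull O.ι) z} {e' : LocIso (D.pull O.ι) (D'.pull O.ι) w}
    (h : e.Compat e') : e.ofPull.Compat e'.ofPull := by
  intro V hV hV'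
  have hW : V ≤ O.ι ''ᵁ (e.W ⊓ e'.W) := by
    intro x hx
    obtain ⟨y, hy, rfl⟩ := hV hx
    obtain ⟨y', hy', hyy⟩ := hV' hx
    obtain rfl := O.ι.injective hyy
    exact ⟨y', ⟨hy, hy'⟩, rfl⟩
  have := congrArg (M.mapG (ofOpen V hW)) (h _ inf_le_left inf_le_right)
  rw [map_mul, map_mul, map_pull_gr, map_pull_gr] at this
  simp only [M.mapG_mapG, ofOpen_comp_res] at this
  have h₁ : ∀ {z : O.toScheme} (l : LocIso (D.pull O.ι) (D'.pull O.ι) z) (h : V ≤ l.ofPull.W),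
      M.mapG (res V h) l.ofPull.u = M.mapG (ofOpen V h) l.u := fun l h ↦
    (M.mapG_mapG _ _ _).trans (congrArg (M.mapG · _) (res_comp_ofOpen _ _))
  rw [h₁, h₁]
  exact this

theorem LocIso.Compat.pull {O : Z.Opens} {D D' : Desc M Z} {z w : O.toScheme}
    {e : LocIso D D' (O.ι z)} {e' : LocIso D D' (O.ι w)} (h : e.Compat e') :
    (e.pull (O := O) (z := z)).Compat (e'.pull (O := O) (z := w)) := by
  intro V hV hV'
  have hW : V ≤ O.ι ⁻¹ᵁ (e.W ⊓ e'.W) := le_inf hV hV'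
  have := congrArg (M.mapG (pb O.ι V hW)) (h _ inf_le_left inf_le_right)
  rw [map_mul, map_mul, pb_gr, pb_gr] at this
  simp only [M.mapG_mapG, pb_comp_res] at this
  have h₁ : ∀ {z : O.toScheme} (l : LocIso D D' (O.ι z)) (h : V ≤ l.pull.W),
      M.mapG (res V h) l.pull.u = M.mapG (pb O.ι V h) l.u := fun l h ↦
    (M.mapG_mapG _ _ _).trans (congrArg (M.mapG · _) (res_comp_pb _ _ _))
  rw [h₁, h₁]
  exact this

/-- Isomorphisms over the open subscheme `O` are isomorphisms over the open subset `O`. -/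
theorem Equiv.equivOn {O : Z.Opens} {D D' : Desc M Z} (h : (D.pull O.ι).Equiv (D'.pull O.ι)) :
    EquivOn O D D' := by
  obtain ⟨e, he, hc⟩ := h
  refine ⟨fun z ↦ {l | ∃ hz : z ∈ O, l = (e ⟨z, hz⟩).ofPull},
    fun z hz ↦ ⟨(e ⟨z, hz⟩).ofPull, ⟨hz, rfl⟩, ⟨⟨z, hz⟩, he ⟨z, hz⟩, rfl⟩⟩, ?_, ?_⟩
  · rintro z _ ⟨hz, rfl⟩
    exact image_le_of_le_preimage fun x _ ↦ x.2
  · rintro z w _ ⟨hz, rfl⟩ _ ⟨hw, rfl⟩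
    exact (hc ⟨z, hz⟩ ⟨w, hw⟩).ofPull

theorem EquivOn.equiv_pull {O : Z.Opens} {D D' : Desc M Z} (h : EquivOn O D D') :
    (D.pull O.ι).Equiv (D'.pull O.ι) := by
  obtain ⟨P, h₁, -, h₃⟩ := h
  choose e he he' using fun z : O.toScheme ↦ h₁ (O.ι z) z.2
  exact ⟨fun z ↦ (e z).pull, he', fun z w ↦ (h₃ _ _ _ (he z) _ (he w)).pull⟩

end Desc

/-! ### Gluing descent data -/

namespace Desc

variable {M : Model.{u}} {Z : Scheme.{u}}

/-- Descent data over the members of an open cover that are locally isomorphic and rigid on the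
overlaps glue: by rigidity the local isomorphisms satisfy the cocycle condition. -/
theorem exists_glue {ι : Type*} (D : ι → Desc M Z) (O : ι → Z.Opens) (hO : ⨆ i, O i = ⊤)
    (hD : ∀ i j, i ≠ j → (D i).GoodOn (O i ⊓ O j))
    (hθ : ∀ i j, i ≠ j → ∀ (z w : Z) (V : Z.Opens) (h : V ≤ (D i).cover.U z)
      (k : V ≤ (D j).cover.U w), V ≤ O i ⊓ O j →
        ∃ θ : M.G Γ(Z, V), M.Rel θ ((D j).xr w V k) ((D i).xr z V h)) :
    ∃ C : Desc M Z, (∀ i, EquivOn (O i) C (D i)) ∧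
      ∀ z, ∃ (i : ι) (h : C.cover.U z ≤ (D i).cover.U z), C.x z = (D i).xr z _ h := by
  let dom (i : ι) (z : Z) : Z.Opens := (D i).cover.U z ⊓ O i
  have hdom (i : ι) (z : Z) : dom i z ≤ (D i).cover.U z := inf_le_left
  have hdomO (i : ι) (z : Z) : dom i z ≤ O i := inf_le_right
  have key (i j : ι) (z w : Z) : ∃ θ : M.G Γ(Z, dom i z ⊓ dom j w),
      M.Rel θ ((D j).xr w _ (inf_le_right.trans (hdom j w)))
        ((D i).xr z _ (inf_le_left.trans (hdom i z))) ∧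
      ∀ l (hi : i = l) (hj : j = l), θ = (D l).gr z w _
        (inf_le_left.trans (hi ▸ hdom i z)) (inf_le_right.trans (hj ▸ hdom j w)) := by
    by_cases hij : i = j
    · subst hij
      refine ⟨_, (D i).rel_gr _ _, ?_⟩
      rintro _ rfl -
      rfl
    · obtain ⟨θ, hθ⟩ := hθ i j hij z w (dom i z ⊓ dom j w) (inf_le_left.trans (hdom i z))
        (inf_le_right.trans (hdom j w)) (inf_le_inf (hdomO i z) (hdomO j w))
      exact ⟨θ, hθ, fun l hi hj ↦ absurd (hi.trans hj.symm) hij⟩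
  choose θ hrel hself using key
  have rel (i j : ι) (z w : Z) (V : Z.Opens) (h : V ≤ dom i z) (k : V ≤ dom j w) :
      M.Rel (M.mapG (res V (le_inf h k)) (θ i j z w)) ((D j).xr w V (k.trans (hdom j w)))
        ((D i).xr z V (h.trans (hdom i z))) := by
    have := M.rel_map (res V (le_inf h k)) (hrel i j z w)
    rwa [map_xr, map_xr] at this
  have gr (i : ι) (z w : Z) (V : Z.Opens) (h : V ≤ dom i z) (k : V ≤ dom i w) :
      (D i).gr z w V (h.trans (hdom i z)) (k.trans (hdom i w)) =
        M.mapG (res V (le_inf h k)) (θ i i z w) := by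
    rw [hself i i z w i rfl rfl, map_gr]
  have mul (i j l : ι) (z w v : Z) (V : Z.Opens) (h : V ≤ dom i z) (h' : V ≤ dom j w)
      (h'' : V ≤ dom l v) : M.mapG (res V (le_inf h h')) (θ i j z w) *
        M.mapG (res V (le_inf h' h'')) (θ j l w v) =
      M.mapG (res V (le_inf h h'')) (θ i l z v) := by
    -- unless all three indices agree, `V` lies in an overlap, where the local points are rigid
    by_cases hjl : j = l ∧ i = j
    · obtain ⟨rfl, rfl⟩ := hjl
      rw [← gr i z w V h h', ← gr i w v V h' h'', ← gr i z v V h h'', gr_mul_gr]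
    · have hgood : M.Good ((D l).xr v V (h''.trans (hdom l v))) := by
        by_cases hl : l = j
        · have hil : l ≠ i := fun e ↦ hjl ⟨hl.symm, e.symm.trans hl⟩
          exact hD l i hil v V _ (le_inf (h''.trans (hdomO l v)) (h.trans (hdomO i z)))
        · exact hD l j hl v V _ (le_inf (h''.trans (hdomO l v)) (h'.trans (hdomO j w)))
      exact M.eq_of_rel hgood (M.rel_mul (rel j l w v V h' h'') (rel i j z w V h h'))
        (rel i l z v V h h'')
  choose c hc using fun z ↦ Opens.mem_iSup.mp (hO ▸ Opens.mem_top z : z ∈ ⨆ i, O i)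
  let C : Desc M Z :=
    { cover := ⟨fun z ↦ dom (c z) z, fun z ↦ ⟨(D (c z)).cover.mem z, hc z⟩⟩
      x z := (D (c z)).xr z _ (hdom (c z) z)
      g z w := θ (c z) (c w) z w
      rel z w := by
        rw [map_xr, map_xr]
        exact hrel _ _ _ _
      g_mul z w v := mul _ _ _ _ _ _ _ (inf_le_left.trans inf_le_left)
        (inf_le_left.trans inf_le_right) inf_le_right }
  refine ⟨C, fun i ↦ ?_, fun z ↦ ⟨c z, hdom (c z) z, rfl⟩⟩
  let e (z : Z) : LocIso C (D i) z :=
    { W := dom i z ⊓ dom (c z) z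
      le := inf_le_right
      le' := inf_le_left.trans (hdom i z)
      u := θ i (c z) z z
      rel := by
        have : C.xr z (dom i z ⊓ dom (c z) z) inf_le_right =
            (D (c z)).xr z _ (inf_le_right.trans (hdom (c z) z)) := (D (c z)).map_xr _ _
        rw [this]
        exact hrel _ _ _ _ }
  refine ⟨fun z ↦ {e z}, fun z hz ↦ ⟨e z, rfl, ⟨⟨(D i).cover.mem z, hz⟩, C.cover.mem z⟩⟩, ?_, ?_⟩
  · rintro z _ rfl
    exact inf_le_left.trans (hdomO i z)
  · rintro z w _ rfl _ rfl V h h'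
    have h₁ := h.trans inf_le_left
    have h₂ := h.trans inf_le_right
    have k₁ := h'.trans inf_le_left
    have k₂ := h'.trans inf_le_right
    rw [gr i z w V h₁ k₁]
    exact (mul i (c z) (c w) z z w V h₁ h₂ k₂).trans (mul i i (c w) z w w V h₁ k₁ k₂).symm

end Desc

/-! ### Linear algebra of the local models -/

/-- Base change of invertible matrices. -/
abbrev mapU {R S : Type u} [CommRing R] [CommRing S] {n : ℕ} (f : R →+* S) :
    (Matrix (Fin n) (Fin n) R)ˣ →* (Matrix (Fin n) (Fin n) S)ˣ :=
  Units.map (f.mapMatrix (m := Fin n) : Matrix (Fin n) (Fin n) R →* Matrix (Fin n) (Fin n) S)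

theorem mul_units_inv_eq {R : Type u} [CommRing R] {r s : ℕ} {x y : Matrix (Fin s) (Fin r) R}
    {a : (Matrix (Fin r) (Fin r) R)ˣ} {b : (Matrix (Fin s) (Fin s) R)ˣ}
    (h : y * a.val = b.val * x) : x * a⁻¹.val = b⁻¹.val * y := by
  have h₁ : b⁻¹.val * (y * a.val) * a⁻¹.val = b⁻¹.val * (b.val * x) * a⁻¹.val := by rw [h]
  rw [Matrix.mul_assoc, Matrix.mul_assoc, Units.mul_inv, Matrix.mul_one, ← Matrix.mul_assoc,
    Units.inv_mul, Matrix.one_mul] at h₁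
  exact h₁.symm

/-- Line bundles with a map to the structure sheaf: the units act on the functions. The good
functions are the invertible ones, which correspond to the isomorphisms `L → 𝒪`. -/
def lineModel : Model.{u} where
  G R _ := (Matrix (Fin 1) (Fin 1) R)ˣ
  X R _ := Matrix (Fin 1) (Fin 1) R
  group R _ := inferInstance
  mapG f := mapU f
  mapX f s := s.map f
  mapG_id g := rfl
  mapX_id s := rfl
  mapG_mapG f f' g := rfl
  mapX_mapX f f' s := rfl
  Rel g s s' := s' * g.val = s
  rel_one s := mul_one s
  rel_mul {R _ g h x y z} hg hh := by
    rw [Units.val_mul, ← mul_assoc, hh, hg]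
  rel_inv {R _ g x y} h := by
    rw [← h, mul_assoc, Units.mul_inv, mul_one]
  rel_map := by
    intro R S _ _ f g x y h
    rw [← h, Matrix.map_mul]
    rfl
  Good s := IsUnit s
  good_map := by
    intro R S _ _ f s h
    exact h.map (f.mapMatrix (m := Fin 1))
  rigid {R _ g s} hs h := by
    obtain ⟨s, rfl⟩ := hs
    exact mul_eq_left.mp (Units.ext h : s * g = s)

/-- The maps of trivial bundles in a datum, over a ring: the trivializations of `det E₁` and
`det E₂`, and the matrices of `L → E₁`, `E₁ → E₂` and `E₂ → 𝒪`. -/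
structure DatumAt (R : Type u) [CommRing R] where
  t₁ : (Matrix (Fin 1) (Fin 1) R)ˣ
  t₂ : (Matrix (Fin 1) (Fin 1) R)ˣ
  i : Matrix (Fin 2) (Fin 1) R
  φ : Matrix (Fin 2) (Fin 2) R
  q : Matrix (Fin 1) (Fin 2) R

namespace DatumAt

variable {R S : Type u} [CommRing R] [CommRing S]

/-- Base change. -/
@[simps]
def map (f : R →+* S) (x : DatumAt R) : DatumAt S where
  t₁ := mapU f x.t₁
  t₂ := mapU f x.t₂
  i := x.i.map f
  φ := x.φ.map f
  q := x.q.map f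

/-- The invertible matrices `a`, `b₁`, `b₂` define an isomorphism from `x` to `y`. -/
structure Rel (g : (Matrix (Fin 1) (Fin 1) R)ˣ × (Matrix (Fin 2) (Fin 2) R)ˣ ×
    (Matrix (Fin 2) (Fin 2) R)ˣ) (x y : DatumAt R) : Prop where
  t₁ : y.t₁.val * Matrix.scalar (Fin 1) g.2.1.val.det = x.t₁.val
  t₂ : y.t₂.val * Matrix.scalar (Fin 1) g.2.2.val.det = x.t₂.val
  i : y.i * g.1.val = g.2.1.val * x.i
  φ : y.φ * g.2.1.val = g.2.2.val * x.φ
  q : y.q * g.2.2.val = x.q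

/-- The composite `L → 𝒪`. -/
def s (x : DatumAt R) : Matrix (Fin 1) (Fin 1) R := x.q * (x.φ * x.i)

/-- The determinant of `E₁ → E₂`. -/
def det (x : DatumAt R) : R := ent x.t₂.val * (x.φ.det * ent x.t₁⁻¹.val)

/-- The standard form of a datum for which the composite `L → 𝒪` is an isomorphism. -/
@[simps]
def std (d : R) : DatumAt R where
  t₁ := 1
  t₂ := 1
  i := !![1; 0]
  φ := !![1, 0; 0, d]
  q := !![1, 0]

theorem Rel.one (x : DatumAt R) : Rel 1 x x := by
  constructor <;> simp

theorem Rel.mul {g h x y z} (hg : Rel (R := R) g x y) (hh : Rel h y z) : Rel (h * g) x z where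
  t₁ := by rw [← hg.t₁, ← hh.t₁]; simp [Matrix.det_mul, mul_assoc, -Matrix.scalar_apply]
  t₂ := by rw [← hg.t₂, ← hh.t₂]; simp [Matrix.det_mul, mul_assoc, -Matrix.scalar_apply]
  i := by
    rw [Prod.fst_mul, Units.val_mul, ← Matrix.mul_assoc, hh.i, Matrix.mul_assoc, hg.i,
      ← Matrix.mul_assoc]
    rfl
  φ := by
    rw [Prod.snd_mul, Prod.fst_mul, Units.val_mul, ← Matrix.mul_assoc, hh.φ, Matrix.mul_assoc,
      hg.φ, ← Matrix.mul_assoc]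
    rfl
  q := by
    rw [Prod.snd_mul, Prod.snd_mul, Units.val_mul, ← Matrix.mul_assoc, hh.q, hg.q]

theorem mul_scalar_det_inv {t : Matrix (Fin 1) (Fin 1) R} (b : (Matrix (Fin 2) (Fin 2) R)ˣ) :
    t * Matrix.scalar (Fin 1) b.val.det * Matrix.scalar (Fin 1) b⁻¹.val.det = t := by
  rw [mul_assoc, ← map_mul, ← Matrix.det_mul, Units.mul_inv, Matrix.det_one, map_one, mul_one]

theorem Rel.inv {g x y} (h : Rel (R := R) g x y) : Rel g⁻¹ y x where
  t₁ := by rw [← h.t₁]; exact mul_scalar_det_inv _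
  t₂ := by rw [← h.t₂]; exact mul_scalar_det_inv _
  i := mul_units_inv_eq h.i
  φ := mul_units_inv_eq h.φ
  q := by
    rw [← h.q, Matrix.mul_assoc, Prod.snd_inv, Prod.snd_inv, Units.mul_inv, Matrix.mul_one]

theorem Rel.map (f : R →+* S) {g x y} (h : Rel g x y) :
    Rel (g.map (mapU f) (Prod.map (mapU f) (mapU f))) (x.map f) (y.map f) where
  t₁ := by
    have := congrArg (f.mapMatrix (m := Fin 1)) h.t₁
    rw [map_mul] at this
    refine Eq.trans (congrArg₂ _ rfl (ent_injective ?_)) this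
    exact (f.map_det g.2.1.val).symm
  t₂ := by
    have := congrArg (f.mapMatrix (m := Fin 1)) h.t₂
    rw [map_mul] at this
    refine Eq.trans (congrArg₂ _ rfl (ent_injective ?_)) this
    exact (f.map_det g.2.2.val).symm
  i := by simpa [Matrix.map_mul] using congrArg (fun A ↦ A.map f) h.i
  φ := by simpa [Matrix.map_mul] using congrArg (fun A ↦ A.map f) h.φ
  q := by simpa [Matrix.map_mul] using congrArg (fun A ↦ A.map f) h.q

theorem s_map (f : R →+* S) (x : DatumAt R) : (x.map f).s = x.s.map f := by
  simp [s, Matrix.map_mul]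

theorem det_map (f : R →+* S) (x : DatumAt R) : (x.map f).det = f x.det := by
  simp only [det, map_φ, map_t₁, map_t₂, map_mul, f.map_det]
  rfl

/-- If the composite `L → 𝒪` is an isomorphism, the datum is isomorphic to a standard one: `L` is
a complement to the kernel of `E₁ → 𝒪`, and the image of `L` one to the kernel of `E₂ → 𝒪`. The
determinants provide the bases of the kernels. -/
theorem exists_rel_std {x : DatumAt R} (hx : IsUnit x.s) : ∃ g, Rel g (std x.det) x := by
  obtain ⟨s, hs⟩ := hx
  have hs₁ := congrArg ent s.mul_inv
  have h₁ := congrArg ent x.t₁.mul_inv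
  have h₂ := congrArg ent x.t₂.mul_inv
  have hd : x.det = ent x.t₂.val * (x.φ.det * ent x.t₁⁻¹.val) := rfl
  simp only [ent_mul, ent_one, hs] at hs₁ h₁ h₂
  simp only [ent, DatumAt.s, Matrix.mul_apply, Fin.sum_univ_two] at hs₁
  rw [Matrix.det_fin_two] at hd
  simp only [ent] at h₁ h₂ hd
  set s' := s⁻¹.val 0 0
  set t₁' := x.t₁⁻¹.val 0 0
  set t₂' := x.t₂⁻¹.val 0 0
  -- the columns of `b₁` and `b₂` are the image of the element of `L` that maps to `1`, and a vector
  -- that spans the kernel of the map to `𝒪`, scaled to match the trivialization of the determinant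
  let b₁ : Matrix (Fin 2) (Fin 2) R :=
    !![x.i 0 0 * s', -(t₁' * (x.q 0 0 * x.φ 0 1 + x.q 0 1 * x.φ 1 1));
      x.i 1 0 * s', t₁' * (x.q 0 0 * x.φ 0 0 + x.q 0 1 * x.φ 1 0)]
  let b₂ : Matrix (Fin 2) (Fin 2) R :=
    !![(x.φ 0 0 * x.i 0 0 + x.φ 0 1 * x.i 1 0) * s', -(t₂' * x.q 0 1);
      (x.φ 1 0 * x.i 0 0 + x.φ 1 1 * x.i 1 0) * s', t₂' * x.q 0 0]
  have hb₁ : b₁.det = t₁' := by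
    rw [Matrix.det_fin_two_of]
    linear_combination t₁' * hs₁
  have hb₂ : b₂.det = t₂' := by
    rw [Matrix.det_fin_two_of]
    linear_combination t₂' * hs₁
  have hu₁ : IsUnit b₁.det := hb₁ ▸ .of_mul_eq_one_right _ h₁
  have hu₂ : IsUnit b₂.det := hb₂ ▸ .of_mul_eq_one_right _ h₂
  refine ⟨(s⁻¹, Matrix.nonsingInvUnit b₁ hu₁, Matrix.nonsingInvUnit b₂ hu₂), ?_, ?_, ?_, ?_, ?_⟩
  · refine ent_injective ?_
    change ent (x.t₁.val * Matrix.scalar (Fin 1) b₁.det) = 1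
    rw [ent_mul, ent_scalar, hb₁]
    exact h₁
  · refine ent_injective ?_
    change ent (x.t₂.val * Matrix.scalar (Fin 1) b₂.det) = 1
    rw [ent_mul, ent_scalar, hb₂]
    exact h₂
  · change x.i * s⁻¹.val = b₁ * !![1; 0]
    ext j k
    fin_cases k
    fin_cases j <;> simp [Matrix.mul_apply, b₁, s']
  · change x.φ * b₁ = b₂ * !![1, 0; 0, x.det]
    rw [hd]
    ext j k
    fin_cases j <;> fin_cases k <;> simp [Matrix.mul_apply, b₁, b₂, Fin.sum_univ_two]
    · ring
    · linear_combination (x.q 0 1 * (x.φ 0 0 * x.φ 1 1 - x.φ 0 1 * x.φ 1 0) * t₁') * h₂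
    · ring
    · linear_combination (-x.q 0 0 * (x.φ 0 0 * x.φ 1 1 - x.φ 0 1 * x.φ 1 0) * t₁') * h₂
  · change x.q * b₂ = !![1, 0]
    ext j k
    fin_cases j
    fin_cases k <;> simp [Matrix.mul_apply, b₂, Fin.sum_univ_two]
    · linear_combination hs₁
    · ring

/-- The standard datum has no automorphisms. -/
theorem eq_one_of_rel_std {d : R} {g} (h : Rel g (std d) (std d)) : g = 1 := by
  obtain ⟨a, b₁, b₂⟩ := g
  have hi := h.i
  have ht₁ := congrArg ent h.t₁
  have ht₂ := congrArg ent h.t₂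
  have hq := h.q
  have hφ := h.φ
  simp only [std_t₁, std_t₂, std_i, std_q, std_φ, Units.val_one, one_mul, ent_scalar, ent_one,
    Matrix.det_fin_two] at ht₁ ht₂ hi hq hφ
  have hi0 := congrFun (congrFun hi 0) 0
  have hi1 := congrFun (congrFun hi 1) 0
  have hq0 := congrFun (congrFun hq 0) 0
  have hq1 := congrFun (congrFun hq 0) 1
  have hφ00 := congrFun (congrFun hφ 0) 0
  have hφ01 := congrFun (congrFun hφ 0) 1
  have hφ10 := congrFun (congrFun hφ 1) 0
  simp [Matrix.mul_apply, Fin.sum_univ_two] at hi0 hi1 hq0 hq1 hφ00 hφ01 hφ10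
  replace hi1 := hi1.symm
  rw [hi1, mul_zero] at hφ10
  replace hφ10 := hφ10.symm
  rw [hq1, zero_mul] at hφ01
  rw [hφ00, hφ01, hq0, zero_mul, sub_zero, one_mul] at ht₁
  rw [hq0, hq1, zero_mul, sub_zero, one_mul] at ht₂
  have ha : a = 1 := Units.ext (ent_injective (by simp [ent, hi0, hφ00, hq0]))
  have hb₁ : b₁ = 1 := by
    ext j k
    fin_cases j <;> fin_cases k
    exacts [hφ00.trans hq0, hφ01, hi1, ht₁]
  have hb₂ : b₂ = 1 := by
    ext j k
    fin_cases j <;> fin_cases k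
    exacts [hq0, hq1, hφ10, ht₂]
  rw [ha, hb₁, hb₂]
  rfl

theorem rigid {g} {x : DatumAt R} (hx : IsUnit x.s) (h : Rel g x x) : g = 1 := by
  obtain ⟨p, hp⟩ := exists_rel_std hx
  have := eq_one_of_rel_std ((hp.mul h).mul hp.inv)
  rwa [inv_mul_eq_one, eq_comm, mul_eq_right] at this

theorem exists_rel {x y : DatumAt R} (hx : IsUnit x.s) (hy : IsUnit y.s) (h : x.det = y.det) :
    ∃ g, Rel g x y := by
  obtain ⟨p, hp⟩ := exists_rel_std hx
  obtain ⟨p', hp'⟩ := exists_rel_std hy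
  exact ⟨_, (h ▸ hp).inv.mul hp'⟩

end DatumAt

/-- The data `L → E₁ → E₂ → 𝒪`: changes of bases of `L`, `E₁`, `E₂` act on matrices of maps.
The good data are those for which the composite `L → 𝒪` is an isomorphism. -/
def datumModel : Model.{u} where
  G R _ := (Matrix (Fin 1) (Fin 1) R)ˣ × (Matrix (Fin 2) (Fin 2) R)ˣ × (Matrix (Fin 2) (Fin 2) R)ˣ
  X R _ := DatumAt R
  group R _ := inferInstance
  mapG f := (mapU f).prodMap ((mapU f).prodMap (mapU f))
  mapX f x := x.map f
  mapG_id g := rfl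
  mapX_id s := rfl
  mapG_mapG f f' g := rfl
  mapX_mapX f f' s := rfl
  Rel g x y := DatumAt.Rel g x y
  rel_one x := .one x
  rel_mul h h' := h.mul h'
  rel_inv h := h.inv
  rel_map f _ _ _ h := h.map f
  Good x := IsUnit x.s
  good_map := by
    intro R S _ _ f x h
    rw [DatumAt.s_map]
    exact h.map (f.mapMatrix (m := Fin 1))
  rigid hx h := DatumAt.rigid hx h

/-! ### Vector bundles and descent data -/

section

variable {Z Z' : Scheme.{u}} {𝒰 : Cover Z}

/-- The transition matrix of a vector bundle, as an invertible matrix. -/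
def Bundle.unit {r : ℕ} (E : Bundle 𝒰 r) (z w : Z) :
    (Matrix (Fin r) (Fin r) Γ(Z, 𝒰.U z ⊓ 𝒰.U w))ˣ where
  val := E.g z w
  inv := resM (𝒰.U z ⊓ 𝒰.U w) (inf_comm (𝒰.U w) (𝒰.U z)).ge (E.g w z)
  val_inv := E.g_mul_symm z w
  inv_val := mul_eq_one_comm.mp (E.g_mul_symm z w)

/-- The matrix of an isomorphism of vector bundles, as an invertible matrix. -/
def BIso.unit {r : ℕ} {E F : Bundle 𝒰 r} (a : BIso E F) (z : Z) :
    (Matrix (Fin r) (Fin r) Γ(Z, 𝒰.U z))ˣ where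
  val := a.hom.m z
  inv := a.inv.m z
  val_inv := congrFun (congrArg BHom.m a.inv_hom) z
  inv_val := congrFun (congrArg BHom.m a.hom_inv) z

/-- The isomorphism of vector bundles given by invertible matrices. -/
def BIso.ofUnits {r : ℕ} {E F : Bundle 𝒰 r} (u : ∀ z, (Matrix (Fin r) (Fin r) Γ(Z, 𝒰.U z))ˣ)
    (h : ∀ z w, resM (𝒰.U z ⊓ 𝒰.U w) inf_le_left (u z).val * E.g z w =
      F.g z w * resM (𝒰.U z ⊓ 𝒰.U w) inf_le_right (u w).val) : BIso E F where
  hom := ⟨fun z ↦ (u z).val, h⟩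
  inv := ⟨fun z ↦ (u z)⁻¹.val, fun z w ↦ (mul_units_inv_eq (a := mapU (res _ inf_le_right) (u w))
    (b := mapU (res _ inf_le_left) (u z)) (h z w).symm).symm⟩
  hom_inv := by ext1; funext z; exact (u z).inv_mul
  inv_hom := by ext1; funext z; exact (u z).mul_inv

theorem Cover.Refines.le {𝒲 : Cover Z} (h : Cover.Refines (𝟙 Z) 𝒲 𝒰) (z : Z) :
    𝒲.U z ≤ 𝒰.U z :=
  h z

theorem Bundle.pull_id_g {r : ℕ} (E : Bundle 𝒰 r) (𝒲 : Cover Z) (h : Cover.Refines (𝟙 Z) 𝒲 𝒰)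
    (z w : Z) : (E.pull (𝟙 Z) 𝒲 h).g z w =
      resM (𝒲.U z ⊓ 𝒲.U w) (inf_le_inf (h.le z) (h.le w)) (E.g z w) :=
  pbM_id _ _

theorem BHom.pull_id_m {r s : ℕ} {E : Bundle 𝒰 r} {F : Bundle 𝒰 s} (a : BHom E F) (𝒲 : Cover Z)
    (h : Cover.Refines (𝟙 Z) 𝒲 𝒰) (z : Z) :
    (a.pull (𝟙 Z) 𝒲 h).m z = resM (𝒲.U z) (h.le z) (a.m z) :=
  pbM_id _ _

theorem BHom.pullToTriv_id_m {r s : ℕ} {E : Bundle 𝒰 s} (a : BHom E (Bundle.triv 𝒰 r))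
    (𝒲 : Cover Z) (h : Cover.Refines (𝟙 Z) 𝒲 𝒰) (z : Z) :
    (a.pullToTriv (𝟙 Z) 𝒲 h).m z = resM (𝒲.U z) (h.le z) (a.m z) :=
  pbM_id _ _

theorem BIso.pullDet_id_m {r : ℕ} {E : Bundle 𝒰 r} (a : BIso E.det (Bundle.triv 𝒰 1))
    (𝒲 : Cover Z) (h : Cover.Refines (𝟙 Z) 𝒲 𝒰) (z : Z) :
    (a.pullDet (𝟙 Z) 𝒲 h).hom.m z = resM (𝒲.U z) (h.le z) (a.hom.m z) :=
  pbM_id _ _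

/-- The isomorphism of vector bundles given by invertible matrices over the members of a common
refinement of the covers. -/
def BIso.ofUnitsOfRefines {r : ℕ} {𝒰' 𝒲 : Cover Z} {E : Bundle 𝒰 r} {F : Bundle 𝒰' r}
    (h : Cover.Refines (𝟙 Z) 𝒲 𝒰) (h' : Cover.Refines (𝟙 Z) 𝒲 𝒰')
    (u : ∀ z, (Matrix (Fin r) (Fin r) Γ(Z, 𝒲.U z))ˣ)
    (hu : ∀ z w, resM (𝒲.U z ⊓ 𝒲.U w) inf_le_left (u z).val *
        resM (𝒲.U z ⊓ 𝒲.U w) (inf_le_inf (h.le z) (h.le w)) (E.g z w) =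
      resM (𝒲.U z ⊓ 𝒲.U w) (inf_le_inf (h'.le z) (h'.le w)) (F.g z w) *
        resM (𝒲.U z ⊓ 𝒲.U w) inf_le_right (u w).val) :
    BIso (E.pull (𝟙 Z) 𝒲 h) (F.pull (𝟙 Z) 𝒲 h') :=
  .ofUnits u fun z w ↦ by
    rw [Bundle.pull_id_g, Bundle.pull_id_g]
    exact hu z w

/-- Compatibility of a homomorphism with the transition matrices, on smaller open subsets. -/
theorem BHom.comm_res {r s : ℕ} {E : Bundle 𝒰 r} {F : Bundle 𝒰 s} (a : BHom E F)
    (z w : Z) (V : Z.Opens) (hz : V ≤ 𝒰.U z) (hw : V ≤ 𝒰.U w) :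
    resM V hz (a.m z) * resM V (le_inf hz hw) (E.g z w) =
      resM V (le_inf hz hw) (F.g z w) * resM V hw (a.m w) := by
  simpa using congrArg (resM V (le_inf hz hw)) (a.comm z w)

/-- Compatibility of the matrices of an isomorphism over the members of a refinement with the
transition matrices. -/
theorem BHom.comm_res_of_pull_id {r : ℕ} {𝒰' 𝒲 : Cover Z} {E : Bundle 𝒰 r} {F : Bundle 𝒰' r}
    {h : Cover.Refines (𝟙 Z) 𝒲 𝒰} {h' : Cover.Refines (𝟙 Z) 𝒲 𝒰'}
    (a : BHom (E.pull (𝟙 Z) 𝒲 h) (F.pull (𝟙 Z) 𝒲 h'))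
    (z w : Z) (V : Z.Opens) (hz : V ≤ 𝒲.U z) (hw : V ≤ 𝒲.U w) :
    resM V hz (a.m z) * resM V (le_inf (hz.trans (h.le z)) (hw.trans (h.le w))) (E.g z w) =
      resM V (le_inf (hz.trans (h'.le z)) (hw.trans (h'.le w))) (F.g z w) * resM V hw (a.m w) := by
  have := a.comm_res z w V hz hw
  rwa [Bundle.pull_id_g, Bundle.pull_id_g, resM_resM, resM_resM] at this

theorem Desc.mk_congr {M : Model.{u}} {𝒰 : Cover Z} {x : ∀ z, M.X Γ(Z, 𝒰.U z)}
    {g g' : ∀ z w, M.G Γ(Z, 𝒰.U z ⊓ 𝒰.U w)} (h : g = g') {r m r' m'} :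
    Desc.mk 𝒰 x g r m = Desc.mk 𝒰 x g' r' m' := by
  subst h; rfl

namespace LineMap

/-- A line bundle with a map to `𝒪`, as descent data. -/
def toDesc (D : LineMap Z) : Desc lineModel Z where
  cover := D.cover
  x z := D.on.s.m z
  g z w := D.on.L.unit z w
  rel z w := (D.on.s.comm z w).trans (Matrix.one_mul _)
  g_mul z w v := Units.ext (D.on.L.g_mul z w v)

theorem toDesc_pull (D : LineMap Z) (f : Z' ⟶ Z) : (D.pull f).toDesc = D.toDesc.pull f := by
  refine Desc.mk_congr ?_
  funext z w
  exact Units.ext rfl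

theorem equiv_iff {D D' : LineMap Z} : D.Equiv D' ↔ D.toDesc.Equiv D'.toDesc := by
  constructor
  · rintro ⟨𝒲, h, h', ⟨e⟩⟩
    refine ⟨fun z ↦ ⟨𝒲.U z, h z, h' z, e.a.unit z, ?_⟩, 𝒲.mem, fun z w V hz hw ↦ ?_⟩
    · have := congrFun (congrArg BHom.m e.comm_s) z
      have h₁ := D.on.s.pullToTriv_id_m 𝒲 h z
      have h₂ := D'.on.s.pullToTriv_id_m 𝒲 h' z
      exact (congrArg (· * e.a.hom.m z) h₂.symm).trans (this.trans h₁)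
    · exact Units.ext (BHom.comm_res_of_pull_id (h := h) (h' := h') e.a.hom z w V hz hw)
  · rintro ⟨e, he, hc⟩
    let 𝒲 : Cover Z := ⟨fun z ↦ (e z).W, he⟩
    have h : Cover.Refines (𝟙 Z) 𝒲 D.cover := fun z ↦ (e z).le
    have h' : Cover.Refines (𝟙 Z) 𝒲 D'.cover := fun z ↦ (e z).le'
    refine ⟨𝒲, h, h', ⟨⟨.ofUnitsOfRefines h h' (fun z ↦ (e z).u)
      fun z w ↦ congrArg Units.val (hc z w _ inf_le_left inf_le_right), ?_⟩⟩⟩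
    ext1; funext z
    have h₁ := D.on.s.pullToTriv_id_m 𝒲 h z
    have h₂ := D'.on.s.pullToTriv_id_m 𝒲 h' z
    exact (congrArg (· * (e z).u.val) h₂).trans (((e z).rel :).trans h₁.symm)

end LineMap

namespace Datum

/-- The matrices of the maps of a datum over a member of the cover. -/
def localAt (D : Datum Z) (z : Z) : DatumAt Γ(Z, D.cover.U z) where
  t₁ := D.on.τ₁.unit z
  t₂ := D.on.τ₂.unit z
  i := D.on.i.m z
  φ := D.on.φ.m z
  q := D.on.q.m z

/-- The transition matrices of the bundles of a datum. -/
abbrev unit (D : Datum Z) (z w : Z) : datumModel.G Γ(Z, D.cover.U z ⊓ D.cover.U w) :=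
  (D.on.L.unit z w, D.on.E₁.unit z w, D.on.E₂.unit z w)

/-- A datum, as descent data. -/
def toDesc (D : Datum Z) : Desc datumModel Z where
  cover := D.cover
  x z := D.localAt z
  g z w := D.unit z w
  rel z w :=
    { t₁ := (D.on.τ₁.hom.comm z w).trans (Matrix.one_mul _)
      t₂ := (D.on.τ₂.hom.comm z w).trans (Matrix.one_mul _)
      i := D.on.i.comm z w
      φ := D.on.φ.comm z w
      q := (D.on.q.comm z w).trans (Matrix.one_mul _) }
  g_mul z w v := Prod.ext (Units.ext (D.on.L.g_mul z w v))
    (Prod.ext (Units.ext (D.on.E₁.g_mul z w v)) (Units.ext (D.on.E₂.g_mul z w v)))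

theorem toDesc_pull (D : Datum Z) (f : Z' ⟶ Z) : (D.pull f).toDesc = D.toDesc.pull f := by
  refine Desc.mk_congr ?_
  funext z w
  exact Prod.ext (Units.ext rfl) (Prod.ext (Units.ext rfl) (Units.ext rfl))

theorem equiv_iff {D D' : Datum Z} : D.Equiv D' ↔ D.toDesc.Equiv D'.toDesc := by
  constructor
  · rintro ⟨𝒲, h, h', ⟨e⟩⟩
    refine ⟨fun z ↦ ⟨𝒲.U z, h z, h' z, (e.a.unit z, e.b₁.unit z, e.b₂.unit z), ?_⟩, 𝒲.mem,
      fun z w V hz hw ↦ ?_⟩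
    · constructor
      · exact (congrArg (· * _) (D'.on.τ₁.pullDet_id_m 𝒲 h' z).symm).trans
          ((congrFun (congrArg BHom.m e.comm_τ₁) z).trans (D.on.τ₁.pullDet_id_m 𝒲 h z))
      · exact (congrArg (· * _) (D'.on.τ₂.pullDet_id_m 𝒲 h' z).symm).trans
          ((congrFun (congrArg BHom.m e.comm_τ₂) z).trans (D.on.τ₂.pullDet_id_m 𝒲 h z))
      · exact (congrArg (· * e.a.hom.m z) (D'.on.i.pull_id_m 𝒲 h' z).symm).trans
          ((congrFun (congrArg BHom.m e.comm_i) z).trans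
            (congrArg (e.b₁.hom.m z * ·) (D.on.i.pull_id_m 𝒲 h z)))
      · exact (congrArg (· * e.b₁.hom.m z) (D'.on.φ.pull_id_m 𝒲 h' z).symm).trans
          ((congrFun (congrArg BHom.m e.comm_φ) z).trans
            (congrArg (e.b₂.hom.m z * ·) (D.on.φ.pull_id_m 𝒲 h z)))
      · exact (congrArg (· * e.b₂.hom.m z) (D'.on.q.pullToTriv_id_m 𝒲 h' z).symm).trans
          ((congrFun (congrArg BHom.m e.comm_q) z).trans (D.on.q.pullToTriv_id_m 𝒲 h z))
    · exact Prod.ext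
        (Units.ext (BHom.comm_res_of_pull_id (h := h) (h' := h') e.a.hom z w V hz hw))
        (Prod.ext (Units.ext (BHom.comm_res_of_pull_id (h := h) (h' := h') e.b₁.hom z w V hz hw))
          (Units.ext (BHom.comm_res_of_pull_id (h := h) (h' := h') e.b₂.hom z w V hz hw)))
  · rintro ⟨e, he, hc⟩
    let 𝒲 : Cover Z := ⟨fun z ↦ (e z).W, he⟩
    have h : Cover.Refines (𝟙 Z) 𝒲 D.cover := fun z ↦ (e z).le
    have h' : Cover.Refines (𝟙 Z) 𝒲 D'.cover := fun z ↦ (e z).le'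
    have hu z w := hc z w _ inf_le_left inf_le_right
    have hr z : DatumAt.Rel _ _ _ := (e z).rel
    refine ⟨𝒲, h, h', ⟨
      { a := .ofUnitsOfRefines h h' (fun z ↦ (e z).u.1)
          fun z w ↦ congrArg (fun g ↦ g.1.val) (hu z w)
        b₁ := .ofUnitsOfRefines h h' (fun z ↦ (e z).u.2.1)
          fun z w ↦ congrArg (fun g ↦ g.2.1.val) (hu z w)
        b₂ := .ofUnitsOfRefines h h' (fun z ↦ (e z).u.2.2)
          fun z w ↦ congrArg (fun g ↦ g.2.2.val) (hu z w)
        comm_τ₁ := ?_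
        comm_τ₂ := ?_
        comm_i := ?_
        comm_φ := ?_
        comm_q := ?_ }⟩⟩
    · ext1; funext z
      exact (congrArg (· * _) (D'.on.τ₁.pullDet_id_m 𝒲 h' z)).trans
        ((hr z).t₁.trans (D.on.τ₁.pullDet_id_m 𝒲 h z).symm)
    · ext1; funext z
      exact (congrArg (· * _) (D'.on.τ₂.pullDet_id_m 𝒲 h' z)).trans
        ((hr z).t₂.trans (D.on.τ₂.pullDet_id_m 𝒲 h z).symm)
    · ext1; funext z
      exact (congrArg (· * (e z).u.1.val) (D'.on.i.pull_id_m 𝒲 h' z)).trans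
        ((hr z).i.trans (congrArg ((e z).u.2.1.val * ·) (D.on.i.pull_id_m 𝒲 h z).symm))
    · ext1; funext z
      exact (congrArg (· * (e z).u.2.1.val) (D'.on.φ.pull_id_m 𝒲 h' z)).trans
        ((hr z).φ.trans (congrArg ((e z).u.2.2.val * ·) (D.on.φ.pull_id_m 𝒲 h z).symm))
    · ext1; funext z
      exact (congrArg (· * (e z).u.2.2.val) (D'.on.q.pullToTriv_id_m 𝒲 h' z)).trans
        ((hr z).q.trans (D.on.q.pullToTriv_id_m 𝒲 h z).symm)

end Datum

theorem Desc.g_self {M : Model.{u}} (C : Desc M Z) (z : Z) : C.g z z = 1 := by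
  have := C.gr_mul_gr (z := z) (w := z) (v := z) (V := C.cover.U z ⊓ C.cover.U z)
    inf_le_left inf_le_left inf_le_left
  rw [mul_eq_left, Desc.gr, res_eq_id, M.mapG_id] at this
  exact this

/-- The vector bundle with the given invertible transition matrices. -/
def Bundle.ofUnits {r : ℕ} (g : ∀ z w, (Matrix (Fin r) (Fin r) Γ(Z, 𝒰.U z ⊓ 𝒰.U w))ˣ)
    (h : ∀ z, g z z = 1) (h' : ∀ z w v,
      mapU (res (𝒰.U z ⊓ 𝒰.U w ⊓ 𝒰.U v) inf_le_left) (g z w) *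
        mapU (res (𝒰.U z ⊓ 𝒰.U w ⊓ 𝒰.U v) (inf_le_inf_right _ inf_le_right)) (g w v) =
      mapU (res (𝒰.U z ⊓ 𝒰.U w ⊓ 𝒰.U v) (inf_le_inf_right _ inf_le_left)) (g z v)) :
    Bundle 𝒰 r where
  g z w := (g z w).val
  g_self z := congrArg Units.val (h z)
  g_mul z w v := congrArg Units.val (h' z w v)

/-- Descent data for the local models come from a datum if the maps `L → E₁` and `E₂ → 𝒪` are
locally split. -/
theorem Datum.exists_toDesc_eq (C : Desc datumModel Z)
    (hi : ∀ z, ∃ (V : Z.Opens) (hV : V ≤ C.cover.U z) (N : Matrix (Fin 1) (Fin 2) Γ(Z, V)),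
      z ∈ V ∧ N * resM V hV (C.x z).i = 1)
    (hq : ∀ z, ∃ (V : Z.Opens) (hV : V ≤ C.cover.U z) (N : Matrix (Fin 2) (Fin 1) Γ(Z, V)),
      z ∈ V ∧ resM V hV (C.x z).q * N = 1) : ∃ D : Datum Z, D.toDesc = C := by
  have hr z w : DatumAt.Rel _ _ _ := C.rel z w
  let L : Bundle C.cover 1 := .ofUnits (fun z w ↦ (C.g z w).1)
    (fun z ↦ congrArg (fun g ↦ g.1) (C.g_self z))
    (fun z w v ↦ congrArg (fun g ↦ g.1) (C.g_mul z w v))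
  let E₁ : Bundle C.cover 2 := .ofUnits (fun z w ↦ (C.g z w).2.1)
    (fun z ↦ congrArg (fun g ↦ g.2.1) (C.g_self z))
    (fun z w v ↦ congrArg (fun g ↦ g.2.1) (C.g_mul z w v))
  let E₂ : Bundle C.cover 2 := .ofUnits (fun z w ↦ (C.g z w).2.2)
    (fun z ↦ congrArg (fun g ↦ g.2.2) (C.g_self z))
    (fun z w v ↦ congrArg (fun g ↦ g.2.2) (C.g_mul z w v))
  let D : Datum Z :=
    { cover := C.cover
      on :=
        { L := L
          E₁ := E₁
          E₂ := E₂
          τ₁ := .ofUnits (fun z ↦ (C.x z).t₁) fun z w ↦ (hr z w).t₁.trans (Matrix.one_mul _).symm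
          τ₂ := .ofUnits (fun z ↦ (C.x z).t₂) fun z w ↦ (hr z w).t₂.trans (Matrix.one_mul _).symm
          i := ⟨fun z ↦ (C.x z).i, fun z w ↦ (hr z w).i⟩
          φ := ⟨fun z ↦ (C.x z).φ, fun z w ↦ (hr z w).φ⟩
          q := ⟨fun z ↦ (C.x z).q, fun z w ↦ (hr z w).q.trans (Matrix.one_mul _).symm⟩
          i_sub := hi
          q_quot := hq } }
  refine ⟨D, ?_⟩
  obtain ⟨𝒰, x, g, _, _⟩ := C
  refine Desc.mk_congr ?_
  funext z w
  exact Prod.ext (Units.ext rfl) (Prod.ext (Units.ext rfl) (Units.ext rfl))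

end

/-! ### Rigidity and gluing of data -/

section

variable {Z : Scheme.{u}}

theorem isUnit_of_isUnit_ent {R : Type*} [CommRing R] {M : Matrix (Fin 1) (Fin 1) R}
    (h : IsUnit (ent M)) : IsUnit M := by
  rw [Matrix.isUnit_iff_isUnit_det, Matrix.det_fin_one]
  exact h

theorem isUnit_res_of_germ {U : Z.Opens} (V : Z.Opens) (h : V ≤ U) (a : Γ(Z, U))
    (ha : ∀ z (hz : z ∈ V), IsUnit (germ z (h hz) a)) : IsUnit (res V h a) := by
  have hV : V ≤ Z.basicOpen a := fun z hz ↦ (Z.mem_basicOpen'' a z).mpr ⟨h hz, ha z hz⟩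
  have h₁ : IsUnit (res _ (Z.basicOpen_le a) a) := Z.toRingedSpace.isUnit_res_basicOpen a
  have := h₁.map (res V hV)
  rwa [res_res] at this

theorem LineMap.isUnit_s (D : LineMap Z) {z : Z} {V : Z.Opens} (h : V ≤ D.cover.U z)
    (hV : V ≤ D.isoLocus) : IsUnit (resM V h (D.on.s.m z)) := by
  refine isUnit_of_isUnit_ent (isUnit_res_of_germ V h _ fun w hw ↦ ?_)
  exact (D.on.associated z w (h hw)).isUnit_iff.mp ((D.mem_isoLocus w).mp (hV hw))

theorem LineMap.goodOn_isoLocus (D : LineMap Z) : D.toDesc.GoodOn D.isoLocus :=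
  fun _ _ h hV ↦ D.isUnit_s h hV

theorem Datum.goodOn_isoLocus (D : Datum Z) : D.toDesc.GoodOn D.toLineMap.isoLocus := by
  intro z V h hV
  have : ((D.localAt z).map (res V h)).s = _ := DatumAt.s_map _ _
  change IsUnit ((D.localAt z).map (res V h)).s
  rw [this]
  exact D.toLineMap.isUnit_s h hV

theorem Desc.GoodOn.mono {M : Model.{u}} {D : Desc M Z} {O O' : Z.Opens} (hD : D.GoodOn O)
    (h : O' ≤ O) : D.GoodOn O' :=
  fun z V hV hV' ↦ hD z V hV (hV'.trans h)

theorem iSup_cond_eq_top {U V : Z.Opens} (h : U ⊔ V = ⊤) : ⨆ b, cond b U V = ⊤ := by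
  rw [iSup_bool_eq, cond_true, cond_false, h]

theorem cond_inf_cond {U V : Z.Opens} {i j : Bool} (h : i ≠ j) :
    cond i U V ⊓ cond j U V = U ⊓ V := by
  cases i <;> cases j <;> simp_all [inf_comm]

/-- Isomorphisms of line bundles with a map to `𝒪` glue if the overlap does not meet the support
of the divisor. -/
theorem LineMap.equiv_of_pull {D D' : LineMap Z} {U V : Z.Opens} (hUV : U ⊔ V = ⊤)
    (hD : U ⊓ V ≤ D.isoLocus) (hU : (D.pull U.ι).Equiv (D'.pull U.ι))
    (hV : (D.pull V.ι).Equiv (D'.pull V.ι)) : D.Equiv D' := by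
  rw [equiv_iff, toDesc_pull, toDesc_pull] at hU hV
  refine equiv_iff.mpr (Desc.GoodOn.equiv_of_equivOn _ (iSup_cond_eq_top hUV) (fun i j hij ↦ ?_) ?_)
  · rw [cond_inf_cond hij]
    exact D.goodOn_isoLocus.mono hD
  · rintro (_ | _)
    exacts [hV.equivOn, hU.equivOn]

/-- Isomorphisms of data glue if the overlap does not meet the support of the divisor. -/
theorem Datum.equiv_of_pull {D D' : Datum Z} {U V : Z.Opens} (hUV : U ⊔ V = ⊤)
    (hD : U ⊓ V ≤ D.toLineMap.isoLocus) (hU : (D.pull U.ι).Equiv (D'.pull U.ι))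
    (hV : (D.pull V.ι).Equiv (D'.pull V.ι)) : D.Equiv D' := by
  rw [equiv_iff, toDesc_pull, toDesc_pull] at hU hV
  refine equiv_iff.mpr (Desc.GoodOn.equiv_of_equivOn _ (iSup_cond_eq_top hUV) (fun i j hij ↦ ?_) ?_)
  · rw [cond_inf_cond hij]
    exact D.goodOn_isoLocus.mono hD
  · rintro (_ | _)
    exacts [hV.equivOn, hU.equivOn]

/-- All line bundles with an isomorphism to `𝒪` are isomorphic. -/
theorem LineMap.equiv_of_isoLocus_eq_top {D D' : LineMap Z} (h : D.isoLocus = ⊤)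
    (h' : D'.isoLocus = ⊤) : D.Equiv D' := by
  refine equiv_iff.mpr (Desc.GoodOn.equiv (h ▸ D.goodOn_isoLocus) fun z ↦ ?_)
  have l : D.cover.U z ⊓ D'.cover.U z ≤ D.cover.U z := inf_le_left
  have l' : D.cover.U z ⊓ D'.cover.U z ≤ D'.cover.U z := inf_le_right
  obtain ⟨a, ha⟩ := D.isUnit_s l (h ▸ le_top)
  obtain ⟨a', ha'⟩ := D'.isUnit_s l' (h' ▸ le_top)
  refine ⟨⟨_, l, l', a'⁻¹ * a, ?_⟩, ⟨D.cover.mem z, D'.cover.mem z⟩⟩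
  change resM _ l' (D'.on.s.m z) * (a'⁻¹ * a).val = resM _ l (D.on.s.m z)
  rw [← ha, ← ha', ← Units.val_mul, mul_inv_cancel_left]

/-- The structure sheaf with its identity map, i.e. the zero divisor. -/
def LineMap.one (Z : Scheme.{u}) : LineMap Z where
  cover := ⟨fun _ ↦ ⊤, Opens.mem_top⟩
  on := ⟨Bundle.triv _ 1, BHom.id _⟩

theorem LineMap.isoLocus_one : (LineMap.one Z).isoLocus = ⊤ := by
  ext z
  refine iff_of_true (((LineMap.one Z).mem_isoLocus z).mpr ?_) trivial
  exact (isUnit_one).map (germ z _)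

theorem LineMap.tensor_one_equiv (D : LineMap Z) : (D.tensor (.one Z)).Equiv D := by
  have h : Cover.Refines (𝟙 Z) (D.tensor (.one Z)).cover D.cover := fun _ ↦ inf_le_left
  have e : (D.tensor (.one Z)).on = D.on.pull (𝟙 Z) _ h := by
    refine LineMapOn.ext' (Bundle.ext ?_) ?_
    · funext z w
      refine ent_injective ((ent_scalar _).trans ?_)
      refine (congrArg (HMul.hMul _) ?_).trans (mul_one _)
      exact map_one (pb (𝟙 Z) (U := ⊤ ⊓ ⊤) _ (le_inf le_top le_top))
    · funext z
      refine ent_injective ((ent_scalar _).trans ?_)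
      refine (congrArg (HMul.hMul _) ?_).trans (mul_one _)
      exact map_one (pb (𝟙 Z) (U := ⊤) _ le_top)
  refine ⟨_, fun _ ↦ le_rfl, h, ⟨(LineMapOn.Iso.refl _).cast ?_ rfl⟩⟩
  rw [e]
  exact (LineMapOn.pull_pull_id (𝟙 Z) _ _ _ D.on).symm

/-- Adding a divisor with empty support does not change a divisor. -/
theorem LineMap.tensor_equiv_left (D : LineMap Z) {E : LineMap Z} (h : E.isoLocus = ⊤) :
    (D.tensor E).Equiv D :=
  ((LineMap.Equiv.refl D).tensor (equiv_of_isoLocus_eq_top h isoLocus_one)).trans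
    D.tensor_one_equiv

theorem Datum.det_localAt (D : Datum Z) (z : Z) :
    (D.localAt z).det = res (D.cover.U z) le_top D.det := by
  refine Eq.trans ?_ (BHom.res_toSection ((D.on.τ₁.inv.comp D.on.φ.det).comp D.on.τ₂.hom) z).symm
  rw [BHom.comp_m, BHom.comp_m, ent_mul, ent_mul, BHom.det_m, ent_scalar]
  rfl

theorem Datum.det_xr (D : Datum Z) {z : Z} {V : Z.Opens} (h : V ≤ D.cover.U z) :
    DatumAt.det (D.toDesc.xr z V h) = res V le_top D.det := by
  refine (DatumAt.det_map _ _).trans ?_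
  change res V h (D.localAt z).det = _
  rw [det_localAt, res_res]

theorem Datum.exists_rel {D D' : Datum Z} (h : D.det = D'.det) {z w : Z} {V : Z.Opens}
    (hz : V ≤ D.cover.U z) (hw : V ≤ D'.cover.U w) (hV : V ≤ D.toLineMap.isoLocus)
    (hV' : V ≤ D'.toLineMap.isoLocus) :
    ∃ θ, datumModel.Rel θ (D.toDesc.xr z V hz) (D'.toDesc.xr w V hw) :=
  DatumAt.exists_rel (D.goodOn_isoLocus z V hz hV) (D'.goodOn_isoLocus w V hw hV')
    (by rw [det_xr, det_xr, h])

/-- Where the composite `L → 𝒪` is an isomorphism, a datum is determined by the determinant of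
`E₁ → E₂`. -/
theorem Datum.equiv_of_isoLocus_eq_top {D D' : Datum Z} (h : D.toLineMap.isoLocus = ⊤)
    (h' : D'.toLineMap.isoLocus = ⊤) (hd : D.det = D'.det) : D.Equiv D' := by
  refine equiv_iff.mpr (Desc.GoodOn.equiv (h ▸ D.goodOn_isoLocus) fun z ↦ ?_)
  have l : D.cover.U z ⊓ D'.cover.U z ≤ D.cover.U z := inf_le_left
  have l' : D.cover.U z ⊓ D'.cover.U z ≤ D'.cover.U z := inf_le_right
  obtain ⟨θ, hθ⟩ := exists_rel hd l l' (h ▸ le_top) (h' ▸ le_top)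
  exact ⟨⟨_, l, l', θ, hθ⟩, ⟨D.cover.mem z, D'.cover.mem z⟩⟩

/-- Data over two open subsets glue if their determinants agree and the overlap does not meet the
supports of the divisors. -/
theorem Datum.exists_glue {A B : Datum Z} {U V : Z.Opens} (hUV : U ⊔ V = ⊤)
    (hA : U ⊓ V ≤ A.toLineMap.isoLocus) (hB : U ⊓ V ≤ B.toLineMap.isoLocus)
    (hd : A.det = B.det) : ∃ C : Datum Z, (C.pull U.ι).Equiv (A.pull U.ι) ∧
      (C.pull V.ι).Equiv (B.pull V.ι) := by
  let D (b : Bool) : Datum Z := cond b A B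
  have hD (b : Bool) : U ⊓ V ≤ (D b).toLineMap.isoLocus := by cases b; exacts [hB, hA]
  have hdet (b b' : Bool) : (D b).det = (D b').det := by cases b <;> cases b' <;> simp [D, hd]
  obtain ⟨C, hC, hx⟩ := Desc.exists_glue (fun b ↦ (D b).toDesc) _ (iSup_cond_eq_top hUV)
    (fun i j hij ↦ by
      rw [cond_inf_cond hij]
      exact (D i).goodOn_isoLocus.mono (hD i))
    (fun i j hij z w W h k hW ↦ by
      rw [cond_inf_cond hij] at hW
      exact exists_rel (hdet j i) k h (hW.trans (hD j)) (hW.trans (hD i)))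
  obtain ⟨E, rfl⟩ := Datum.exists_toDesc_eq C
    (fun z ↦ by
      obtain ⟨b, h, hb⟩ := hx z
      obtain ⟨W, hW, N, hz, hN⟩ := (D b).on.i_sub z
      refine ⟨W ⊓ C.cover.U z, inf_le_right, resM _ inf_le_left N, ⟨hz, C.cover.mem z⟩, ?_⟩
      have := congrArg (resM (W ⊓ C.cover.U z) inf_le_left) hN
      rw [resM_mul, resM_one, resM_resM] at this
      rw [hb]
      refine Eq.trans (congrArg (_ * ·) ?_) this
      exact resM_resM (U := (D b).cover.U z) h inf_le_right _)
    (fun z ↦ by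
      obtain ⟨b, h, hb⟩ := hx z
      obtain ⟨W, hW, N, hz, hN⟩ := (D b).on.q_quot z
      refine ⟨W ⊓ C.cover.U z, inf_le_right, resM _ inf_le_left N, ⟨hz, C.cover.mem z⟩, ?_⟩
      have := congrArg (resM (W ⊓ C.cover.U z) inf_le_left) hN
      rw [resM_mul, resM_one, resM_resM] at this
      rw [hb]
      refine Eq.trans (congrArg (· * _) ?_) this
      exact resM_resM (U := (D b).cover.U z) h inf_le_right _)
  refine ⟨E, ?_, ?_⟩
  · rw [equiv_iff, toDesc_pull, toDesc_pull]
    exact (hC true).equiv_pull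
  · rw [equiv_iff, toDesc_pull, toDesc_pull]
    exact (hC false).equiv_pull

/-- The standard datum with a given determinant `d`: the sheaf `𝒪` as a direct summand of `𝒪²`,
the diagonal map `𝒪² → 𝒪²` with entries `1` and `d`, and the projection `𝒪² → 𝒪`. -/
theorem Datum.exists_std (d : Γ(Z, ⊤)) :
    ∃ D : Datum Z, D.toLineMap.isoLocus = ⊤ ∧ D.det = d := by
  let C : Desc datumModel Z :=
    { cover := ⟨fun _ ↦ ⊤, fun z ↦ Opens.mem_top z⟩
      x _ := DatumAt.std d
      g _ _ := 1
      rel _ _ := DatumAt.Rel.one _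
      g_mul _ _ _ := (map_mul _ _ _).symm.trans (congrArg _ (mul_one _)) }
  obtain ⟨D, hD⟩ := Datum.exists_toDesc_eq C
    (fun z ↦ ⟨⊤, le_rfl, !![1, 0], trivial, by
      rw [resM_self]
      change !![1, 0] * !![1; 0] = 1
      ext i j
      fin_cases i; fin_cases j
      simp [Matrix.mul_apply]⟩)
    (fun z ↦ ⟨⊤, le_rfl, !![1; 0], trivial, by
      rw [resM_self]
      change !![1, 0] * !![1; 0] = 1
      ext i j
      fin_cases i; fin_cases j
      simp [Matrix.mul_apply]⟩)
  have hs : ∀ z, ent (DatumAt.s (C.x z)) = 1 := fun z ↦ by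
    change ent (DatumAt.s (DatumAt.std d)) = 1
    simp [DatumAt.s, ent, Matrix.mul_apply]
  have hdet : ∀ z, res (C.cover.U z) le_top d = DatumAt.det (C.x z) := fun z ↦ by
    change res ⊤ le_top d = DatumAt.det (DatumAt.std d)
    simp [DatumAt.det]
  rw [← hD] at hs hdet
  refine ⟨D, ?_, (BHom.eq_toSection _ _ fun z ↦ ?_).symm⟩
  · ext z
    refine iff_of_true ((D.toLineMap.mem_isoLocus z).mpr ?_) trivial
    have : D.toLineMap.eqn z = germ z _ (ent (DatumAt.s (D.toDesc.x z))) := rfl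
    rw [this, hs, map_one]
    exact isUnit_one
  · refine (hdet z).trans ?_
    rw [BHom.comp_m, BHom.comp_m, ent_mul, ent_mul, BHom.det_m, ent_scalar]
    rfl

end

/-! ### Sums of data with disjoint divisors -/

section

variable {Z Z' : Scheme.{u}}

theorem LineMap.tensor_comm_equiv (D E : LineMap Z) : (D.tensor E).Equiv (E.tensor D) := by
  let 𝒲 := (D.tensor E).cover
  have k : Cover.Refines (𝟙 Z) 𝒲 (E.tensor D).cover := fun z ↦ (inf_comm _ _).le
  have l : Cover.Refines (𝟙 Z) 𝒲 D.cover := fun z ↦ inf_le_left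
  have l' : Cover.Refines (𝟙 Z) 𝒲 E.cover := fun z ↦ inf_le_right
  have h₁ : (D.tensor E).on.pull (𝟙 Z) 𝒲 (fun _ ↦ le_rfl) =
      (D.on.pull (𝟙 Z) 𝒲 l).tensor (E.on.pull (𝟙 Z) 𝒲 l') :=
    (LineMapOn.pull_tensor (𝟙 Z) 𝒲 _ _ _).trans (congrArg₂ LineMapOn.tensor
      (LineMapOn.pull_id_pull (𝟙 Z) _ _ l D.on) (LineMapOn.pull_id_pull (𝟙 Z) _ _ l' E.on))
  have h₂ : (E.tensor D).on.pull (𝟙 Z) 𝒲 k =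
      (E.on.pull (𝟙 Z) 𝒲 l').tensor (D.on.pull (𝟙 Z) 𝒲 l) :=
    (LineMapOn.pull_tensor (𝟙 Z) 𝒲 k _ _).trans (congrArg₂ LineMapOn.tensor
      (LineMapOn.pull_id_pull (𝟙 Z) _ _ l' E.on) (LineMapOn.pull_id_pull (𝟙 Z) _ _ l D.on))
  have h₃ : (D.on.pull (𝟙 Z) 𝒲 l).tensor (E.on.pull (𝟙 Z) 𝒲 l') =
      (E.on.pull (𝟙 Z) 𝒲 l').tensor (D.on.pull (𝟙 Z) 𝒲 l) := by
    refine LineMapOn.ext' (Bundle.ext ?_) ?_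
    · funext z w
      exact congrArg (Matrix.scalar (Fin 1)) (mul_comm _ _)
    · funext z
      exact congrArg (Matrix.scalar (Fin 1)) (mul_comm _ _)
  exact ⟨𝒲, fun _ ↦ le_rfl, k, ⟨(LineMapOn.Iso.refl _).cast rfl ((h₁.trans h₃).trans h₂.symm)⟩⟩

theorem LineMap.isoLocus_pull_ι {D : LineMap Z} {U : Z.Opens} (h : U ≤ D.isoLocus) :
    (D.pull U.ι).isoLocus = ⊤ := by
  rw [isoLocus_pull]
  ext z
  exact iff_of_true (h z.2) trivial

theorem LineMap.mem_isoLocus_iff_of_pull {D D' : LineMap Z} {U : Z.Opens}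
    (h : (D.pull U.ι).Equiv (D'.pull U.ι)) {z : Z} (hz : z ∈ U) :
    z ∈ D.isoLocus ↔ z ∈ D'.isoLocus := by
  have := h.isoLocus
  rw [isoLocus_pull, isoLocus_pull] at this
  exact Set.ext_iff.mp (Opens.ext_iff.mp this) ⟨z, hz⟩

theorem Datum.Equiv.toLineMap_pull {D D' : Datum Z} {f : Z' ⟶ Z}
    (h : (D.pull f).Equiv (D'.pull f)) : (D.toLineMap.pull f).Equiv (D'.toLineMap.pull f) := by
  rw [← Datum.toLineMap_pull, ← Datum.toLineMap_pull]
  exact h.toLineMap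

theorem Datum.Equiv.res_det {D D' : Datum Z} {U : Z.Opens}
    (h : (D.pull U.ι).Equiv (D'.pull U.ι)) : res U le_top D.det = res U le_top D'.det := by
  have := h.det_eq
  rw [det_pull, det_pull] at this
  have hU : U ≤ U.ι ''ᵁ (⊤ : U.toScheme.Opens) := by simp
  have h' := congrArg (ofOpen U hU) this
  have e (a : Γ(Z, ⊤)) : ofOpen U hU (U.ι.appTop.hom a) = res U le_top a := by
    have h : U.ι.appTop.hom a = pb U.ι (U := ⊤) ⊤ le_top a :=
      congrArg (fun g ↦ g.hom a) (Scheme.Hom.appLE_eq_app (f := U.ι) (U := ⊤)).symm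
    rw [h]
    exact congrArg (fun f ↦ f a) (ofOpen_comp_pb (O := ⊤) hU le_top)
  rwa [e, e] at h'

theorem eq_of_res_eq {U V : Z.Opens} (hUV : U ⊔ V = ⊤) {a b : Γ(Z, ⊤)}
    (hU : res U le_top a = res U le_top b) (hV : res V le_top a = res V le_top b) : a = b := by
  refine Z.sheaf.eq_of_locally_eq' (fun i ↦ cond i U V) ⊤ (fun i ↦ homOfLE le_top)
    (iSup_cond_eq_top hUV).ge a b ?_
  rintro (_ | _)
  exacts [hV, hU]

theorem Datum.det_eq_of_pull {A B C : Datum Z} {U V : Z.Opens} (hUV : U ⊔ V = ⊤)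
    (hd : A.det = B.det) (hU : (C.pull U.ι).Equiv (A.pull U.ι))
    (hV : (C.pull V.ι).Equiv (B.pull V.ι)) : C.det = A.det :=
  eq_of_res_eq hUV hU.res_det (hd ▸ hV.res_det)

/-- Away from the second divisor, the sum of two divisors is the first one. -/
theorem LineMap.tensor_pull_equiv (D E : LineMap Z) :
    ((D.tensor E).pull E.isoLocus.ι).Equiv (D.pull E.isoLocus.ι) := by
  rw [pull_tensor]
  exact (D.pull _).tensor_equiv_left (isoLocus_pull_ι le_rfl)

namespace Datum

variable {A B C : Datum Z}

/-- The divisor of a sum of two data is the sum of the divisors. -/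
theorem toLineMap_equiv_tensor (h : A.toLineMap.isoLocus ⊔ B.toLineMap.isoLocus = ⊤)
    (hA : (C.pull B.toLineMap.isoLocus.ι).Equiv (A.pull B.toLineMap.isoLocus.ι))
    (hB : (C.pull A.toLineMap.isoLocus.ι).Equiv (B.pull A.toLineMap.isoLocus.ι)) :
    C.toLineMap.Equiv (A.toLineMap.tensor B.toLineMap) := by
  refine LineMap.equiv_of_pull h (fun z hz ↦ ?_) ?_ ?_
  · exact (LineMap.mem_isoLocus_iff_of_pull hB.toLineMap_pull hz.1).mpr hz.2
  · refine hB.toLineMap_pull.trans (LineMap.Equiv.trans ?_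
      ((A.toLineMap.tensor_comm_equiv B.toLineMap).pull _).symm)
    exact (LineMap.tensor_pull_equiv _ _).symm
  · exact hA.toLineMap_pull.trans (LineMap.tensor_pull_equiv _ _).symm

/-- A sum of two data is unique. -/
theorem equiv_of_pull_equiv {C' : Datum Z} (h : A.toLineMap.isoLocus ⊔ B.toLineMap.isoLocus = ⊤)
    (hA : (C.pull B.toLineMap.isoLocus.ι).Equiv (A.pull B.toLineMap.isoLocus.ι))
    (hB : (C.pull A.toLineMap.isoLocus.ι).Equiv (B.pull A.toLineMap.isoLocus.ι))
    (hA' : (C'.pull B.toLineMap.isoLocus.ι).Equiv (A.pull B.toLineMap.isoLocus.ι))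
    (hB' : (C'.pull A.toLineMap.isoLocus.ι).Equiv (B.pull A.toLineMap.isoLocus.ι)) :
    C.Equiv C' :=
  equiv_of_pull h
    (fun _ hz ↦ (LineMap.mem_isoLocus_iff_of_pull hB.toLineMap_pull hz.1).mpr hz.2)
    (hB.trans hB'.symm) (hA.trans hA'.symm)

/-- A datum whose divisor is the sum of two disjoint divisors has a summand with the first
divisor: away from the second divisor it is the given datum, and away from the first divisor it is
a standard datum. -/
theorem exists_summand {D E : LineMap Z} (h : D.isoLocus ⊔ E.isoLocus = ⊤)
    (hC : C.toLineMap.Equiv (D.tensor E)) : ∃ A : Datum Z, A.toLineMap.Equiv D ∧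
      A.det = C.det ∧ (A.pull E.isoLocus.ι).Equiv (C.pull E.isoLocus.ι) := by
  obtain ⟨B, hB, hd⟩ := exists_std C.det
  rw [sup_comm] at h
  have hC' : E.isoLocus ⊓ D.isoLocus ≤ C.toLineMap.isoLocus := by
    rw [hC.isoLocus, LineMap.isoLocus_tensor, inf_comm]
  obtain ⟨A, hA, hA'⟩ := exists_glue h hC' (hB ▸ le_top) hd.symm
  have h' : D.isoLocus ≤ A.toLineMap.isoLocus := fun z hz ↦
    (LineMap.mem_isoLocus_iff_of_pull hA'.toLineMap_pull hz).mpr (hB ▸ Opens.mem_top z)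
  refine ⟨A, LineMap.equiv_of_pull h (inf_le_right.trans h') ?_ ?_, det_eq_of_pull h hd.symm hA hA',
    hA⟩
  · exact hA.toLineMap_pull.trans ((hC.pull _).trans (LineMap.tensor_pull_equiv _ _))
  · exact LineMap.equiv_of_isoLocus_eq_top (LineMap.isoLocus_pull_ι h')
      (LineMap.isoLocus_pull_ι le_rfl)

/-- A datum is determined by its determinant, its divisor, and its restriction to a neighbourhood
of the divisor. -/
theorem equiv_of_toLineMap_equiv {U : Z.Opens} (h : A.toLineMap.isoLocus ⊔ U = ⊤)
    (hs : A.toLineMap.Equiv B.toLineMap) (hd : A.det = B.det)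
    (hU : (A.pull U.ι).Equiv (B.pull U.ι)) : A.Equiv B := by
  refine equiv_of_pull h inf_le_left ?_ hU
  refine equiv_of_isoLocus_eq_top ?_ ?_ (by rw [det_pull, det_pull, hd])
  · rw [toLineMap_pull]
    exact LineMap.isoLocus_pull_ι le_rfl
  · rw [toLineMap_pull]
    exact LineMap.isoLocus_pull_ι hs.isoLocus.le

theorem Equiv.pull_preimage {D D' : Datum Z} {U : Z.Opens} (h : (D.pull U.ι).Equiv (D'.pull U.ι))
    (f : Z' ⟶ Z) : ((D.pull f).pull (f ⁻¹ᵁ U).ι).Equiv ((D'.pull f).pull (f ⁻¹ᵁ U).ι) := by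
  rw [← pull_comp, ← pull_comp, ← morphismRestrict_ι, pull_comp, pull_comp]
  exact h.pull _

end Datum

end

/-! ### The gluing morphism -/

section

variable {k : Type u} [Field k] {X : Over (Spec (.of k))}

theorem LineMap.Equiv.hasRelDegree {S : Over (Spec (.of k))} {D D' : LineMap (prod X S)} {n : ℕ}
    (e : D.Equiv D') (h : D.HasRelDegree n) : D'.HasRelDegree n := by
  intro Ω _ _ a s
  have e' := e.pull (prodMap X s)
  exact ⟨e'.isoLocus ▸ (h Ω a s).1, e'.hasDegree (h Ω a s).2⟩

instance nonempty_prod [Nonempty X.left] (Ω : Type u) [Field Ω]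
    (a : Spec (.of Ω) ⟶ Spec (.of k)) : Nonempty (prod X (Over.mk a)) := by
  obtain ⟨x⟩ := ‹Nonempty X.left›
  have hk : Subsingleton (Spec (.of k)) := inferInstanceAs (Subsingleton (PrimeSpectrum k))
  obtain ⟨y⟩ : Nonempty (Spec (.of Ω)) := inferInstanceAs (Nonempty (PrimeSpectrum Ω))
  obtain ⟨z, -⟩ := Scheme.Pullback.exists_preimage_pullback (f := X.hom) (g := a) x y
    (Subsingleton.elim _ _)
  exact ⟨z⟩

/-- If the composite `L → 𝒪` is generically an isomorphism on the geometric fibers, the map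
`E₁ → E₂` is nonzero on them, since the fibers are nonempty. -/
theorem Datum.isNonzeroOnFibers [Nonempty X.left] {S : Over (Spec (.of k))} {D : Datum (prod X S)}
    {n : ℕ} (h : D.toLineMap.HasRelDegree n) : D.IsNonzeroOnFibers := by
  intro Ω _ _ a s
  obtain ⟨z, hz⟩ := (h Ω a s).1.nonempty
  rw [← toLineMap_pull] at hz
  have hu := (LineMap.mem_isoLocus _ z).mp hz
  refine ⟨z, fun h0 ↦ not_isUnit_zero (M₀ := (prod X (Over.mk a)).presheaf.stalk z) ?_⟩
  set E := D.pull (prodMap X s)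
  have e : E.toLineMap.eqn z = ent (((E.on.q.m z) * (E.on.φ.m z * E.on.i.m z)).map
    (germ z (E.cover.mem z))) := rfl
  rw [e, Matrix.map_mul, Matrix.map_mul, h0, Matrix.zero_mul, Matrix.mul_zero] at hu
  exact hu

theorem Y_induction [Nonempty X.left] {S : (Over (Spec (.of k)))ᵒᵖ} {n : ℕ}
    {P : (Y X n).obj S → Prop}
    (h : ∀ (D : Datum (prod X S.unop)) (hD : D.toLineMap.HasRelDegree n),
      P ⟨Quotient.mk _ D, D, ⟨Datum.isNonzeroOnFibers hD, hD⟩, rfl⟩) (y : (Y X n).obj S) : P y := by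
  obtain ⟨_, D, ⟨-, hD⟩, rfl⟩ := y
  exact h D hD

variable [IsAlgClosed k] [IsProper X.hom] [IsIntegral X.left]

theorem descend_injective {S : Over (Spec (.of k))} :
    Function.Injective (descend X (S := S)) := fun a b h ↦ by
  rw [← appTop_descend X a, h, appTop_descend]

variable {n₁ n₂ : ℕ} {S : (Over (Spec (.of k)))ᵒᵖ}

/-- The datum `y` is isomorphic to the first component of `p` away from the divisor of the second
one, and vice versa. -/
def IsSum (p : (fiberProd X n₁ n₂).obj S) (y : (Y X (n₁ + n₂)).obj S) : Prop :=
  restrict (locus ((π X n₂).app S p.1.2).1) y.1 =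
      restrict (locus ((π X n₂).app S p.1.2).1) p.1.1.1 ∧
    restrict (locus ((π X n₁).app S p.1.1).1) y.1 =
      restrict (locus ((π X n₁).app S p.1.1).1) p.1.2.1

theorem restrict_mk {Z : Scheme.{u}} {D D' : Datum Z} {U : Z.Opens} :
    restrict U (Quotient.mk _ D) = restrict U (Quotient.mk _ D') ↔
      (D.pull U.ι).Equiv (D'.pull U.ι) :=
  Quotient.eq

theorem fiberProd_induction {P : (fiberProd X n₁ n₂).obj S → Prop}
    (h : ∀ (A B : Datum (prod X S.unop)) (hA : A.toLineMap.HasRelDegree n₁)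
      (hB : B.toLineMap.HasRelDegree n₂) (hd : A.det = B.det)
      (hAB : A.toLineMap.isoLocus ⊔ B.toLineMap.isoLocus = ⊤),
      P ⟨(⟨Quotient.mk _ A, A, ⟨Datum.isNonzeroOnFibers hA, hA⟩, rfl⟩,
        ⟨Quotient.mk _ B, B, ⟨Datum.isNonzeroOnFibers hB, hB⟩, rfl⟩),
          congrArg (descend X) hd, hAB⟩) (p : (fiberProd X n₁ n₂).obj S) : P p := by
  obtain ⟨⟨⟨_, A, ⟨-, hA⟩, rfl⟩, ⟨_, B, ⟨-, hB⟩, rfl⟩⟩, hd, hAB⟩ := p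
  exact h A B hA hB (descend_injective hd) hAB

theorem existsUnique_isSum (p : (fiberProd X n₁ n₂).obj S) : ∃! y, IsSum p y := by
  induction p using fiberProd_induction with | h A B hA hB hd hAB
  obtain ⟨C, hC, hC'⟩ := Datum.exists_glue ((sup_comm _ _).trans hAB) inf_le_right inf_le_left hd
  have hs := Datum.toLineMap_equiv_tensor hAB hC hC'
  have hr := hs.symm.hasRelDegree (hA.tensor hB hAB)
  refine ⟨⟨Quotient.mk _ C, C, ⟨Datum.isNonzeroOnFibers hr, hr⟩, rfl⟩,
    ⟨restrict_mk.mpr hC, restrict_mk.mpr hC'⟩, fun y hy ↦ ?_⟩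
  induction y using Y_induction with | h C' hr'
  exact Subtype.ext (Quotient.sound (Datum.equiv_of_pull_equiv hAB
    (restrict_mk.mp hy.1) (restrict_mk.mp hy.2) hC hC'))

theorem IsSum.map {p : (fiberProd X n₁ n₂).obj S} {y : (Y X (n₁ + n₂)).obj S} (h : IsSum p y)
    {S' : (Over (Spec (.of k)))ᵒᵖ} (f : S ⟶ S') :
    IsSum ((fiberProd X n₁ n₂).map f p) ((Y X (n₁ + n₂)).map f y) := by
  induction p using fiberProd_induction with | h A B hA hB hd hAB
  induction y using Y_induction with | h C hC
  have e (D : Datum (prod X S.unop)) : (D.pull (prodMap X f.unop)).toLineMap.isoLocus =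
      prodMap X f.unop ⁻¹ᵁ D.toLineMap.isoLocus := by
    rw [Datum.toLineMap_pull, LineMap.isoLocus_pull]
  constructor
  · refine (restrict_mk (U := (B.pull (prodMap X f.unop)).toLineMap.isoLocus)).mpr ?_
    rw [e]
    exact (restrict_mk.mp h.1).pull_preimage _
  · refine (restrict_mk (U := (A.pull (prodMap X f.unop)).toLineMap.isoLocus)).mpr ?_
    rw [e]
    exact (restrict_mk.mp h.2).pull_preimage _

variable (X n₁ n₂) in
/-- The gluing morphism `t`, which takes two data with the same determinant and disjoint divisors
to their sum. -/
def glue : fiberProd X n₁ n₂ ⟶ Y X (n₁ + n₂) where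
  app S := ↾fun p ↦ (existsUnique_isSum p).choose
  naturality S S' f := by
    ext p
    exact ((existsUnique_isSum _).choose_spec.2 _
      ((existsUnique_isSum p).choose_spec.1.map f)).symm

theorem isSum_glue (p : (fiberProd X n₁ n₂).obj S) : IsSum p ((glue X n₁ n₂).app S p) :=
  (existsUnique_isSum p).choose_spec.1

theorem IsSum.eq_glue {p : (fiberProd X n₁ n₂).obj S} {y : (Y X (n₁ + n₂)).obj S}
    (h : IsSum p y) : (glue X n₁ n₂).app S p = y :=
  ((existsUnique_isSum p).choose_spec.2 y h).symm

theorem IsSum.π_eq {p : (fiberProd X n₁ n₂).obj S} {y : (Y X (n₁ + n₂)).obj S} (h : IsSum p y) :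
    (π X (n₁ + n₂)).app S y = (add X n₁ n₂).app S ((fiberProdπ X n₁ n₂).app S p) := by
  induction p using fiberProd_induction with | h A B hA hB hd hAB
  induction y using Y_induction with | h C hC
  exact Subtype.ext (Quotient.sound
    (Datum.toLineMap_equiv_tensor hAB (restrict_mk.mp h.1) (restrict_mk.mp h.2)))

theorem IsSum.v_eq {p : (fiberProd X n₁ n₂).obj S} {y : (Y X (n₁ + n₂)).obj S} (h : IsSum p y) :
    (v X (n₁ + n₂)).app S y = (fiberProdv X n₁ n₂).app S p := by
  induction p using fiberProd_induction with | h A B hA hB hd hAB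
  induction y using Y_induction with | h C hC
  exact congrArg (descend X) (Datum.det_eq_of_pull ((sup_comm _ _).trans hAB) hd
    (restrict_mk.mp h.1) (restrict_mk.mp h.2))

/-- The two summands are determined by the sum and by their divisors. -/
theorem IsSum.eq {p p' : (fiberProd X n₁ n₂).obj S} {y : (Y X (n₁ + n₂)).obj S} (h : IsSum p y)
    (h' : IsSum p' y) (hp : (fiberProdπ X n₁ n₂).app S p = (fiberProdπ X n₁ n₂).app S p') :
    p = p' := by
  have hv := h.v_eq.symm.trans h'.v_eq
  induction p using fiberProd_induction with | h A B hA hB hd hAB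
  induction p' using fiberProd_induction with | h A' B' hA' hB' hd' hAB'
  induction y using Y_induction with | h C hC
  have hv : A.det = A'.det := descend_injective hv
  have hsA : A.toLineMap.Equiv A'.toLineMap := Quotient.exact (congrArg (fun q ↦ q.1.1.1) hp)
  have hsB : B.toLineMap.Equiv B'.toLineMap := Quotient.exact (congrArg (fun q ↦ q.1.2.1) hp)
  have hCA := restrict_mk.mp h.1
  have hCB := restrict_mk.mp h.2
  have hCA' : (C.pull B'.toLineMap.isoLocus.ι).Equiv (A'.pull B'.toLineMap.isoLocus.ι) :=
    restrict_mk.mp h'.1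
  have hCB' : (C.pull A'.toLineMap.isoLocus.ι).Equiv (B'.pull A'.toLineMap.isoLocus.ι) :=
    restrict_mk.mp h'.2
  rw [← hsB.isoLocus] at hCA'
  rw [← hsA.isoLocus] at hCB'
  have hAA' : A.Equiv A' := Datum.equiv_of_toLineMap_equiv hAB hsA hv (hCA.symm.trans hCA')
  have hBB' : B.Equiv B' := Datum.equiv_of_toLineMap_equiv ((sup_comm _ _).trans hAB) hsB
    (hd.symm.trans (hv.trans hd')) (hCB.symm.trans hCB')
  exact Subtype.ext (Prod.ext (Subtype.ext (Quotient.sound hAA'))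
    (Subtype.ext (Quotient.sound hBB')))

/-- A datum whose divisor is the sum of two disjoint divisors is a sum of two data with these
divisors. -/
theorem exists_isSum {y : (Y X (n₁ + n₂)).obj S} {d : (disj X n₁ n₂).obj S}
    (h : (π X (n₁ + n₂)).app S y = (add X n₁ n₂).app S d) :
    ∃ p, IsSum p y ∧ (fiberProdπ X n₁ n₂).app S p = d := by
  induction y using Y_induction with | h C hC
  obtain ⟨⟨⟨_, D, hD, rfl⟩, ⟨_, E, hE, rfl⟩⟩, hDE⟩ := d
  have hDE : D.isoLocus ⊔ E.isoLocus = ⊤ := hDE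
  have hs : C.toLineMap.Equiv (D.tensor E) := Quotient.exact (congrArg Subtype.val h)
  obtain ⟨A, hA, hdA, hAC⟩ := Datum.exists_summand hDE hs
  obtain ⟨B, hB, hdB, hBC⟩ := Datum.exists_summand ((sup_comm _ _).trans hDE)
    (hs.trans (D.tensor_comm_equiv E))
  rw [← hB.isoLocus] at hAC
  rw [← hA.isoLocus] at hBC
  have hrA := hA.symm.hasRelDegree hD
  have hrB := hB.symm.hasRelDegree hE
  refine ⟨⟨(⟨Quotient.mk _ A, A, ⟨Datum.isNonzeroOnFibers hrA, hrA⟩, rfl⟩,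
    ⟨Quotient.mk _ B, B, ⟨Datum.isNonzeroOnFibers hrB, hrB⟩, rfl⟩),
      congrArg (descend X) (hdA.trans hdB.symm), ?_⟩,
    ⟨restrict_mk.mpr hAC.symm, restrict_mk.mpr hBC.symm⟩, ?_⟩
  · change A.toLineMap.isoLocus ⊔ B.toLineMap.isoLocus = ⊤
    rw [hA.isoLocus, hB.isoLocus, hDE]
  · exact Subtype.ext (Prod.ext (Subtype.ext (Quotient.sound hA)) (Subtype.ext (Quotient.sound hB)))

variable (X n₁ n₂)

theorem isPullback_glue :
    IsPullback (glue X n₁ n₂) (fiberProdπ X n₁ n₂) (π X (n₁ + n₂)) (add X n₁ n₂) := by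
  refine .of_forall_isPullback_app fun S ↦ (Types.isPullback_iff _ _ _ _).mpr ⟨?_, ?_, ?_⟩
  · ext p
    exact (isSum_glue p).π_eq
  · rintro p p' ⟨h, h'⟩
    exact IsSum.eq (isSum_glue p) (h ▸ isSum_glue p') h'
  · intro y d h
    obtain ⟨p, hp, hpd⟩ := exists_isSum h
    exact ⟨p, hp.eq_glue, hpd⟩

/-- The restriction of the gluing morphism to the fibers over a scalar. -/
def glueFiber (c : k) : prodFiber X n₁ n₂ c ⟶ Yc X (n₁ + n₂) c :=
  Subfunctor.lift (prodFiberι X n₁ n₂ c ≫ glue X n₁ n₂) (by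
    rintro S _ ⟨p, rfl⟩
    exact (isSum_glue ((prodFiberι X n₁ n₂ c).app S p)).v_eq.trans p.1.1.2)

theorem isPullback_glueFiber (c : k) : IsPullback (glueFiber X n₁ n₂ c) (prodFiberπ X n₁ n₂ c)
    ((fiberSub X (n₁ + n₂) c).ι ≫ π X (n₁ + n₂)) (add X n₁ n₂) := by
  refine .of_forall_isPullback_app fun S ↦ (Types.isPullback_iff _ _ _ _).mpr ⟨?_, ?_, ?_⟩
  · ext p
    exact (isSum_glue ((prodFiberι X n₁ n₂ c).app S p)).π_eq
  · rintro p p' ⟨h, h'⟩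
    have h : (glue X n₁ n₂).app S ((prodFiberι X n₁ n₂ c).app S p) =
        (glue X n₁ n₂).app S ((prodFiberι X n₁ n₂ c).app S p') := congrArg Subtype.val h
    have e := IsSum.eq (p' := (prodFiberι X n₁ n₂ c).app S p')
      (isSum_glue ((prodFiberι X n₁ n₂ c).app S p)) (h ▸ isSum_glue _) h'
    exact Subtype.ext (Prod.ext (Subtype.ext (congrArg (fun q ↦ q.1.1) e))
      (Subtype.ext (congrArg (fun q ↦ q.1.2) e)))
  · intro y d h
    obtain ⟨p, hp, hpd⟩ := exists_isSum (y := y.1) (d := d) h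
    have hc : (v X n₁).app S p.1.1 = const c S.unop := hp.v_eq.symm.trans y.2
    exact ⟨⟨(⟨p.1.1, hc⟩, ⟨p.1.2, p.2.1.symm.trans hc⟩), p.2.2⟩, Subtype.ext hp.eq_glue, hpd⟩

end

end

end VinLoc

theorem mainTheorem8 {k : Type u} [Field k] [IsAlgClosed k] (X : Over (Spec (.of k)))
    [IsProper X.hom] [SmoothOfRelativeDimension 1 X.hom] [AlgebraicGeometry.IsIntegral X.left]
    (n₁ n₂ : ℕ) :
    ∃ t : VinLoc.fiberProd X n₁ n₂ ⟶ VinLoc.Y X (n₁ + n₂),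
      IsPullback t (VinLoc.fiberProdπ X n₁ n₂) (VinLoc.π X (n₁ + n₂)) (VinLoc.add X n₁ n₂) ∧
      t ≫ VinLoc.v X (n₁ + n₂) = VinLoc.fiberProdv X n₁ n₂ ∧
      (∀ (S : (Over (Spec (.of k)))ᵒᵖ) (p : (VinLoc.fiberProd X n₁ n₂).obj S),
        VinLoc.restrict (VinLoc.locus ((VinLoc.π X n₂).app S p.1.2).1) (t.app S p).1 =
          VinLoc.restrict (VinLoc.locus ((VinLoc.π X n₂).app S p.1.2).1) p.1.1.1 ∧
        VinLoc.restrict (VinLoc.locus ((VinLoc.π X n₁).app S p.1.1).1) (t.app S p).1 =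
          VinLoc.restrict (VinLoc.locus ((VinLoc.π X n₁).app S p.1.1).1) p.1.2.1) ∧
      ∀ c : k, ∃ t' : VinLoc.prodFiber X n₁ n₂ c ⟶ VinLoc.Yc X (n₁ + n₂) c,
        IsPullback t' (VinLoc.prodFiberπ X n₁ n₂ c)
          ((VinLoc.fiberSub X (n₁ + n₂) c).ι ≫ VinLoc.π X (n₁ + n₂)) (VinLoc.add X n₁ n₂) ∧
        t' ≫ (VinLoc.fiberSub X (n₁ + n₂) c).ι = VinLoc.prodFiberι X n₁ n₂ c ≫ t := by
  refine ⟨VinLoc.glue X n₁ n₂, VinLoc.isPullback_glue X n₁ n₂, ?_,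
    fun S p ↦ VinLoc.isSum_glue p, fun c ↦
      ⟨VinLoc.glueFiber X n₁ n₂ c, VinLoc.isPullback_glueFiber X n₁ n₂ c, Subfunctor.lift_ι _ _⟩⟩
  ext S p
  exact (VinLoc.isSum_glue p).v_eq
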